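/- **Setting.** Let $D=(V,A)$ be a finite digraph (parallel arcs allowed) with arc weights $w:A\to\mathbb{R}_{\ge 0}$; the unweighted case is $w\equiv 1$. An $r$-arborescence is a set $B\subseteq A$ without cycles that has in-degree $0$ at $r$ and in-degree $1$ at every other node. Let $\mathcal{L}$ be a laminar family of non-empty subsets of $V$ with $V\in\mathcal{L}$. An $r$-arborescence $B$ is $\mathcal{L}$-tight if it enters every $F\in\mathcal{L}$ at most once and does not enter any $F\in\mathcal{L}$ containing its root $r$. Let $\gamma(D,\mathcal{L})$ be the minimum of $w(H)=\sum_{a\in H}w(a)$ over the sets $H\subseteq A$ that intersect every $\mathcal{L}$-tight arborescence of $D$ (of any root), with $\gamma=+\infty$ if there is no such $H$. For a digraph $G$ with arc weights let $\varrho_G(Z)$ be the total weight of the arcs entering $Z$, and let $\mu(G)$ be the minimum of $\varrho_G(Z_1)+\varrho_G(Z_2)$ over disjoint non-empty sets $Z_1,Z_2$ of nodes of $G$ ($+\infty$ if $G$ has only one node). An anchor node of $G$ is a node $t$ such that $\varrho_G(Z)\ge\mu(G)/2$ for every non-empty set $Z$ of nodes not containing $t$. $G[F]$ denotes the sub-digraph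 induced by $F$. **Algorithm COVERING_TIGHT_ARBORESCENCES.** Start with $D'=D$ and $\mathcal{L}'=\mathcal{L}$. While $\mathcal{L}'\neq\emptyset$: choose an inclusionwise minimal $F\in\mathcal{L}'$ and an anchor node $a_F\in F$ of $D'[F]$, relocate the tail of every arc of $D'$ leaving $F$ to $a_F$, and remove $F$ from $\mathcal{L}'$. For the resulting $D'$ and each $a\in V$, let $D_a$ be obtained from $D'$ by relocating to $a$ the tail of every arc that leaves some $F\in\mathcal{L}$ with $a\in F$. Return the minimum of the numbers $\mu(D'[F])$ for $F\in\mathcal{L}$ and $\mu(D_a[F])$ for $F\in\mathcal{L}$, $a\in F$. **Theorem.** 1. *(Correctness)* The algorithm can always be carried out (in every state that it can reach, an anchor node exists for every possible choice of $F$, and the first phase can be completed), and, whatever choices are made, the returned value is $\gamma(D,\mathcal{L})$. 2. *(Running time, tight arborescences)* There is an algorithm that, given a digraph $D$ with $n$ nodes and $m$ arcs, $w$ and $\mathcal{L}$ as above (each member of $\mathcal{L}$ listed once), finds in $O(n^3\,T(n,m))$ steps a minimum weight set $H$ of arcs that intersects every $\mathcal{L}$-tight arborescence, if there is any set intersecting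 all of them. 3. *(Running time, minimum cost arborescences)* There is an algorithm that, given a digraph $D$ with $n$ nodes and $m$ arcs, a root $r$, arbitrary real arc costs $c$ and non-negative arc weights $w$, finds in $O(n^3\,T(n,m))$ steps a minimum weight set $H$ of arcs that intersects every minimum $c$-cost $r$-arborescence, if there is any set intersecting all of them. In 2 and 3 an algorithm is a program on a RAM with natural number and real registers, whose elementary steps are access to array cells, addition, subtraction, comparison and branching, and which may in addition call a subroutine returning an arbitrary minimum $s$-$t$ cut of a given capacitated digraph, a call on $N$ nodes and $M$ arcs counting as $T(N,M)$ steps. Here $T$ is any function that is non-decreasing in both arguments and satisfies $T(N,M)\ge N+M$, and $T(2N,2M+N)\le K\,T(N,M)$ whenever $M\ge N-1$, for some constant $K$. The programs depend neither on $T$ nor on the cut subroutine, and the constant in the $O$ depends only on $K$. In particular the number of steps is bounded by a polynomial in $n$ and $m$ whenever $T$ is. -/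

import Mathlib

open scoped NNReal ENNReal

namespace CoverArb

/-! ### Digraphs, arborescences, tight arborescences -/

/-- A directed multigraph with node type `V` and arc type `A`; parallel arcs are allowed. -/
structure MultiDigraph (V A : Type*) where
  tail : A → V
  head : A → V

/-- `w(H)`; for `w = 1` this is `|H|`. -/
def weight {A : Type*} (w : A → ℝ≥0) (H : Finset A) : ℝ≥0 := ∑ a ∈ H, w a

namespace MultiDigraph

variable {V A : Type*}

/-- The arc `a` enters the node set `Z`. -/
def Enters (D : MultiDigraph V A) (a : A) (Z : Finset V) : Prop :=
  D.tail a ∉ Z ∧ D.head a ∈ Z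

/-- The arc `a` leaves the node set `Z`. -/
def Leaves (D : MultiDigraph V A) (a : A) (Z : Finset V) : Prop :=
  D.tail a ∈ Z ∧ D.head a ∉ Z

instance [DecidableEq V] (D : MultiDigraph V A) (a : A) (Z : Finset V) :
    Decidable (D.Enters a Z) := by unfold Enters; infer_instance

instance [DecidableEq V] (D : MultiDigraph V A) (a : A) (Z : Finset V) :
    Decidable (D.Leaves a Z) := by unfold Leaves; infer_instance

/-- `B` is a spanning arborescence of root `r`: no arc of `B` enters `r`, exactly one arc of `B`
has head `v` for every other node `v`, and `B` contains no directed cycle. -/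
def IsArborescence [DecidableEq V] (D : MultiDigraph V A) (r : V) (B : Finset A) : Prop :=
  (B.filter fun a => D.head a = r).card = 0 ∧
  (∀ v, v ≠ r → (B.filter fun a => D.head a = v).card = 1) ∧
  ∀ v, ¬ Relation.TransGen (fun x y => ∃ a ∈ B, D.tail a = x ∧ D.head a = y) v v

/-- `B` is an `L`-tight arborescence of root `r`: it enters every member of `L` at most once, and
it does not enter the members of `L` containing `r`. -/
def IsTightArborescence [DecidableEq V] (D : MultiDigraph V A) (L : Finset (Finset V)) (r : V)
    (B : Finset A) : Prop :=
  D.IsArborescence r B ∧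
  (∀ F ∈ L, (B.filter fun a => D.Enters a F).card ≤ 1) ∧
  ∀ F ∈ L, r ∈ F → (B.filter fun a => D.Enters a F).card = 0

/-- `H` intersects every `L`-tight arborescence (of any root). -/
def CoversTight [DecidableEq V] [DecidableEq A] (D : MultiDigraph V A) (L : Finset (Finset V))
    (H : Finset A) : Prop :=
  ∀ r B, D.IsTightArborescence L r B → (B ∩ H).Nonempty

/-- `B` is a minimum `c`-cost `r`-arborescence. -/
def IsMinCostArborescence [DecidableEq V] (D : MultiDigraph V A) (c : A → ℝ) (r : V)
    (B : Finset A) : Prop :=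
  D.IsArborescence r B ∧ ∀ B', D.IsArborescence r B' → ∑ a ∈ B, c a ≤ ∑ a ∈ B', c a

/-- `H` intersects every minimum `c`-cost `r`-arborescence. -/
def CoversMinCost [DecidableEq V] [DecidableEq A] (D : MultiDigraph V A) (c : A → ℝ) (r : V)
    (H : Finset A) : Prop :=
  ∀ B, D.IsMinCostArborescence c r B → (B ∩ H).Nonempty

/-- `γ(D, L)`: the minimum of `w(H)` over the arc sets `H` that intersect every `L`-tight
arborescence; it is `⊤` exactly when there is no such `H`. -/
noncomputable def gamma [DecidableEq V] [DecidableEq A] (D : MultiDigraph V A) (w : A → ℝ≥0)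
    (L : Finset (Finset V)) : ℝ≥0∞ :=
  ⨅ (H : Finset A) (_ : D.CoversTight L H), (weight w H : ℝ≥0∞)

/-! ### In-degrees, double cuts, anchor nodes -/

/-- The (weighted) in-degree `ϱ(Z)` of a node set. -/
def inDeg [Fintype A] [DecidableEq V] (D : MultiDigraph V A) (w : A → ℝ≥0) (Z : Finset V) :
    ℝ≥0 :=
  weight w (Finset.univ.filter fun a => D.Enters a Z)

/-- `μ(D)`: the minimum weight of a double cut, `⊤` if there is none (a single node). -/
noncomputable def mu [Fintype A] [DecidableEq V] (D : MultiDigraph V A) (w : A → ℝ≥0) : ℝ≥0∞ :=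
  ⨅ (Z₁ : Finset V) (Z₂ : Finset V) (_ : Z₁.Nonempty ∧ Z₂.Nonempty ∧ Disjoint Z₁ Z₂),
    ((D.inDeg w Z₁ : ℝ≥0∞) + (D.inDeg w Z₂ : ℝ≥0∞))

/-- `t` is an anchor node: `ϱ(Z) ≥ μ / 2` for every non-empty `Z` avoiding `t`. -/
def IsAnchor [Fintype A] [DecidableEq V] (D : MultiDigraph V A) (w : A → ℝ≥0) (t : V) : Prop :=
  ∀ Z : Finset V, Z.Nonempty → t ∉ Z → D.mu w / 2 ≤ (D.inDeg w Z : ℝ≥0∞)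

/-- The arcs of `D[F]`. -/
abbrev InducedArc (D : MultiDigraph V A) (F : Finset V) : Type _ :=
  {a : A // D.tail a ∈ F ∧ D.head a ∈ F}

/-- The induced sub-digraph `D[F]`. -/
def induce (D : MultiDigraph V A) (F : Finset V) :
    MultiDigraph {v : V // v ∈ F} (D.InducedArc F) where
  tail a := ⟨D.tail a.1, a.2.1⟩
  head a := ⟨D.head a.1, a.2.2⟩

/-- `μ(D[F])`, with the weights of `D`. -/
noncomputable def muOn [Fintype A] [DecidableEq V] (D : MultiDigraph V A) (w : A → ℝ≥0)
    (F : Finset V) : ℝ≥0∞ :=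
  (D.induce F).mu fun a => w a.1

/-- `t` is an anchor node of `D[F]`, with the weights of `D`. -/
def IsAnchorOn [Fintype A] [DecidableEq V] (D : MultiDigraph V A) (w : A → ℝ≥0)
    (F : Finset V) (t : {v : V // v ∈ F}) : Prop :=
  (D.induce F).IsAnchor (fun a => w a.1) t

/-! ### The algorithm -/

/-- Relocate the tail of every arc leaving `F` to `t`. -/
def relocate [DecidableEq V] (D : MultiDigraph V A) (F : Finset V) (t : V) :
    MultiDigraph V A where
  tail a := if D.Leaves a F then t else D.tail a
  head := D.head

/-- Relocate the tail of every arc leaving a member of `L` that contains `t` to `t`. Applied to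
the digraph `D'` of the first phase, this is `D_t`. -/
def relocateAll [DecidableEq V] (D : MultiDigraph V A) (L : Finset (Finset V)) (t : V) :
    MultiDigraph V A where
  tail a := if ∃ F ∈ L, t ∈ F ∧ D.Leaves a F then t else D.tail a
  head := D.head

/-- `FirstPhase D w L D' L'`: some execution of the loop of the first phase, started with
`(D, L)`, reaches the state `(D', L')`. In one pass an inclusionwise minimal `F ∈ L'` and an anchor
node `t` of `D'[F]` are chosen (arbitrarily), the tails of the arcs leaving `F` are relocated to
`t`, and `F` is removed from `L'`. -/
inductive FirstPhase [Fintype A] [DecidableEq V] (D : MultiDigraph V A) (w : A → ℝ≥0)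
    (L : Finset (Finset V)) : MultiDigraph V A → Finset (Finset V) → Prop
  | start : FirstPhase D w L D L
  | step {D' : MultiDigraph V A} {L' : Finset (Finset V)} {F : Finset V} {t : {v : V // v ∈ F}} :
      FirstPhase D w L D' L' → Minimal (fun X => X ∈ L') F → D'.IsAnchorOn w F t →
      FirstPhase D w L (D'.relocate F t.1) (L'.erase F)

/-- The value returned by the second phase: the minimum of `μ(D'[F])` and of `μ(D_a[F])` over
`F ∈ L` and `a ∈ F`. -/
noncomputable def secondPhase [Fintype A] [DecidableEq V] (D' : MultiDigraph V A)
    (w : A → ℝ≥0) (L : Finset (Finset V)) : ℝ≥0∞ :=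
  ⨅ F ∈ L, (D'.muOn w F ⊓ ⨅ a ∈ F, (D'.relocateAll L a).muOn w F)

end MultiDigraph

/-- A laminar family of non-empty sets. -/
def IsLaminar {V : Type*} (L : Finset (Finset V)) : Prop :=
  (∀ X ∈ L, X.Nonempty) ∧ ∀ X ∈ L, ∀ Y ∈ L, X ⊆ Y ∨ Y ⊆ X ∨ Disjoint X Y

/-- `H` is a minimum weight arc set among those with the property `P`. -/
def IsMinWeight {A : Type*} (P : Finset A → Prop) (w : A → ℝ≥0) (H : Finset A) : Prop :=
  P H ∧ ∀ H', P H' → weight w H ≤ weight w H'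

/-! ### A real RAM with a minimum cut instruction

Programs work on two-dimensional arrays of natural numbers and of real numbers; a scalar is the cell
`(0, 0)` of an array. The elementary operations are reading and writing a cell, addition and
subtraction, comparison of two numbers, and branching; each costs one step. Programs have bounded
loops only, so every program halts. The single instruction that is not elementary computes a minimum
`s`-`t` cut of a network with `N` nodes and `M` arcs, and costs `T N M` steps. -/

/-- A capacitated digraph with nodes `0, …, N - 1` and arcs `0, …, M - 1`, a source and a sink,
as read from the memory. -/
structure Network where
  N : ℕ
  M : ℕ
  tail : Fin M → ℕ
  head : Fin M → ℕ
  cap : Fin M → ℝ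
  s : ℕ
  t : ℕ

/-- The data describe a network. -/
def Network.WellFormed (G : Network) : Prop :=
  (∀ e, G.tail e < G.N ∧ G.head e < G.N ∧ 0 ≤ G.cap e) ∧ G.s < G.N ∧ G.t < G.N ∧ G.s ≠ G.t

/-- The total capacity of the arcs leaving `X`. -/
def Network.cut (G : Network) (X : Finset ℕ) : ℝ :=
  ∑ e, if G.tail e ∈ X ∧ G.head e ∉ X then G.cap e else 0

/-- The result of `O` on every well-formed network is a minimum `s`-`t` cut. -/
def IsMinCutOracle (O : Network → Finset ℕ) : Prop :=
  ∀ G : Network, G.WellFormed →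
    G.s ∈ O G ∧ G.t ∉ O G ∧ ∀ X : Finset ℕ, G.s ∈ X → G.t ∉ X → G.cut (O G) ≤ G.cut X

/-- `T N M` is admissible as the time of a minimum cut computation with `N` nodes and `M` arcs:
it is monotone, at least the size of the network, and grows by a factor of at most `K` when the
network is doubled (for networks with at least `N - 1` arcs). -/
def IsCutTime (K : ℕ) (T : ℕ → ℕ → ℕ) : Prop :=
  (∀ N M N' M', N ≤ N' → M ≤ M' → T N M ≤ T N' M') ∧
  (∀ N M, N + M ≤ T N M) ∧
  ∀ N M, N ≤ M + 1 → T (2 * N) (2 * M + N) ≤ K * T N M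

/-- The memory: `nat x i j` and `real x i j` are the cells `(i, j)` of the arrays named `x`. -/
structure Mem where
  nat : ℕ → ℕ → ℕ → ℕ
  real : ℕ → ℕ → ℕ → ℝ

/-- Write `v` into the cell `(i, j)` of the natural number array `x`. -/
def Mem.setNat (σ : Mem) (x i j v : ℕ) : Mem :=
  { σ with nat := fun x' i' j' => if x' = x ∧ i' = i ∧ j' = j then v else σ.nat x' i' j' }

/-- Write `v` into the cell `(i, j)` of the real array `x`. -/
noncomputable def Mem.setReal (σ : Mem) (x i j : ℕ) (v : ℝ) : Mem :=
  { σ with real := fun x' i' j' => if x' = x ∧ i' = i ∧ j' = j then v else σ.real x' i' j' }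

/-- Expressions for natural numbers. -/
inductive NExpr where
  | lit (k : ℕ)
  | get (x : ℕ) (i j : NExpr)
  | add (a b : NExpr)
  | sub (a b : NExpr)

/-- Value of an expression; subtraction is truncated. -/
def NExpr.eval (σ : Mem) : NExpr → ℕ
  | lit k => k
  | get x i j => σ.nat x (i.eval σ) (j.eval σ)
  | add a b => a.eval σ + b.eval σ
  | sub a b => a.eval σ - b.eval σ

/-- Number of steps for evaluating an expression. -/
def NExpr.cost : NExpr → ℕ
  | lit _ => 1
  | get _ i j => 1 + i.cost + j.cost
  | add a b => 1 + a.cost + b.cost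
  | sub a b => 1 + a.cost + b.cost

/-- Expressions for real numbers. -/
inductive RExpr where
  | zero
  | one
  | get (x : ℕ) (i j : NExpr)
  | add (a b : RExpr)
  | sub (a b : RExpr)

/-- Value of an expression. -/
noncomputable def RExpr.eval (σ : Mem) : RExpr → ℝ
  | zero => 0
  | one => 1
  | get x i j => σ.real x (i.eval σ) (j.eval σ)
  | add a b => a.eval σ + b.eval σ
  | sub a b => a.eval σ - b.eval σ

/-- Number of steps for evaluating an expression. -/
def RExpr.cost : RExpr → ℕ
  | zero => 1
  | one => 1
  | get _ i j => 1 + i.cost + j.cost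
  | add a b => 1 + a.cost + b.cost
  | sub a b => 1 + a.cost + b.cost

/-- Tests. -/
inductive BExpr where
  | nle (a b : NExpr)
  | rle (a b : RExpr)
  | neg (p : BExpr)
  | and (p q : BExpr)

/-- Meaning of a test. -/
def BExpr.holds (σ : Mem) : BExpr → Prop
  | nle a b => a.eval σ ≤ b.eval σ
  | rle a b => a.eval σ ≤ b.eval σ
  | neg p => ¬ p.holds σ
  | and p q => p.holds σ ∧ q.holds σ

/-- Number of steps for a test. -/
def BExpr.cost : BExpr → ℕ
  | nle a b => 1 + a.cost + b.cost
  | rle a b => 1 + a.cost + b.cost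
  | neg p => 1 + p.cost
  | and p q => 1 + p.cost + q.cost

/-- Programs. -/
inductive Prog where
  | skip
  /-- Assign the value of `e` to the cell `(i, j)` of the natural number array `x`. -/
  | setNat (x : ℕ) (i j e : NExpr)
  /-- Assign the value of `e` to the cell `(i, j)` of the real array `x`. -/
  | setReal (x : ℕ) (i j : NExpr) (e : RExpr)
  | seq (p q : Prog)
  | ite (b : BExpr) (p q : Prog)
  /-- Evaluate `e` once, then execute `p` for each of the values `0, …, e - 1` of the scalar `x`. -/
  | loop (x : ℕ) (e : NExpr) (p : Prog)
  /-- Compute a minimum `s`-`t` cut in the network with `N` nodes and `M` arcs whose tails, heads and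
  capacities are in the first column of the arrays `tl`, `hd` (natural numbers) and `cp` (real
  numbers), and write its indicator vector into the first column of the array `out`. -/
  | minCut (N M s t : NExpr) (tl hd cp out : ℕ)

open Classical in
/-- Final memory and number of steps of a program, when minimum cuts are computed by `O` and cost
`T` steps. -/
noncomputable def Prog.run (O : Network → Finset ℕ) (T : ℕ → ℕ → ℕ) : Prog → Mem → Mem × ℕ
  | skip, σ => (σ, 1)
  | setNat x i j e, σ =>
      (σ.setNat x (i.eval σ) (j.eval σ) (e.eval σ), 1 + i.cost + j.cost + e.cost)
  | setReal x i j e, σ =>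
      (σ.setReal x (i.eval σ) (j.eval σ) (e.eval σ), 1 + i.cost + j.cost + e.cost)
  | seq p q, σ =>
      let ρ := p.run O T σ
      let τ := q.run O T ρ.1
      (τ.1, ρ.2 + τ.2)
  | ite b p q, σ =>
      let ρ := if b.holds σ then p.run O T σ else q.run O T σ
      (ρ.1, 1 + b.cost + ρ.2)
  | loop x e p, σ =>
      (List.range (e.eval σ)).foldl
        (fun ρ i =>
          let τ := p.run O T (ρ.1.setNat x 0 0 i)
          (τ.1, ρ.2 + 1 + τ.2))
        (σ, 1 + e.cost)
  | minCut N M s t tl hd cp out, σ =>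
      let X := O
        { N := N.eval σ
          M := M.eval σ
          tail := fun e => σ.nat tl e 0
          head := fun e => σ.nat hd e 0
          cap := fun e => σ.real cp e 0
          s := s.eval σ
          t := t.eval σ }
      ({ σ with
          nat := fun x i j =>
            if x = out ∧ i < N.eval σ ∧ j = 0 then (if i ∈ X then 1 else 0) else σ.nat x i j },
        1 + N.cost + M.cost + s.cost + t.cost + T (N.eval σ) (M.eval σ))

/-! ### Input and output -/

/-- An array holding a scalar. -/
def scalar (v : ℕ) : ℕ → ℕ → ℕ := fun i j => if i = 0 ∧ j = 0 then v else 0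

/-- An array holding a vector in its first column. -/
def column {m : ℕ} {α : Type*} [Zero α] (f : Fin m → α) : ℕ → ℕ → α :=
  fun i j => if h : i < m ∧ j = 0 then f ⟨i, h.1⟩ else 0

/-- An array holding a listing of node sets, as an incidence matrix. -/
def incidence {k n : ℕ} (S : Fin k → Finset (Fin n)) : ℕ → ℕ → ℕ :=
  fun i j => if h : i < k ∧ j < n then (if (⟨j, h.2⟩ : Fin n) ∈ S ⟨i, h.1⟩ then 1 else 0) else 0

/-- The initial memory for a digraph with a root, arc costs and arc weights. -/
noncomputable def costInput {n m : ℕ} (D : MultiDigraph (Fin n) (Fin m)) (r : Fin n)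
    (c : Fin m → ℝ) (w : Fin m → ℝ≥0) : Mem where
  nat := fun x => match x with
    | 0 => scalar n
    | 1 => scalar m
    | 2 => scalar r
    | 3 => column fun e => (D.tail e : ℕ)
    | 4 => column fun e => (D.head e : ℕ)
    | _ => fun _ _ => 0
  real := fun x => match x with
    | 0 => column fun e => (w e : ℝ)
    | 1 => column c
    | _ => fun _ _ => 0

/-- The initial memory for a digraph with a family of `k` node sets and arc weights. -/
noncomputable def tightInput {n m k : ℕ} (D : MultiDigraph (Fin n) (Fin m))
    (S : Fin k → Finset (Fin n)) (w : Fin m → ℝ≥0) : Mem where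
  nat := fun x => match x with
    | 0 => scalar n
    | 1 => scalar m
    | 2 => scalar k
    | 3 => column fun e => (D.tail e : ℕ)
    | 4 => column fun e => (D.head e : ℕ)
    | 6 => incidence S
    | _ => fun _ _ => 0
  real := fun x => match x with
    | 0 => column fun e => (w e : ℝ)
    | _ => fun _ _ => 0

/-- The arc set that a program has written into the first column of array `5`. -/
def outputArcs (m : ℕ) (σ : Mem) : Finset (Fin m) :=
  Finset.univ.filter fun e => σ.nat 5 e 0 = 1

end CoverArb

open CoverArb

/-! The returned value is at least `gamma` because of two facts. If an arc leaves a member of `L`,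
moving its tail to another node of that member does not change which arc sets are tight
arborescences (`IsTightArborescence.of_lEquiv`), so every digraph the algorithm meets may replace
`D`. And if Z₁ and Z₂ are disjoint non-empty subsets of F ∈ `L`, a tight arborescence must enter one
of them by an arc with tail in F, since it comes into F from outside at most once. Hence every
double cut of `D'[F]` or `D_a[F]` is a cover.

Conversely, let `H` weigh less than the value M. A tight arborescence avoiding `H` is sought
recursively: `roots` of F consists of the nodes from which all of F can be reached when moves inside
a child (a maximal smaller member) are free, and a child may be entered only at one of its own
roots. A root of the whole node set yields the arborescence (`exists_tightOn`), so the point is that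
no set of roots is empty (`roots_nonempty`). If no node reaches all of F, there are two disjoint
sets closed under predecessors. Restricted to roots of the children (`core`), they are entered
inside F by arcs of `H` only, provided that the arcs leaving a child start at one of its roots.
After the first phase these arcs start at the anchor of the child. Either the anchor is a root
(`Central`), or the search for another centre has cost `H` at least M/2 inside the child
(`Eccentric`): a set of roots avoiding the anchor has in-degree at least M/2, all of it paid by `H`.
Two disjoint children cannot both be eccentric, so one relocation to a root a of the single
eccentric child repairs everything, and the two cores form a double cut of `D'[F]` or `D_a[F]` of
weight less than M, a contradiction. Anchors exist by an averaging argument over a smallest family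
of light sets without a common node (`exists_anchor`).

For the running time, a minimum double cut separating two given nodes is a minimum cut in a network
on two copies of the nodes (`IsDoubleNet`). Each of the O(n) members needs O(n²) such cuts. The
values of the second phase can be computed as soon as F is chosen, because later relocations do not
affect the arcs inside F.

For minimum cost arborescences, the primal-dual method produces reduced costs and a laminar family
with positive multipliers (`Dual.step`). Complementary slackness identifies the minimum cost
r-arborescences with the tight arborescences of the zero-cost arcs (`Dual.minCost_iff`). Laminarity
bounds the number of dual steps by 2n - 2. -/

namespace CoverArb

open Relation

/-! ### Arborescences, and invariance of tightness under moving tails -/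

namespace MultiDigraph

variable {V A : Type*}

/-- There is an arc of `B` from `x` to `y`. -/
def Step (D : MultiDigraph V A) (B : Finset A) (x y : V) : Prop :=
  ∃ a ∈ B, D.tail a = x ∧ D.head a = y

theorem Step.mono {D : MultiDigraph V A} {B C : Finset A} (h : B ⊆ C) {x y : V}
    (hs : D.Step B x y) : D.Step C x y := by
  obtain ⟨a, ha, h1, h2⟩ := hs
  exact ⟨a, h ha, h1, h2⟩

theorem exists_enters_of_reach {D : MultiDigraph V A} {B : Finset A} {Z : Finset V} {u v : V}
    (h : ReflTransGen (D.Step B) u v) (hu : u ∉ Z) (hv : v ∈ Z) :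
    ∃ a ∈ B, D.Enters a Z ∧ ReflTransGen (D.Step B) u (D.tail a) ∧
      ReflTransGen (D.Step B) (D.head a) v := by
  induction h with
  | refl => exact absurd hv hu
  | @tail y z hy hz ih =>
    by_cases hyZ : y ∈ Z
    · obtain ⟨a, ha, h1, h2, h3⟩ := ih hyZ
      exact ⟨a, ha, h1, h2, h3.tail hz⟩
    · obtain ⟨a, ha, rfl, rfl⟩ := hz
      exact ⟨a, ha, ⟨hyZ, hv⟩, hy, .refl⟩

section

variable [DecidableEq V]

theorem IsArborescence.head_ne {D : MultiDigraph V A} {r : V} {B : Finset A}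
    (h : D.IsArborescence r B) {a : A} (ha : a ∈ B) : D.head a ≠ r := by
  intro hr
  have := Finset.card_eq_zero.1 h.1
  exact Finset.notMem_empty a (this ▸ Finset.mem_filter.2 ⟨ha, hr⟩)

theorem IsArborescence.exists_arc {D : MultiDigraph V A} {r : V} {B : Finset A}
    (h : D.IsArborescence r B) {v : V} (hv : v ≠ r) : ∃ a ∈ B, D.head a = v := by
  obtain ⟨a, ha⟩ := Finset.card_pos.1 (by rw [h.2.1 v hv]; exact one_pos)
  exact ⟨a, (Finset.mem_filter.1 ha).1, (Finset.mem_filter.1 ha).2⟩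

theorem IsArborescence.acyclic {D : MultiDigraph V A} {r : V} {B : Finset A}
    (h : D.IsArborescence r B) (v : V) : ¬ TransGen (D.Step B) v v := h.2.2 v

/-- Acyclicity on finitely many nodes makes the arcs well-founded, so following entering arcs
backwards can only stop at the root. -/
theorem IsArborescence.reach [Finite V] {D : MultiDigraph V A} {r : V} {B : Finset A}
    (h : D.IsArborescence r B) (v : V) : ReflTransGen (D.Step B) r v := by
  have wf : WellFounded (TransGen (D.Step B)) := by
    have : Std.Irrefl (TransGen (D.Step B)) := ⟨h.acyclic⟩
    exact Finite.wellFounded_of_trans_of_irrefl _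
  induction v using wf.induction with
  | _ v ih =>
    by_cases hv : v = r
    · rw [hv]
    · obtain ⟨a, ha, rfl⟩ := h.exists_arc hv
      have hs : D.Step B (D.tail a) (D.head a) := ⟨a, ha, rfl, rfl⟩
      exact (ih _ (.single hs)).tail hs

/-- Reachability excludes cycles: by the in-degree condition, a cycle through a node also passes
through its predecessor on the path from r, and so on back to r, which no arc enters. -/
theorem isArborescence_of_reach {D : MultiDigraph V A} {r : V} {B : Finset A}
    (h0 : ∀ a ∈ B, D.head a ≠ r) (h1 : ∀ v, v ≠ r → (B.filter fun a => D.head a = v).card = 1)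
    (h2 : ∀ v, ReflTransGen (D.Step B) r v) : D.IsArborescence r B := by
  refine ⟨?_, h1, ?_⟩
  · rw [Finset.card_eq_zero, Finset.filter_eq_empty_iff]
    exact fun {a} ha => h0 a ha
  · intro v
    change ¬ TransGen (D.Step B) v v
    induction h2 v with
    | refl =>
      intro h
      obtain ⟨y, -, a, ha, -, h3⟩ := TransGen.tail'_iff.1 h
      exact h0 a ha h3
    | @tail y z hy hz ih =>
      intro h
      obtain ⟨y', hy', a, ha, h3, h4⟩ := TransGen.tail'_iff.1 h
      obtain ⟨b, hb, h5, h6⟩ := id hz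
      have hab : a = b := by
        have := h1 z (fun e => h0 b hb (h6.trans e))
        exact Finset.card_le_one.1 this.le a (by simp [ha, h4]) b (by simp [hb, h6])
      subst hab
      obtain rfl : y' = y := h3.symm.trans h5
      exact ih (TransGen.head' hz hy')

theorem IsTightArborescence.enters_unique {D : MultiDigraph V A} {L : Finset (Finset V)} {r : V}
    {B : Finset A} (h : D.IsTightArborescence L r B) {F : Finset V} (hF : F ∈ L) {a b : A}
    (ha : a ∈ B) (hb : b ∈ B) (haF : D.Enters a F) (hbF : D.Enters b F) : a = b :=
  Finset.card_le_one.1 (h.2.1 F hF) a (by simp [ha, haF]) b (by simp [hb, hbF])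

theorem IsTightArborescence.not_enters {D : MultiDigraph V A} {L : Finset (Finset V)} {r : V}
    {B : Finset A} (h : D.IsTightArborescence L r B) {F : Finset V} (hF : F ∈ L) (hr : r ∈ F)
    {a : A} (ha : a ∈ B) : ¬ D.Enters a F := by
  intro haF
  have := Finset.card_eq_zero.1 (h.2.2 F hF hr)
  exact Finset.notMem_empty a (this ▸ Finset.mem_filter.2 ⟨ha, haF⟩)

/-- Two digraphs with the same heads, in which the tails of an arc coincide or belong to a common
member of `L` that the arc leaves. -/
structure LEquiv (L : Finset (Finset V)) (D D' : MultiDigraph V A) : Prop where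
  head : ∀ e, D.head e = D'.head e
  tail : ∀ e, D.tail e = D'.tail e ∨ ∃ F ∈ L, D.tail e ∈ F ∧ D'.tail e ∈ F ∧ D.head e ∉ F

omit [DecidableEq V] in
theorem LEquiv.refl (L : Finset (Finset V)) (D : MultiDigraph V A) : LEquiv L D D :=
  ⟨fun _ => rfl, fun _ => .inl rfl⟩

omit [DecidableEq V] in
theorem LEquiv.symm {L : Finset (Finset V)} {D D' : MultiDigraph V A} (h : LEquiv L D D') :
    LEquiv L D' D := by
  refine ⟨fun e => (h.head e).symm, fun e => ?_⟩
  rcases h.tail e with h1 | ⟨F, hF, h1, h2, h3⟩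
  · exact .inl h1.symm
  · exact .inr ⟨F, hF, h2, h1, h.head e ▸ h3⟩

omit [DecidableEq V] in
theorem _root_.CoverArb.IsLaminar.nested {L : Finset (Finset V)} (hL : IsLaminar L) {F G : Finset V}
    (hF : F ∈ L) (hG : G ∈ L) {x : V} (hx : x ∈ F) (hx' : x ∈ G) : F ⊆ G ∨ G ⊆ F := by
  rcases hL.2 F hF G hG with h | h | h
  · exact .inl h
  · exact .inr h
  · exact absurd hx' (Finset.disjoint_left.1 h hx)

-- The two witnessing members share the middle tail, so they are nested and the larger one witnesses
-- the composition.
omit [DecidableEq V] in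
theorem LEquiv.trans {L : Finset (Finset V)} (hL : IsLaminar L) {D D' D'' : MultiDigraph V A}
    (h : LEquiv L D D') (h' : LEquiv L D' D'') : LEquiv L D D'' := by
  refine ⟨fun e => (h.head e).trans (h'.head e), fun e => ?_⟩
  rcases h.tail e with h1 | ⟨F, hF, h1, h2, h3⟩
  · rw [h1, h.head e]
    exact h'.tail e
  · rcases h'.tail e with h4 | ⟨G, hG, h4, h5, h6⟩
    · exact .inr ⟨F, hF, h1, h4 ▸ h2, h3⟩
    · rcases hL.nested hF hG h2 h4 with h7 | h7
      · exact .inr ⟨G, hG, h7 h1, h5, h.head e ▸ h6⟩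
      · exact .inr ⟨F, hF, h1, h7 h5, h3⟩

-- A member left by the arc cannot contain a member G around its head. By laminarity it lies inside
-- G or is disjoint from it, so both tails are on the same side of G.
omit [DecidableEq V] in
theorem LEquiv.tail_mem_iff {L : Finset (Finset V)} (hL : IsLaminar L) {D D' : MultiDigraph V A}
    (h : LEquiv L D D') {G : Finset V} (hG : G ∈ L) {e : A} (he : D.head e ∈ G) :
    D.tail e ∈ G ↔ D'.tail e ∈ G := by
  rcases h.tail e with h1 | ⟨F, hF, h1, h2, h3⟩
  · rw [h1]
  · constructor
    · intro h4
      rcases hL.nested hF hG h1 h4 with h5 | h5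
      · exact h5 h2
      · exact absurd (h5 he) h3
    · intro h4
      rcases hL.nested hF hG h2 h4 with h5 | h5
      · exact h5 h1
      · exact absurd (h5 he) h3

omit [DecidableEq V] in
theorem LEquiv.enters_iff {L : Finset (Finset V)} (hL : IsLaminar L) {D D' : MultiDigraph V A}
    (h : LEquiv L D D') {G : Finset V} (hG : G ∈ L) {e : A} :
    D.Enters e G ↔ D'.Enters e G := by
  unfold Enters
  rw [← h.head e]
  by_cases he : D.head e ∈ G
  · rw [h.tail_mem_iff hL hG he]
  · simp [he]

/-- Moving the tail of a single arc preserves tight arborescences. -/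
theorem IsTightArborescence.of_single [Finite V] [DecidableEq A] {L : Finset (Finset V)}
    (hL : IsLaminar L) {D D' : MultiDigraph V A} (h : LEquiv L D D') {e₀ : A}
    (he : ∀ e, e ≠ e₀ → D.tail e = D'.tail e) {r : V} {B : Finset A}
    (hB : D.IsTightArborescence L r B) : D'.IsTightArborescence L r B := by
  have hA := hB.1
  refine ⟨?_, ?_, ?_⟩
  · apply isArborescence_of_reach
    · intro a ha
      rw [← h.head a]
      exact hA.head_ne ha
    · intro v hv
      rw [← hA.2.1 v hv]
      congr 1
      ext a
      simp [h.head a]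
    · have mono : ∀ {x y}, ReflTransGen (D.Step (B.erase e₀)) x y →
          ReflTransGen (D'.Step B) x y := by
        intro x y hxy
        refine ReflTransGen.mono ?_ _ _ hxy
        rintro x y ⟨a, ha, h1, h2⟩
        rw [Finset.mem_erase] at ha
        exact ⟨a, ha.2, (he a ha.1) ▸ h1, (h.head a) ▸ h2⟩
      have split : ∀ {x y}, ReflTransGen (D.Step B) x y →
          ReflTransGen (D.Step (B.erase e₀)) x y ∨
            (e₀ ∈ B ∧ ReflTransGen (D.Step B) (D.head e₀) y) := by
        intro x y hxy
        induction hxy with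
        | refl => exact .inl .refl
        | @tail y z hy hz ih =>
          rcases ih with ih | ih
          · obtain ⟨a, ha, h1, h2⟩ := hz
            by_cases hae : a = e₀
            · subst hae
              exact .inr ⟨ha, h2 ▸ .refl⟩
            · exact .inl (ih.tail ⟨a, Finset.mem_erase.2 ⟨hae, ha⟩, h1, h2⟩)
          · exact .inr ⟨ih.1, ih.2.tail hz⟩
      -- Only `e₀` differs between the digraphs, so what matters is that its new tail is reached
      -- from r without using it.
      have key : e₀ ∈ B → ReflTransGen (D'.Step B) r (D.head e₀) := by
        intro he₀
        have stp : D'.Step B (D'.tail e₀) (D.head e₀) := ⟨e₀, he₀, rfl, (h.head e₀).symm⟩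
        refine ReflTransGen.tail ?_ stp
        have stp0 : D.Step B (D.tail e₀) (D.head e₀) := ⟨e₀, he₀, rfl, rfl⟩
        have nocyc : ¬ ReflTransGen (D.Step B) (D.head e₀) (D.tail e₀) := fun hc =>
          hA.acyclic _ (TransGen.tail' hc stp0)
        rcases split (hA.reach (D'.tail e₀)) with h1 | ⟨-, h1⟩
        · exact mono h1
        · exfalso
          rcases h.tail e₀ with h2 | ⟨F, hF, h2, h3, h4⟩
          · exact nocyc (h2 ▸ h1)
          · obtain ⟨f, hf, hfF, h5, -⟩ := exists_enters_of_reach h1 h4 h3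
            -- The path from the head of `e₀` to its new tail enters F, and so does the path from r
            -- to the old tail. By tightness they use the same arc, which closes a cycle through
            -- `e₀`.
            have hrF : r ∉ F := fun hr => hB.not_enters hF hr hf hfF
            obtain ⟨g, hg, hgF, -, h6⟩ := exists_enters_of_reach (hA.reach (D.tail e₀)) hrF h2
            obtain rfl := hB.enters_unique hF hf hg hfF hgF
            exact nocyc ((h5.tail ⟨f, hf, rfl, rfl⟩).trans h6)
      intro v
      have := hA.reach v
      induction this with
      | refl => exact .refl
      | @tail y z hy hz ih =>
        obtain ⟨a, ha, h1, h2⟩ := hz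
        by_cases hae : a = e₀
        · subst hae
          exact h2 ▸ key ha
        · exact ih.tail ⟨a, ha, (he a hae) ▸ h1, (h.head a) ▸ h2⟩
  · intro F hF
    convert hB.2.1 F hF using 3
    exact (h.enters_iff hL hF).symm
  · intro F hF hr
    convert hB.2.2 F hF hr using 3
    exact (h.enters_iff hL hF).symm

/-- Tails are exchanged one arc at a time, through the hybrids `E S` that use the tails of `D'` on S
and those of `D` elsewhere. -/
theorem IsTightArborescence.of_lEquiv [Finite V] [Finite A] {L : Finset (Finset V)}
    (hL : IsLaminar L) {D D' : MultiDigraph V A} (h : LEquiv L D D') {r : V} {B : Finset A}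
    (hB : D.IsTightArborescence L r B) : D'.IsTightArborescence L r B := by
  classical
  cases nonempty_fintype A
  let E : Finset A → MultiDigraph V A := fun S =>
    ⟨fun e => if e ∈ S then D'.tail e else D.tail e, D.head⟩
  have hE : ∀ S, (E S).IsTightArborescence L r B := by
    intro S
    induction S using Finset.induction_on with
    | empty => simpa [E] using hB
    | insert e₀ S he₀ ih =>
      refine IsTightArborescence.of_single (D := E S) (D' := E (insert e₀ S)) hL (e₀ := e₀) ⟨fun _ => rfl, fun e => ?_⟩ ?_ ih
      · by_cases hS : e ∈ S
        · simp [E, hS]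
        · by_cases hee : e = e₀
          · subst hee
            simp [E, hS, h.tail e]
          · simp [E, hS, hee]
      · intro e hee
        simp [E, hee]
  have h1 := hE Finset.univ
  have : E Finset.univ = D' := by
    obtain ⟨t, hd⟩ := D'
    have : D.head = hd := funext h.head
    simp [E, this]
  rwa [this] at h1

theorem LEquiv.tight_iff [Finite V] [Finite A] {L : Finset (Finset V)}
    (hL : IsLaminar L) {D D' : MultiDigraph V A} (h : LEquiv L D D') {r : V} {B : Finset A} :
    D.IsTightArborescence L r B ↔ D'.IsTightArborescence L r B :=
  ⟨fun hB => hB.of_lEquiv hL h, fun hB => hB.of_lEquiv hL h.symm⟩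

theorem LEquiv.coversTight_iff [Finite V] [Finite A] [DecidableEq A] {L : Finset (Finset V)}
    (hL : IsLaminar L) {D D' : MultiDigraph V A} (h : LEquiv L D D') {H : Finset A} :
    D.CoversTight L H ↔ D'.CoversTight L H := by
  unfold CoversTight
  simp only [h.tight_iff hL]

/-- A tight arborescence uses an arc of `D[F]` entering one of two given disjoint subsets
of `F`. -/
theorem IsTightArborescence.exists_enters [Finite V] {D : MultiDigraph V A}
    {L : Finset (Finset V)} {r : V} {B : Finset A} (hB : D.IsTightArborescence L r B)
    {F Z₁ Z₂ : Finset V} (hF : F ∈ L) (h₁ : Z₁.Nonempty) (h₂ : Z₂.Nonempty) (hd : Disjoint Z₁ Z₂)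
    (hs₁ : Z₁ ⊆ F) (hs₂ : Z₂ ⊆ F) :
    ∃ a ∈ B, D.tail a ∈ F ∧ (D.Enters a Z₁ ∨ D.Enters a Z₂) := by
  have key : ∀ Z : Finset V, Z.Nonempty → r ∉ Z → ∃ a ∈ B, D.Enters a Z := by
    rintro Z ⟨z, hz⟩ hr
    obtain ⟨a, ha, h, -⟩ := exists_enters_of_reach (hB.1.reach z) hr hz
    exact ⟨a, ha, h⟩
  by_cases hr : r ∈ F
  · have hin : ∀ a ∈ B, D.head a ∈ F → D.tail a ∈ F := fun a ha h => by
      by_contra hc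
      exact hB.not_enters hF hr ha ⟨hc, h⟩
    by_cases hr1 : r ∈ Z₁
    · obtain ⟨a, ha, h⟩ := key Z₂ h₂ (Finset.disjoint_left.1 hd hr1)
      exact ⟨a, ha, hin a ha (hs₂ h.2), .inr h⟩
    · obtain ⟨a, ha, h⟩ := key Z₁ h₁ hr1
      exact ⟨a, ha, hin a ha (hs₁ h.2), .inl h⟩
  -- With the root outside F both sets are entered. If both arcs came from outside F they would
  -- coincide by tightness, yet their heads lie in disjoint sets.
  · obtain ⟨a, ha, h⟩ := key Z₁ h₁ fun h => hr (hs₁ h)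
    obtain ⟨b, hb, h'⟩ := key Z₂ h₂ fun h => hr (hs₂ h)
    by_cases haF : D.tail a ∈ F
    · exact ⟨a, ha, haF, .inl h⟩
    by_cases hbF : D.tail b ∈ F
    · exact ⟨b, hb, hbF, .inr h'⟩
    obtain rfl := hB.enters_unique hF ha hb ⟨haF, hs₁ h.2⟩ ⟨hbF, hs₂ h'.2⟩
    exact absurd h'.2 (Finset.disjoint_left.1 hd h.2)

end

end MultiDigraph

end CoverArb

/-! ### Roots of the members of a laminar family -/

namespace CoverArb

open Relation

/-- `G` is a maximal member of `L` among those properly contained in `F`. -/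
def IsChild {V : Type*} (L : Finset (Finset V)) (F G : Finset V) : Prop :=
  G ∈ L ∧ G ⊂ F ∧ ∀ G' ∈ L, G' ⊂ F → (∃ x ∈ G, x ∈ G') → G' ⊆ G

theorem IsChild.ssubset {V : Type*} {L : Finset (Finset V)} {F G : Finset V}
    (h : IsChild L F G) : G ⊂ F := h.2.1

theorem IsChild.unique {V : Type*} {L : Finset (Finset V)} {F G G' : Finset V}
    (h : IsChild L F G) (h' : IsChild L F G') {x : V} (hx : x ∈ G) (hx' : x ∈ G') : G = G' :=
  (h'.2.2 G h.1 h.2.1 ⟨x, hx', hx⟩).antisymm (h.2.2 G' h'.1 h'.2.1 ⟨x, hx, hx'⟩)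

theorem IsLaminar.exists_child {V : Type*} {L : Finset (Finset V)} (hL : IsLaminar L)
    {F G₀ : Finset V} (h₀ : G₀ ∈ L) (hF : G₀ ⊂ F) : ∃ G, IsChild L F G ∧ G₀ ⊆ G := by
  classical
  obtain ⟨G, hG, hmax⟩ := Finset.exists_maximal (s := L.filter fun G => G ⊂ F ∧ G₀ ⊆ G)
    ⟨G₀, by simp [h₀, hF]⟩
  rw [Finset.mem_filter] at hG
  refine ⟨G, ⟨hG.1, hG.2.1, ?_⟩, hG.2.2⟩
  rintro G' hG' hG'F ⟨x, hx, hx'⟩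
  rcases hL.nested hG.1 hG' hx hx' with h | h
  · exact hmax (by simp [hG', hG'F, hG.2.2.trans h]) h
  · exact h

/-- Take v with the fewest predecessors in F. If v does not reach y, the predecessor sets of v and y
are disjoint: a common element u would, by minimality, have all predecessors of v, in particular v
itself, so v would reach y through u. -/
theorem exists_reaching_or_pair {V : Type*} {R : V → V → Prop} {F : Finset V}
    (hR : ∀ x z, R x z → x ∈ F) (hF : F.Nonempty) :
    (∃ v ∈ F, ∀ y ∈ F, ReflTransGen R v y) ∨
      ∃ X Y : Set V, X.Nonempty ∧ Y.Nonempty ∧ Disjoint X Y ∧ (∀ x ∈ X, x ∈ F) ∧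
        (∀ x ∈ Y, x ∈ F) ∧ (∀ x z, R x z → z ∈ X → x ∈ X) ∧ (∀ x z, R x z → z ∈ Y → x ∈ Y) := by
  classical
  have conf : ∀ x v, v ∈ F → ReflTransGen R x v → x ∈ F := by
    intro x v hv h
    rcases ReflTransGen.cases_head h with rfl | ⟨z, hz, -⟩
    · exact hv
    · exact hR _ _ hz
  obtain ⟨v, hv, hmin⟩ :=
    Finset.exists_min_image F (fun v => (F.filter fun x => ReflTransGen R x v).card) hF
  by_cases hall : ∀ y ∈ F, ReflTransGen R v y
  · exact .inl ⟨v, hv, hall⟩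
  push Not at hall
  obtain ⟨y, hy, hvy⟩ := hall
  refine .inr ⟨{x | ReflTransGen R x v}, {x | ReflTransGen R x y}, ⟨v, .refl⟩, ⟨y, .refl⟩, ?_,
    fun x hx => conf x v hv hx, fun x hx => conf x y hy hx, fun x z h hz => .head h hz,
    fun x z h hz => .head h hz⟩
  rw [Set.disjoint_left]
  intro u huv huy
  have huF := conf u v hv huv
  have hsub : (F.filter fun x => ReflTransGen R x u) ⊆ F.filter fun x => ReflTransGen R x v := by
    intro x hx
    rw [Finset.mem_filter] at hx ⊢
    exact ⟨hx.1, hx.2.trans huv⟩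
  have heq := Finset.eq_of_subset_of_card_le hsub (hmin u huF)
  have : v ∈ F.filter fun x => ReflTransGen R x u := by
    rw [heq]
    simp [hv, ReflTransGen.refl]
  exact hvy ((Finset.mem_filter.1 this).2.trans huy)

theorem weight_mono {A : Type*} (w : A → ℝ≥0) {H H' : Finset A} (h : H ⊆ H') :
    weight w H ≤ weight w H' :=
  Finset.sum_le_sum_of_subset h

theorem weight_add_le {A : Type*} (w : A → ℝ≥0) {H₁ H₂ H : Finset A} (h₁ : H₁ ⊆ H) (h₂ : H₂ ⊆ H)
    (hd : Disjoint H₁ H₂) : weight w H₁ + weight w H₂ ≤ weight w H := by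
  classical
  unfold weight
  rw [← Finset.sum_union hd]
  exact Finset.sum_le_sum_of_subset (Finset.union_subset h₁ h₂)

namespace MultiDigraph

variable {V A : Type*}

/-- The nodes `v ∈ F` such that `D[F]` without the arcs of `H` has an `L`-tight arborescence of
root `v`, described recursively by reachability after contracting the maximal proper subsets
of `F` in `L`. -/
def roots (D : MultiDigraph V A) (L : Finset (Finset V)) (H : Finset A) (F : Finset V) : Set V :=
  {v | v ∈ F ∧ (∀ G, (_ : IsChild L F G) → v ∈ G → v ∈ roots D L H G) ∧
    ∀ y ∈ F, ReflTransGen (fun x z => x ∈ F ∧ z ∈ F ∧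
      ((∃ G, IsChild L F G ∧ x ∈ G ∧ z ∈ G) ∨
        ∃ e, e ∉ H ∧ D.tail e = x ∧ D.head e = z ∧
          ∀ G, (_ : IsChild L F G) → z ∈ G → x ∉ G → z ∈ roots D L H G)) v y}
termination_by F.card
decreasing_by all_goals exact Finset.card_lt_card (IsChild.ssubset (L := L) (by assumption))

/-- One move within a maximal proper subset of `F` in `L`, or along an arc outside `H` that enters
such a subset at one of its roots only. -/
def Move (D : MultiDigraph V A) (L : Finset (Finset V)) (H : Finset A) (F : Finset V)
    (x z : V) : Prop :=
  x ∈ F ∧ z ∈ F ∧ ((∃ G, IsChild L F G ∧ x ∈ G ∧ z ∈ G) ∨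
    ∃ e, e ∉ H ∧ D.tail e = x ∧ D.head e = z ∧
      ∀ G, IsChild L F G → z ∈ G → x ∉ G → z ∈ D.roots L H G)

/-- The elements of `X` that are roots of the maximal proper subset of `F` in `L` around them. -/
def core (D : MultiDigraph V A) (L : Finset (Finset V)) (H : Finset A) (F : Finset V)
    (X : Set V) : Set V :=
  {x | x ∈ X ∧ ∀ G, IsChild L F G → x ∈ G → x ∈ D.roots L H G}

/-- The nodes of `F` from which all of `F` can be reached by moves. -/
def reaching (D : MultiDigraph V A) (L : Finset (Finset V)) (H : Finset A) (F : Finset V) :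
    Set V :=
  {x | x ∈ F ∧ ∀ y ∈ F, ReflTransGen (D.Move L H F) x y}

theorem roots_eq (D : MultiDigraph V A) (L : Finset (Finset V)) (H : Finset A) (F : Finset V) :
    D.roots L H F = D.core L H F (D.reaching L H F) := by
  rw [roots]
  ext v
  simp only [core, reaching, Set.mem_ofPred_eq]
  constructor
  · rintro ⟨h1, h2, h3⟩
    exact ⟨⟨h1, h3⟩, h2⟩
  · rintro ⟨⟨h1, h3⟩, h2⟩
    exact ⟨h1, h2, h3⟩

theorem roots_subset {D : MultiDigraph V A} {L : Finset (Finset V)} {H : Finset A} {F : Finset V}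
    {x : V} (hx : x ∈ D.roots L H F) : x ∈ F := by
  rw [roots_eq] at hx
  exact hx.1.1

/-- No arc of `E[F]` outside `H` enters the set of roots of `F`. -/
def NotEntered (D : MultiDigraph V A) (L : Finset (Finset V)) (H : Finset A)
    (E : MultiDigraph V A) (F : Finset V) : Prop :=
  ∀ e, e ∉ H → E.tail e ∈ F → E.head e ∈ D.roots L H F → E.tail e ∈ D.roots L H F

/-- Arcs of `E` outside `H` neither enter the set of roots of `G` from inside `G` nor leave `G`
towards `F` from another node than a root. -/
def GoodAt (D : MultiDigraph V A) (L : Finset (Finset V)) (H : Finset A)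
    (E : MultiDigraph V A) (F G : Finset V) : Prop :=
  D.NotEntered L H E G ∧
    ∀ e, e ∉ H → E.tail e ∈ G → E.head e ∈ F → E.head e ∉ G → E.tail e ∈ D.roots L H G

theorem reaching_pred {D : MultiDigraph V A} {L : Finset (Finset V)} {H : Finset A}
    {F : Finset V} (x z : V) (h : D.Move L H F x z) (hz : z ∈ D.reaching L H F) :
    x ∈ D.reaching L H F :=
  ⟨h.1, fun y hy => .head h (hz.2 y hy)⟩

/-- Since the head is a root of its child, the arc of `D` is a move, so its `D`-tail lies in X. The
tail in `E` belongs to the same child as the `D`-tail or is equal to it, hence lies in X too, and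
`GoodAt` makes it a root of its child. The moves are those of `D` although the entering arc is taken
in `E`; this allows one set of roots to be used for `D` and for all its relocations. -/
theorem core_not_entered {D E : MultiDigraph V A} {L : Finset (Finset V)} (hL : IsLaminar L)
    {H : Finset A} (hE : LEquiv L D E) {F : Finset V} (hF : F ∈ L) {X : Set V}
    (hXF : ∀ x ∈ X, x ∈ F) (hX : ∀ x z, D.Move L H F x z → z ∈ X → x ∈ X)
    (hch : ∀ G, IsChild L F G → (∃ x ∈ G, x ∈ X) → D.GoodAt L H E F G) {e : A} (he : e ∉ H)
    (ht : E.tail e ∈ F) (hh : E.head e ∈ D.core L H F X) : E.tail e ∈ D.core L H F X := by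
  have hhd := hE.head e
  have hzF : E.head e ∈ F := hXF _ hh.1
  have hxF : D.tail e ∈ F := (hE.tail_mem_iff hL hF (hhd ▸ hzF)).2 ht
  have hmove : D.Move L H F (D.tail e) (E.head e) :=
    ⟨hxF, hzF, .inr ⟨e, he, rfl, hhd, fun G hG hzG _ => hh.2 G hG hzG⟩⟩
  by_cases hτ : ∃ G, IsChild L F G ∧ E.tail e ∈ G
  · obtain ⟨G, hG, hτG⟩ := hτ
    have fin : E.tail e ∈ X → E.tail e ∈ D.roots L H G → E.tail e ∈ D.core L H F X :=
      fun h1 h2 => ⟨h1, fun G' hG' hτG' => by rwa [hG'.unique hG hτG' hτG]⟩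
    by_cases hzG : E.head e ∈ G
    · refine fin (hX _ _ ⟨ht, hzF, .inl ⟨G, hG, hτG, hzG⟩⟩ hh.1) ?_
      exact (hch G hG ⟨_, hzG, hh.1⟩).1 e he hτG (hh.2 G hG hzG)
    · have hxG : D.tail e ∈ G := by
        -- If the tail was moved, both of its positions lie in a member that is strictly inside F,
        -- because the head is in F but not in that member. It meets the child G and is therefore
        -- contained in it.
        rcases hE.tail e with h | ⟨G₀, hG₀, h1, h2, h3⟩
        · rwa [h]
        · refine hG.2.2 G₀ hG₀ ?_ ⟨_, hτG, h2⟩ h1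
          rcases hL.nested hG₀ hF h1 hxF with h | h
          · exact h.ssubset_of_ne (fun h' => h3 (h' ▸ hhd ▸ hzF))
          · exact absurd (h (hhd ▸ hzF)) h3
      have hxX := hX _ _ hmove hh.1
      have hτX := hX _ _ ⟨ht, hxF, .inl ⟨G, hG, hτG, hxG⟩⟩ hxX
      exact fin hτX ((hch G hG ⟨_, hτG, hτX⟩).2 e he hτG hzF hzG)
  · have hx : D.tail e = E.tail e := by
      rcases hE.tail e with h | ⟨G₀, hG₀, h1, h2, h3⟩
      · exact h
      · exfalso
        -- A moved tail would lie in a member strictly inside F, hence in a child, which is excluded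
        -- in this case.
        have : G₀ ⊂ F := by
          rcases hL.nested hG₀ hF h1 hxF with h | h
          · exact h.ssubset_of_ne (fun h' => h3 (h' ▸ hhd ▸ hzF))
          · exact absurd (h (hhd ▸ hzF)) h3
        obtain ⟨G, hG, hsub⟩ := hL.exists_child hG₀ this
        exact hτ ⟨G, hG, hsub h2⟩
    exact ⟨hX _ _ (hx ▸ hmove) hh.1, fun G hG h => absurd ⟨G, hG, h⟩ hτ⟩

section

variable [DecidableEq V]

/-- The in-degree of a subset `Z` of `F` in the sub-digraph induced by `F`. -/
def cutIn [Fintype A] (D : MultiDigraph V A) (w : A → ℝ≥0) (F Z : Finset V) : ℝ≥0 :=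
  weight w (Finset.univ.filter fun e => D.tail e ∈ F ∧ D.Enters e Z)

theorem lEquiv_relocateAll (D : MultiDigraph V A) (L : Finset (Finset V)) (a : V) :
    LEquiv L D (D.relocateAll L a) := by
  refine ⟨fun _ => rfl, fun e => ?_⟩
  by_cases h : ∃ F ∈ L, a ∈ F ∧ D.Leaves e F
  · obtain ⟨F, hF, haF, hl⟩ := id h
    refine .inr ⟨F, hF, hl.1, ?_, hl.2⟩
    simpa only [relocateAll, if_pos h] using haF
  · left
    simp only [relocateAll, if_neg h]

theorem relocateAll_tail (D : MultiDigraph V A) (L : Finset (Finset V)) (a : V) (e : A) :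
    (D.relocateAll L a).tail e = a ∨ ((D.relocateAll L a).tail e = D.tail e ∧
      ∀ F ∈ L, a ∈ F → ¬ D.Leaves e F) := by
  by_cases h : ∃ F ∈ L, a ∈ F ∧ D.Leaves e F
  · left
    simp only [relocateAll, if_pos h]
  · right
    refine ⟨by simp only [relocateAll, if_neg h], fun F hF haF hl => h ⟨F, hF, haF, hl⟩⟩

/-- The situation at the end of the first phase: `anc F` is an anchor of `F`, the arcs leaving `F`
leave it at `anc F`, and all relevant double cuts have weight at least `M`. -/
structure Anchored [Fintype A] (D : MultiDigraph V A) (w : A → ℝ≥0) (L : Finset (Finset V))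
    (M : ℝ≥0) (anc : Finset V → V) : Prop where
  tail : ∀ F ∈ L, ∀ e, D.Leaves e F → (∀ F' ∈ L, F ⊂ F' → ¬ D.Leaves e F') → D.tail e = anc F
  cut : ∀ F ∈ L, ∀ Z₁ Z₂ : Finset V, Z₁.Nonempty → Z₂.Nonempty → Disjoint Z₁ Z₂ → Z₁ ⊆ F →
    Z₂ ⊆ F → M ≤ D.cutIn w F Z₁ + D.cutIn w F Z₂
  cutAt : ∀ F ∈ L, ∀ a, ∀ Z₁ Z₂ : Finset V, a ∈ Z₁ → Z₂.Nonempty → Disjoint Z₁ Z₂ → Z₁ ⊆ F →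
    Z₂ ⊆ F → M ≤ (D.relocateAll L a).cutIn w F Z₁ + (D.relocateAll L a).cutIn w F Z₂
  anchor : ∀ F ∈ L, ∀ Z : Finset V, Z.Nonempty → Z ⊆ F → anc F ∉ Z → M ≤ 2 * D.cutIn w F Z

theorem cutIn_le [Fintype A] {E : MultiDigraph V A} (w : A → ℝ≥0) {H : Finset A} {F Z : Finset V}
    (h : ∀ e, e ∉ H → E.tail e ∈ F → E.head e ∈ Z → E.tail e ∈ Z) :
    E.cutIn w F Z ≤ weight w (H.filter fun e => E.tail e ∈ F ∧ E.head e ∈ Z) := by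
  apply weight_mono
  intro e he
  simp only [Finset.mem_filter, Finset.mem_univ, true_and] at he ⊢
  obtain ⟨h1, h2, h3⟩ := he
  refine ⟨?_, h1, h3⟩
  by_contra hH
  exact h2 (h e hH h1 h3)

variable [Fintype A] {D : MultiDigraph V A} {w : A → ℝ≥0}
  {L : Finset (Finset V)} {M : ℝ≥0} {anc : Finset V → V} {H : Finset A}

/-- The anchor of `F` is a root, and the set of roots is not entered in `D[F]`. -/
def Central (D : MultiDigraph V A) (L : Finset (Finset V)) (H : Finset A) (anc : Finset V → V)
    (F : Finset V) : Prop :=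
  D.NotEntered L H D F ∧ anc F ∈ D.roots L H F

/-- The root `a` can replace the anchor, and at least half of `M` has been spent on arcs of `H`
inside `F`. -/
def Eccentric (D : MultiDigraph V A) (w : A → ℝ≥0) (L : Finset (Finset V)) (H : Finset A) (M : ℝ≥0)
    (F : Finset V) (a : V) : Prop :=
  a ∈ D.roots L H F ∧ D.NotEntered L H (D.relocateAll L a) F ∧
    M ≤ 2 * weight w (H.filter fun e => D.tail e ∈ F ∧ D.head e ∈ F)

/-- G is an outermost member left by e: a larger one would lie strictly between G and F, against the
maximality of a child, or contain F and with it the head. -/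
theorem Anchored.tail_child (hA : D.Anchored w L M anc) (hL : IsLaminar L) {F G : Finset V}
    (hF : F ∈ L) (hG : IsChild L F G) {e : A} (ht : D.tail e ∈ G) (hh : D.head e ∈ F)
    (hh' : D.head e ∉ G) : D.tail e = anc G := by
  refine hA.tail G hG.1 e ⟨ht, hh'⟩ fun F' hF' hGF' hl => ?_
  have : F' ⊂ F := by
    rcases hL.nested hF' hF hl.1 (hG.2.1.subset ht) with h | h
    · exact h.ssubset_of_ne (fun h' => hl.2 (h' ▸ hh))
    · exact absurd (h hh) hl.2
  exact hGF'.2 (hG.2.2 F' hF' this ⟨_, ht, hl.1⟩)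

theorem Central.goodAt (hA : D.Anchored w L M anc) (hL : IsLaminar L) {F G : Finset V}
    (hF : F ∈ L) (hG : IsChild L F G) (hc : D.Central L H anc G) : D.GoodAt L H D F G :=
  ⟨hc.1, fun _ _ ht hh hh' => hA.tail_child hL hF hG ht hh hh' ▸ hc.2⟩

/-- Relocation to a node outside G moves no tail into G, so the arcs with tail in G are still in
their old place. -/
theorem Central.goodAt_relocateAll (hA : D.Anchored w L M anc) (hL : IsLaminar L)
    {F G : Finset V} (hF : F ∈ L) (hG : IsChild L F G) (hc : D.Central L H anc G) {a : V}
    (ha : a ∉ G) : D.GoodAt L H (D.relocateAll L a) F G := by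
  have key : ∀ e, (D.relocateAll L a).tail e ∈ G → (D.relocateAll L a).tail e = D.tail e := by
    intro e he
    rcases D.relocateAll_tail L a e with h | h
    · exact absurd (h ▸ he) ha
    · exact h.1
  have hgood := hc.goodAt hA hL hF hG
  refine ⟨fun e he ht hh => ?_, fun e he ht hh hh' => ?_⟩
  · have hk := key e ht
    rw [hk] at ht ⊢
    exact hgood.1 e he ht hh
  · have hk := key e ht
    rw [hk] at ht ⊢
    exact hgood.2 e he ht hh hh'

-- Every arc leaving G has been moved to a, which is a root of G.
omit [Fintype A] in
theorem Eccentric.goodAt {F G : Finset V} (hG : IsChild L F G) {a : V}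
    (hc : D.Eccentric w L H M G a) : D.GoodAt L H (D.relocateAll L a) F G := by
  refine ⟨hc.2.1, fun e he ht hh hh' => ?_⟩
  rcases D.relocateAll_tail L a e with h | h
  · rw [h]
    exact hc.1
  · exact absurd ⟨h.1 ▸ ht, hh'⟩ (h.2 G hG.1 (roots_subset hc.1))

-- Distinct children are disjoint, so `H` would have spent M/2 twice.
omit [Fintype A] in
theorem Eccentric.unique (hH : weight w H < M) {F G G' : Finset V} (hG : IsChild L F G)
    (hG' : IsChild L F G') {a a' : V} (hc : D.Eccentric w L H M G a)
    (hc' : D.Eccentric w L H M G' a') : G = G' := by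
  by_contra hne
  have hd : Disjoint (H.filter fun e => D.tail e ∈ G ∧ D.head e ∈ G)
      (H.filter fun e => D.tail e ∈ G' ∧ D.head e ∈ G') := by
    rw [Finset.disjoint_left]
    intro e he he'
    rw [Finset.mem_filter] at he he'
    exact hne (hG.unique hG' he.2.1 he'.2.1)
  have h := weight_add_le w (Finset.filter_subset _ H) (Finset.filter_subset _ H) hd
  have h1 := hc.2.2
  have h2 := hc'.2.2
  have h3 : 2 * M ≤ 2 * weight w H := by
    calc 2 * M = M + M := two_mul M
      _ ≤ _ := add_le_add h1 h2
      _ = 2 * (weight w (H.filter fun e => D.tail e ∈ G ∧ D.head e ∈ G) +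
        weight w (H.filter fun e => D.tail e ∈ G' ∧ D.head e ∈ G')) := by ring
      _ ≤ _ := by gcongr
  have : M ≤ weight w H := le_of_mul_le_mul_left h3 two_pos
  exact absurd hH (not_lt.2 this)

theorem goodAt_of_eccentric (hA : D.Anchored w L M anc) (hL : IsLaminar L) (hH : weight w H < M)
    {F : Finset V} (hF : F ∈ L)
    (hch : ∀ G, IsChild L F G → D.Central L H anc G ∨ ∃ a, D.Eccentric w L H M G a)
    {G₁ : Finset V} (hG₁ : IsChild L F G₁) {a : V} (ha : D.Eccentric w L H M G₁ a) {G : Finset V}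
    (hG : IsChild L F G) : D.GoodAt L H (D.relocateAll L a) F G := by
  by_cases hGG : G = G₁
  · subst hGG
    exact ha.goodAt hG
  · rcases hch G hG with h | ⟨a', h⟩
    · exact h.goodAt_relocateAll hA hL hF hG
        fun haG => hGG (hG.unique hG₁ haG (roots_subset ha.1))
    · exact absurd (h.unique hH hG hG₁ ha) hGG

omit [DecidableEq V] [Fintype A] in
theorem subset_of_meets {F : Finset V} {G : Finset V} (hG : IsChild L F G) {X : Set V}
    (hX : ∀ x z, D.Move L H F x z → z ∈ X → x ∈ X) {x : V} (hxG : x ∈ G) (hxX : x ∈ X) {y : V}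
    (hy : y ∈ G) : y ∈ X :=
  hX y x ⟨hG.2.1.subset hy, hG.2.1.subset hxG, .inl ⟨G, hG, hy, hxG⟩⟩ hxX

omit [DecidableEq V] [Fintype A] in
theorem mem_core_of_child {F : Finset V} {G : Finset V} (hG : IsChild L F G) {X : Set V}
    (hX : ∀ x z, D.Move L H F x z → z ∈ X → x ∈ X) {x : V} (hxG : x ∈ G) (hxX : x ∈ X) {y : V}
    (hy : y ∈ D.roots L H G) : y ∈ D.core L H F X := by
  have hyG := roots_subset hy
  exact ⟨subset_of_meets hG hX hxG hxX hyG, fun G' hG' h => by rwa [hG'.unique hG h hyG]⟩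

/-- Eccentricity is inherited from an eccentric child that meets the reaching set, with the same
node a and the same expense. Otherwise it arises at F itself exactly when the anchor fails to be a
root. -/
theorem central_or_eccentric (hA : D.Anchored w L M anc) (hL : IsLaminar L)
    (hH : weight w H < M) {F : Finset V} (hF : F ∈ L)
    (hne : ∀ G ∈ L, G ⊆ F → (D.roots L H G).Nonempty) :
    D.Central L H anc F ∨ ∃ a, D.Eccentric w L H M F a := by
  classical
  induction F using Finset.strongInduction with
  | _ F ih =>
    have hch : ∀ G, IsChild L F G → D.Central L H anc G ∨ ∃ a, D.Eccentric w L H M G a :=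
      fun G hG => ih G hG.2.1 hG.1 fun G' hG' h => hne G' hG' (h.trans hG.2.1.subset)
    have hXF : ∀ x ∈ D.reaching L H F, x ∈ F := fun x hx => hx.1
    have hroots := D.roots_eq L H F
    by_cases hall : ∀ G, IsChild L F G → (∃ x ∈ G, x ∈ D.reaching L H F) → D.Central L H anc G
    · have hNE : D.NotEntered L H D F := by
        intro e he ht hh
        rw [hroots] at hh ⊢
        exact core_not_entered hL (LEquiv.refl L D) hF hXF reaching_pred
          (fun G hG hx => (hall G hG hx).goodAt hA hL hF hG) he ht hh
      by_cases hanc : anc F ∈ D.roots L H F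
      · exact .inl ⟨hNE, hanc⟩
      · right
        -- Any root serves as a: an arc that has been relocated starts at a, which is a root, and
        -- the other arcs are as in `D`, where the roots are not entered.
        obtain ⟨a, ha⟩ := hne F hF subset_rfl
        refine ⟨a, ha, ?_, ?_⟩
        · intro e he ht hh
          rcases D.relocateAll_tail L a e with h | h
          · rw [h]
            exact ha
          · rw [h.1] at ht ⊢
            exact hNE e he ht hh
        -- The roots form a set that avoids the anchor, so its in-degree inside F is at least M/2,
        -- and all arcs counted there belong to `H`.
        · have hZ := hA.anchor F hF (F.filter fun x => x ∈ D.roots L H F)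
            ⟨a, by simp [ha, roots_subset ha]⟩ (Finset.filter_subset _ _) (by simp [hanc])
          refine hZ.trans (mul_le_mul_right ((cutIn_le (H := H) w ?_).trans (weight_mono w ?_)) 2)
          · intro e he ht hh
            rw [Finset.mem_filter] at hh ⊢
            exact ⟨ht, hNE e he ht hh.2⟩
          · intro e he
            simp only [Finset.mem_filter] at he ⊢
            exact ⟨he.1, he.2.1, he.2.2.1⟩
    · push Not at hall
      obtain ⟨G₁, hG₁, ⟨x, hxG, hxX⟩, hnc⟩ := hall
      obtain ⟨a, ha⟩ := (hch G₁ hG₁).resolve_left hnc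
      refine .inr ⟨a, ?_, ?_, ?_⟩
      · rw [hroots]
        exact mem_core_of_child hG₁ reaching_pred hxG hxX ha.1
      · intro e he ht hh
        rw [hroots] at hh ⊢
        exact core_not_entered hL (D.lEquiv_relocateAll L a) hF hXF reaching_pred
          (fun G hG _ => goodAt_of_eccentric hA hL hH hF hch hG₁ ha hG) he ht hh
      · refine ha.2.2.trans (mul_le_mul_right (weight_mono w ?_) 2)
        intro e he
        simp only [Finset.mem_filter] at he ⊢
        exact ⟨he.1, hG₁.2.1.subset he.2.1, hG₁.2.1.subset he.2.2⟩

/-- Moves inside a child are free, so a predecessor-closed set that meets a child contains it,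
including its roots. -/
theorem core_nonempty {F : Finset V} (hne : ∀ G, IsChild L F G → (D.roots L H G).Nonempty)
    {X : Set V} (hX : ∀ x z, D.Move L H F x z → z ∈ X → x ∈ X) (hX0 : X.Nonempty) :
    (D.core L H F X).Nonempty := by
  obtain ⟨x, hx⟩ := hX0
  by_cases h : ∃ G, IsChild L F G ∧ x ∈ G
  · obtain ⟨G, hG, hxG⟩ := h
    obtain ⟨g, hg⟩ := hne G hG
    exact ⟨g, mem_core_of_child hG hX hxG hx hg⟩
  · exact ⟨x, hx, fun G hG hxG => absurd ⟨G, hG, hxG⟩ h⟩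

open Classical in
/-- Two disjoint sets that are not entered outside `H` form a double cut of weight at most
`w(H)`. -/
theorem double_cut_le {E : MultiDigraph V A} {F Z₁ Z₂ : Finset V}
    (hd : Disjoint Z₁ Z₂) (h₁ : ∀ e, e ∉ H → E.tail e ∈ F → E.head e ∈ Z₁ → E.tail e ∈ Z₁)
    (h₂ : ∀ e, e ∉ H → E.tail e ∈ F → E.head e ∈ Z₂ → E.tail e ∈ Z₂) :
    E.cutIn w F Z₁ + E.cutIn w F Z₂ ≤ weight w H := by
  refine (add_le_add (cutIn_le w h₁) (cutIn_le w h₂)).trans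
    (weight_add_le w (Finset.filter_subset _ _) (Finset.filter_subset _ _) ?_)
  rw [Finset.disjoint_left]
  intro e he he'
  rw [Finset.mem_filter] at he he'
  exact Finset.disjoint_left.1 hd he.2.2 he'.2.2

/-- Without a reaching node there are two disjoint predecessor-closed sets, whose cores are
non-empty. They would be a double cut paid by `H` alone, in `D` or in one relocation of `D`, and
such double cuts weigh at least M. -/
theorem roots_nonempty (hA : D.Anchored w L M anc) (hL : IsLaminar L) (hH : weight w H < M)
    {F : Finset V} (hF : F ∈ L) : (D.roots L H F).Nonempty := by
  classical
  induction F using Finset.strongInduction with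
  | _ F ih =>
    have hne : ∀ G, IsChild L F G → (D.roots L H G).Nonempty := fun G hG => ih G hG.2.1 hG.1
    rcases exists_reaching_or_pair (R := D.Move L H F) (fun x z h => h.1) (hL.1 F hF) with
      ⟨v, hv, hall⟩ | ⟨X, Y, hX0, hY0, hXY, hXF, hYF, hX, hY⟩
    · rw [roots_eq]
      exact core_nonempty hne reaching_pred ⟨v, hv, hall⟩
    · exfalso
      have hch : ∀ G, IsChild L F G → D.Central L H anc G ∨ ∃ a, D.Eccentric w L H M G a :=
        fun G hG => central_or_eccentric hA hL hH hG.1 fun G' hG' h =>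
          ih G' (h.trans_ssubset hG.2.1) hG'
      have hsub : ∀ {Z : Set V}, (∀ x ∈ Z, x ∈ F) → ∀ x, x ∈ D.core L H F Z → x ∈ F :=
        fun hZ x hx => hZ x hx.1
      have hmem : ∀ {Z : Set V}, (∀ x ∈ Z, x ∈ F) → ∀ x,
          x ∈ F.filter (fun x => x ∈ D.core L H F Z) ↔ x ∈ D.core L H F Z :=
        fun hZ x => ⟨fun h => (Finset.mem_filter.1 h).2,
          fun h => Finset.mem_filter.2 ⟨hsub hZ x h, h⟩⟩
      have hdisj : Disjoint (F.filter fun x => x ∈ D.core L H F X)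
          (F.filter fun x => x ∈ D.core L H F Y) := by
        rw [Finset.disjoint_left]
        intro x hx hy
        exact Set.disjoint_left.1 hXY ((hmem hXF x).1 hx).1 ((hmem hYF x).1 hy).1
      have hnon : ∀ {Z : Set V}, (∀ x ∈ Z, x ∈ F) → (∀ x z, D.Move L H F x z → z ∈ Z → x ∈ Z) →
          Z.Nonempty → (F.filter fun x => x ∈ D.core L H F Z).Nonempty := by
        intro Z hZF hZ hZ0
        obtain ⟨x, hx⟩ := core_nonempty hne hZ hZ0
        exact ⟨x, (hmem hZF x).2 hx⟩
      have hle : ∀ E : MultiDigraph V A, LEquiv L D E →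
          (∀ G, IsChild L F G → (∃ x ∈ G, x ∈ X ∨ x ∈ Y) → D.GoodAt L H E F G) →
          E.cutIn w F (F.filter fun x => x ∈ D.core L H F X) +
            E.cutIn w F (F.filter fun x => x ∈ D.core L H F Y) ≤ weight w H := by
        intro E hE hgood
        refine double_cut_le hdisj ?_ ?_
        · intro e he ht hh
          exact (hmem hXF _).2 (core_not_entered hL hE hF hXF hX
            (fun G hG ⟨x, hx, hx'⟩ => hgood G hG ⟨x, hx, .inl hx'⟩) he ht ((hmem hXF _).1 hh))
        · intro e he ht hh
          exact (hmem hYF _).2 (core_not_entered hL hE hF hYF hY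
            (fun G hG ⟨x, hx, hx'⟩ => hgood G hG ⟨x, hx, .inr hx'⟩) he ht ((hmem hYF _).1 hh))
      by_cases hall : ∀ G, IsChild L F G → (∃ x ∈ G, x ∈ X ∨ x ∈ Y) → D.Central L H anc G
      · exact absurd ((hA.cut F hF _ _ (hnon hXF hX hX0) (hnon hYF hY hY0) hdisj
          (Finset.filter_subset _ _) (Finset.filter_subset _ _)).trans
          (hle D (LEquiv.refl L D) fun G hG hx => (hall G hG hx).goodAt hA hL hF hG))
          (not_le.2 hH)
      · push Not at hall
        obtain ⟨G₁, hG₁, ⟨x, hxG, hxX⟩, hnc⟩ := hall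
        obtain ⟨a, ha⟩ := (hch G₁ hG₁).resolve_left hnc
        have h := hle _ (D.lEquiv_relocateAll L a)
          (fun G hG _ => goodAt_of_eccentric hA hL hH hF hch hG₁ ha hG)
        -- The bound `cutAt` is available only for double cuts with a on one side. The core of
        -- whichever of X, Y meets the eccentric child contains a.
        rcases hxX with hxX | hxX
        · exact absurd ((hA.cutAt F hF a _ _
            ((hmem hXF a).2 (mem_core_of_child hG₁ hX hxG hxX ha.1)) (hnon hYF hY hY0) hdisj
            (Finset.filter_subset _ _) (Finset.filter_subset _ _)).trans h) (not_le.2 hH)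
        · rw [add_comm] at h
          exact absurd ((hA.cutAt F hF a _ _
            ((hmem hYF a).2 (mem_core_of_child hG₁ hY hxG hxX ha.1)) (hnon hXF hX hX0) hdisj.symm
            (Finset.filter_subset _ _) (Finset.filter_subset _ _)).trans h) (not_le.2 hH)

end

end MultiDigraph

end CoverArb

/-! ### Tight arborescences grown from roots, and covers from double cuts -/

namespace CoverArb

open Relation

theorem exists_step_out {V : Type*} {R : V → V → Prop} {U : Set V} {u v : V}
    (h : ReflTransGen R u v) (hu : u ∈ U) (hv : v ∉ U) : ∃ x z, R x z ∧ x ∈ U ∧ z ∉ U := by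
  induction h with
  | refl => exact absurd hu hv
  | @tail y z hy hz ih =>
    by_cases hyU : y ∈ U
    · exact ⟨y, z, hz, hyU, hv⟩
    · exact ih hyU

namespace MultiDigraph

variable {V A : Type*}

/-- `B` is an arborescence of root `v` on the node set `U`, without arcs of `H`, and tight with
respect to the members of `L` contained in `F`. -/
structure TightOn (D : MultiDigraph V A) (L : Finset (Finset V)) (H : Finset A) (F U : Finset V)
    (v : V) (B : Finset A) : Prop where
  inside : ∀ e ∈ B, e ∉ H ∧ D.tail e ∈ U ∧ D.head e ∈ U ∧ D.head e ≠ v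
  unique : ∀ e ∈ B, ∀ e' ∈ B, D.head e = D.head e' → e = e'
  reach : ∀ y ∈ U, ReflTransGen (D.Step B) v y
  not_enters : ∀ G ∈ L, G ⊆ F → v ∈ G → ∀ e ∈ B, ¬ D.Enters e G
  once : ∀ G ∈ L, G ⊆ F → ∀ e ∈ B, ∀ e' ∈ B, D.Enters e G → D.Enters e' G → e = e'

theorem tightOn_singleton [DecidableEq V] (D : MultiDigraph V A) (L : Finset (Finset V))
    (H : Finset A) (v : V) : D.TightOn L H {v} {v} v ∅ where
  inside := by simp
  unique := by simp
  reach := by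
    intro y hy
    rw [Finset.mem_singleton.1 hy]
  not_enters := by simp
  once := by simp

variable [DecidableEq V] [DecidableEq A]

/-- U and K are unions of blocks: by `hbU` and `hbK` no proper member meets one of them without
being contained in it. Hence each tightness condition concerns only the old tree, or only the new
tree together with the connecting arc e. F itself is never entered, as all tails are in F. -/
theorem TightOn.extend {D : MultiDigraph V A} {L : Finset (Finset V)} {H : Finset A}
    {F U K : Finset V} {v : V} {B C : Finset A} {e : A} (hB : D.TightOn L H F U v B)
    (hC : D.TightOn L H K K (D.head e) C) (hU : U ⊆ F) (hd : Disjoint U K)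
    (hvU : v ∈ U) (hK : D.head e ∈ K) (ht : D.tail e ∈ U) (heH : e ∉ H)
    (hbU : ∀ G ∈ L, G ⊂ F → ∀ p ∈ G, p ∈ U → G ⊆ U)
    (hbK : ∀ G ∈ L, G ⊂ F → ∀ p ∈ G, p ∈ K → G ⊆ K) (hKF : K ⊆ F) :
    D.TightOn L H F (U ∪ K) v (insert e (B ∪ C)) := by
  have hdis : ∀ {p}, p ∈ U → p ∈ K → False := fun h h' => Finset.disjoint_left.1 hd h h'
  have hB' : ∀ a ∈ B, a ∈ insert e (B ∪ C) := fun a ha => by simp [ha]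
  have hC' : ∀ a ∈ C, a ∈ insert e (B ∪ C) := fun a ha => by simp [ha]
  have inside : ∀ a ∈ insert e (B ∪ C),
      a ∉ H ∧ D.tail a ∈ U ∪ K ∧ D.head a ∈ U ∪ K ∧ D.head a ≠ v := by
    intro a ha
    simp only [Finset.mem_insert, Finset.mem_union] at ha ⊢
    rcases ha with rfl | ha | ha
    · exact ⟨heH, .inl ht, .inr hK, fun h => hdis hvU (h ▸ hK)⟩
    · obtain ⟨h1, h2, h3, h4⟩ := hB.inside a ha
      exact ⟨h1, .inl h2, .inl h3, h4⟩
    · obtain ⟨h1, h2, h3, -⟩ := hC.inside a ha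
      exact ⟨h1, .inr h2, .inr h3, fun h => hdis hvU (h ▸ h3)⟩
  have mem_cases : ∀ a ∈ insert e (B ∪ C), (a ∈ B ∧ D.head a ∈ U) ∨
      ((a = e ∨ a ∈ C) ∧ D.head a ∈ K) := by
    intro a ha
    simp only [Finset.mem_insert, Finset.mem_union] at ha
    rcases ha with rfl | ha | ha
    · exact .inr ⟨.inl rfl, hK⟩
    · exact .inl ⟨ha, (hB.inside a ha).2.2.1⟩
    · exact .inr ⟨.inr ha, (hC.inside a ha).2.2.1⟩
  have not_F : ∀ a ∈ insert e (B ∪ C), ¬ D.Enters a F := fun a ha h =>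
    h.1 (Finset.union_subset hU hKF (inside a ha).2.1)
  refine ⟨inside, ?_, ?_, ?_, ?_⟩
  · intro a ha b hb hab
    rcases mem_cases a ha with ⟨h1, h2⟩ | ⟨h1, h2⟩ <;> rcases mem_cases b hb with ⟨h3, h4⟩ | ⟨h3, h4⟩
    · exact hB.unique a h1 b h3 hab
    · exact absurd (hab ▸ h4) (hdis h2)
    · exact absurd h2 (hdis (hab ▸ h4))
    · rcases h1 with rfl | h1 <;> rcases h3 with rfl | h3
      · rfl
      · exact absurd hab.symm (hC.inside b h3).2.2.2
      · exact absurd hab (hC.inside a h1).2.2.2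
      · exact hC.unique a h1 b h3 hab
  · have hBr : ∀ y ∈ U, ReflTransGen (D.Step (insert e (B ∪ C))) v y := fun y hy =>
      ReflTransGen.mono (fun _ _ h => h.mono hB') _ _ (hB.reach y hy)
    intro y hy
    rcases Finset.mem_union.1 hy with hy | hy
    · exact hBr y hy
    · exact ((hBr _ ht).tail ⟨e, by simp, rfl, rfl⟩).trans
        (ReflTransGen.mono (fun _ _ h => h.mono hC') _ _ (hC.reach y hy))
  · intro G hG hGF hvG a ha haG
    by_cases hGF' : G = F
    · exact not_F a ha (hGF' ▸ haG)
    · rcases mem_cases a ha with ⟨h1, h2⟩ | ⟨h1, h2⟩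
      · exact hB.not_enters G hG hGF hvG a h1 haG
      · exact hdis (hbU G hG (hGF.ssubset_of_ne hGF') v hvG hvU haG.2) h2
  · intro G hG hGF a ha b hb haG hbG
    by_cases hGF' : G = F
    · exact absurd (hGF' ▸ haG) (not_F a ha)
    have hss := hGF.ssubset_of_ne hGF'
    rcases mem_cases a ha with ⟨h1, h2⟩ | ⟨h1, h2⟩
    · rcases mem_cases b hb with ⟨h3, h4⟩ | ⟨h3, h4⟩
      · exact hB.once G hG hGF a h1 b h3 haG hbG
      · exact absurd h4 (hdis (hbU G hG hss _ haG.2 h2 hbG.2))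
    · have hGK := hbK G hG hss _ haG.2 h2
      rcases mem_cases b hb with ⟨h3, h4⟩ | ⟨h3, h4⟩
      · exact absurd (hGK hbG.2) (hdis h4)
      -- If G contains the root of the new tree, that tree does not enter G and e is the only
      -- candidate; if not, e does not enter G.
      · by_cases hz : D.head e ∈ G
        · have hno := hC.not_enters G hG hGK hz
          have h5 : a = e := h1.resolve_right fun h => hno a h haG
          have h6 : b = e := h3.resolve_right fun h => hno b h hbG
          rw [h5, h6]
        · have h5 : a ∈ C := h1.resolve_left fun h => hz (h ▸ haG.2)
          have h6 : b ∈ C := h3.resolve_left fun h => hz (h ▸ hbG.2)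
          exact hC.once G hG hGK a h5 b h6 haG hbG

/-- A tree on a largest union of blocks covers F. Otherwise some move leaves it; this is not a move
inside a child, so it is an arc outside `H` whose head is a root of an untouched child, and the tree
of that child, given by induction, can be attached. -/
theorem exists_tightOn {D : MultiDigraph V A} {L : Finset (Finset V)} (hL : IsLaminar L)
    {H : Finset A} {F : Finset V} (hF : F ∈ L) {v : V} (hv : v ∈ D.roots L H F) :
    ∃ B, D.TightOn L H F F v B := by
  classical
  induction F using Finset.strongInduction generalizing v with
  | _ F ih =>
    -- the block of the contracted node set around a node
    have hblock : ∀ z ∈ F, (∀ G, IsChild L F G → z ∈ G → z ∈ D.roots L H G) →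
        ∃ K C, z ∈ K ∧ K ⊆ F ∧ D.TightOn L H K K z C ∧ (IsChild L F K ∨ K = {z}) ∧
          ∀ G ∈ L, G ⊂ F → ∀ p ∈ G, p ∈ K → G ⊆ K := by
      intro z hz hzG
      by_cases h : ∃ G, IsChild L F G ∧ z ∈ G
      · obtain ⟨G, hG, hz'⟩ := h
        obtain ⟨C, hC⟩ := ih G hG.2.1 hG.1 (hzG G hG hz')
        exact ⟨G, C, hz', hG.2.1.subset, hC, .inl hG,
          fun G' hG' hF' p hp hp' => hG.2.2 G' hG' hF' ⟨p, hp', hp⟩⟩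
      · refine ⟨{z}, ∅, by simp, by simpa using hz, D.tightOn_singleton L H z, .inr rfl, ?_⟩
        intro G' hG' hF' p hp hp'
        rw [Finset.mem_singleton] at hp'
        subst hp'
        obtain ⟨G, hG, hsub⟩ := hL.exists_child hG' hF'
        exact absurd ⟨G, hG, hsub hp⟩ h
    rw [roots_eq] at hv
    let P : Finset V → Prop := fun U => v ∈ U ∧ (∀ G ∈ L, G ⊂ F → ∀ p ∈ G, p ∈ U → G ⊆ U) ∧
      ∃ B, D.TightOn L H F U v B
    have hP0 : ∃ U, U ∈ F.powerset.filter P := by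
      obtain ⟨K, C, hzK, hKF, hC, -, hK⟩ := hblock v hv.1.1 hv.2
      refine ⟨K, Finset.mem_filter.2 ⟨Finset.mem_powerset.2 hKF, hzK, hK, C,
        hC.inside, hC.unique, hC.reach, ?_, ?_⟩⟩
      · intro G hG hGF hvG e he hen
        by_cases hGF' : G = F
        · exact hen.1 (hGF' ▸ hKF (hC.inside e he).2.1)
        · exact hC.not_enters G hG (hK G hG (hGF.ssubset_of_ne hGF') v hvG hzK) hvG e he hen
      · intro G hG hGF e he e' he' hen hen'
        by_cases hGF' : G = F
        · exact absurd (hGF' ▸ hKF (hC.inside e he).2.1) hen.1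
        · exact hC.once G hG (hK G hG (hGF.ssubset_of_ne hGF') _ hen.2 (hC.inside e he).2.2.1)
            e he e' he' hen hen'
    obtain ⟨U, hU, hmax⟩ := Finset.exists_max_image _ Finset.card hP0
    rw [Finset.mem_filter, Finset.mem_powerset] at hU
    obtain ⟨hUF, hvU, hbU, B, hB⟩ := hU
    by_cases hUeq : U = F
    · subst hUeq
      exact ⟨B, hB⟩
    exfalso
    obtain ⟨y, hy, hyU⟩ := Finset.exists_of_ssubset (hUF.ssubset_of_ne hUeq)
    obtain ⟨x, z, hxz, hxU, hzU⟩ := exists_step_out (U := (U : Set V)) (hv.1.2 y hy)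
      (by simpa using hvU) (by simpa using hyU)
    rw [Finset.mem_coe] at hxU hzU
    obtain ⟨hxF, hzF, ⟨G, hG, hxG, hzG⟩ | ⟨e, he, rfl, rfl, hroot⟩⟩ := hxz
    · exact hzU (hbU G hG.1 hG.2.1 x hxG hxU hzG)
    · obtain ⟨K, C, hzK, hKF, hC, hKc, hK⟩ := hblock _ hzF fun G hG hzG =>
        hroot G hG hzG fun hxG => hzU (hbU G hG.1 hG.2.1 _ hxG hxU hzG)
      have hd : Disjoint U K := by
        rw [Finset.disjoint_right]
        intro p hp hpU
        rcases hKc with hKc | rfl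
        · exact hzU (hbU K hKc.1 hKc.2.1 p hp hpU hzK)
        · rw [Finset.mem_singleton] at hp
          exact hzU (hp ▸ hpU)
      have hnew := hB.extend hC hUF hd hvU hzK hxU he hbU hK hKF
      have := hmax (U ∪ K) (Finset.mem_filter.2 ⟨Finset.mem_powerset.2
        (Finset.union_subset hUF hKF), Finset.mem_union_left _ hvU, ?_, _, hnew⟩)
      · rw [Finset.card_union_of_disjoint hd] at this
        have := Finset.card_pos.2 ⟨_, hzK⟩
        omega
      · intro G hG hGF p hp hpUK
        rcases Finset.mem_union.1 hpUK with h | h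
        · exact (hbU G hG hGF p hp h).trans Finset.subset_union_left
        · exact (hK G hG hGF p hp h).trans Finset.subset_union_right

theorem exists_tight_of_mem_roots [Fintype V] {D : MultiDigraph V A} {L : Finset (Finset V)}
    (hL : IsLaminar L) {H : Finset A} (hV : Finset.univ ∈ L) {v : V}
    (hv : v ∈ D.roots L H Finset.univ) :
    ∃ B, D.IsTightArborescence L v B ∧ B ∩ H = ∅ := by
  obtain ⟨B, hB⟩ := exists_tightOn hL hV hv
  refine ⟨B, ⟨?_, ?_, ?_⟩, ?_⟩
  · refine isArborescence_of_reach (fun a ha => (hB.inside a ha).2.2.2) ?_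
      (fun y => hB.reach y (Finset.mem_univ y))
    intro y hy
    rw [Finset.card_eq_one]
    rcases ReflTransGen.cases_tail (hB.reach y (Finset.mem_univ y)) with h | ⟨x, -, a, ha, -, h⟩
    · exact absurd h hy
    · refine ⟨a, ?_⟩
      ext b
      simp only [Finset.mem_filter, Finset.mem_singleton]
      constructor
      · rintro ⟨hb, hby⟩
        exact hB.unique b hb a ha (hby.trans h.symm)
      · rintro rfl
        exact ⟨ha, h⟩
  · intro F hF
    rw [Finset.card_le_one]
    intro a ha b hb
    rw [Finset.mem_filter] at ha hb
    exact hB.once F hF (Finset.subset_univ F) a ha.1 b hb.1 ha.2 hb.2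
  · intro F hF hvF
    rw [Finset.card_eq_zero, Finset.filter_eq_empty_iff]
    exact fun {a} ha => hB.not_enters F hF (Finset.subset_univ F) hvF a ha
  · ext a
    simp only [Finset.mem_inter, Finset.notMem_empty, iff_false, not_and]
    exact fun ha => (hB.inside a ha).1

/-- A set of weight less than `M` misses some tight arborescence. -/
theorem Anchored.exists_tight [Fintype V] [Fintype A] {D : MultiDigraph V A} {w : A → ℝ≥0}
    {L : Finset (Finset V)} {M : ℝ≥0} {anc : Finset V → V} (hA : D.Anchored w L M anc)
    (hL : IsLaminar L) (hV : Finset.univ ∈ L) {H : Finset A} (hH : weight w H < M) :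
    ∃ r B, D.IsTightArborescence L r B ∧ B ∩ H = ∅ := by
  obtain ⟨v, hv⟩ := roots_nonempty hA hL hH hV
  exact ⟨v, exists_tight_of_mem_roots hL hV hv⟩

theorem Anchored.le_of_covers [Fintype V] [Fintype A] {D : MultiDigraph V A} {w : A → ℝ≥0}
    {L : Finset (Finset V)} {M : ℝ≥0} {anc : Finset V → V} (hA : D.Anchored w L M anc)
    (hL : IsLaminar L) (hV : Finset.univ ∈ L) {H : Finset A} (hH : D.CoversTight L H) :
    M ≤ weight w H := by
  by_contra h
  obtain ⟨r, B, hB, hBH⟩ := hA.exists_tight hL hV (not_le.1 h)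
  have := hH r B hB
  rw [hBH] at this
  exact Finset.not_nonempty_empty this

/-- The arcs of a double cut of an equivalent digraph cover all tight arborescences. -/
theorem LEquiv.covers_double_cut [Finite V] [Fintype A] {D E : MultiDigraph V A}
    {L : Finset (Finset V)} (hL : IsLaminar L) (hE : LEquiv L D E) {F Z₁ Z₂ : Finset V}
    (hF : F ∈ L) (h₁ : Z₁.Nonempty) (h₂ : Z₂.Nonempty) (hd : Disjoint Z₁ Z₂) (hs₁ : Z₁ ⊆ F)
    (hs₂ : Z₂ ⊆ F) :
    D.CoversTight L
      (Finset.univ.filter fun e => E.tail e ∈ F ∧ (E.Enters e Z₁ ∨ E.Enters e Z₂)) := by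
  intro r B hB
  obtain ⟨a, ha, h⟩ := (hB.of_lEquiv hL hE).exists_enters hF h₁ h₂ hd hs₁ hs₂
  exact ⟨a, by simpa [ha] using h⟩

omit [DecidableEq A] in
theorem weight_double_cut [Fintype A] (E : MultiDigraph V A) (w : A → ℝ≥0) (F : Finset V)
    {Z₁ Z₂ : Finset V} (hd : Disjoint Z₁ Z₂) :
    weight w (Finset.univ.filter fun e => E.tail e ∈ F ∧ (E.Enters e Z₁ ∨ E.Enters e Z₂)) =
      E.cutIn w F Z₁ + E.cutIn w F Z₂ := by
  classical
  unfold cutIn weight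
  rw [← Finset.sum_union]
  · congr 1
    ext e
    simp only [Finset.mem_filter, Finset.mem_univ, true_and, Finset.mem_union]
    tauto
  · rw [Finset.disjoint_left]
    intro e he he'
    simp only [Finset.mem_filter, Finset.mem_univ, true_and] at he he'
    exact Finset.disjoint_left.1 hd he.2.2 he'.2.2

end MultiDigraph

end CoverArb

namespace CoverArb

namespace MultiDigraph

variable {V A : Type*} [DecidableEq V] [Fintype A]

/-! ### Anchor nodes -/

theorem cutIn_eq_sum (D : MultiDigraph V A) (w : A → ℝ≥0) (F Z : Finset V) :
    D.cutIn w F Z = ∑ e, if D.tail e ∈ F ∧ D.Enters e Z then w e else 0 := by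
  unfold cutIn weight
  rw [Finset.sum_filter]

/-- If there is no anchor, the light sets have no common node. In a smallest subfamily with this
property, the intersections of all members but one are non-empty and pairwise disjoint, so any two
of them have in-degree sum at least M and on average they have at least M/2. But uncrossing shows
that together they are not heavier than the light sets, each of which is below M/2. -/
theorem exists_anchor (D : MultiDigraph V A) (w : A → ℝ≥0) {F : Finset V} (hF : F.Nonempty)
    {M : ℝ≥0} (hM : ∀ Z₁ Z₂ : Finset V, Z₁.Nonempty → Z₂.Nonempty → Disjoint Z₁ Z₂ → Z₁ ⊆ F →
      Z₂ ⊆ F → M ≤ D.cutIn w F Z₁ + D.cutIn w F Z₂) :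
    ∃ t ∈ F, ∀ Z : Finset V, Z.Nonempty → Z ⊆ F → t ∉ Z → M ≤ 2 * D.cutIn w F Z := by
  classical
  by_contra! hcon
  -- a smallest family of light sets without a common node
  let bad := F.powerset.filter fun Z => Z.Nonempty ∧ 2 * D.cutIn w F Z < M
  obtain ⟨S, hS, hmin⟩ := Finset.exists_min_image
    (bad.powerset.filter fun S => ∀ t ∈ F, ∃ Z ∈ S, t ∉ Z) Finset.card (by
      refine ⟨bad, Finset.mem_filter.2 ⟨Finset.mem_powerset_self _, fun t ht => ?_⟩⟩
      obtain ⟨Z, h1, h2, h3, h4⟩ := hcon t ht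
      exact ⟨Z, by simp [bad, h1, h2, h4], h3⟩)
  rw [Finset.mem_filter, Finset.mem_powerset] at hS
  obtain ⟨hSbad, hS0⟩ := hS
  have hb : ∀ X ∈ S, X ⊆ F ∧ X.Nonempty ∧ 2 * D.cutIn w F X < M := fun X hX => by
    simpa [bad] using hSbad hX
  -- The intersection, within F, of all members except X; it is non-empty by the minimality of S.
  let P : Finset V → Finset V := fun X => F.filter fun t => ∀ Y ∈ S.erase X, t ∈ Y
  have hPne : ∀ X ∈ S, (P X).Nonempty := by
    intro X hX
    by_contra h
    rw [Finset.not_nonempty_iff_eq_empty, Finset.filter_eq_empty_iff] at h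
    have hle := hmin (S.erase X) (by
      refine Finset.mem_filter.2 ⟨Finset.mem_powerset.2 ((Finset.erase_subset _ _).trans hSbad), ?_⟩
      intro t ht
      have := h ht
      push Not at this
      exact this)
    have := Finset.card_erase_lt_of_mem hX
    omega
  have hPX : ∀ X ∈ S, ∀ t ∈ P X, t ∉ X := by
    intro X hX t ht htX
    rw [Finset.mem_filter] at ht
    obtain ⟨Y, hY, htY⟩ := hS0 t ht.1
    by_cases hYX : Y = X
    · exact htY (hYX ▸ htX)
    · exact htY (ht.2 Y (Finset.mem_erase.2 ⟨hYX, hY⟩))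
  have hPY : ∀ X, ∀ t ∈ P X, ∀ Y ∈ S, Y ≠ X → t ∈ Y := fun X t ht Y hY hne =>
    (Finset.mem_filter.1 ht).2 Y (Finset.mem_erase.2 ⟨hne, hY⟩)
  have hdisj : ∀ X ∈ S, ∀ Y ∈ S, X ≠ Y → Disjoint (P X) (P Y) := by
    intro X hX Y hY hne
    rw [Finset.disjoint_left]
    exact fun t ht ht' => hPX Y hY t ht' (hPY X t ht Y hY hne.symm)
  have hsum : ∑ X ∈ S, D.cutIn w F (P X) ≤ ∑ X ∈ S, D.cutIn w F X := by
    simp only [cutIn_eq_sum]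
    rw [Finset.sum_comm, Finset.sum_comm (s := S)]
    refine Finset.sum_le_sum fun e _ => ?_
    -- An arc enters at most one of the disjoint sets `P X`. If it does, its tail misses some other
    -- member Y, while its head lies in Y, so it enters Y as well.
    by_cases h : ∃ X ∈ S, D.tail e ∈ F ∧ D.Enters e (P X)
    · obtain ⟨X, hX, ht, hen⟩ := h
      rw [Finset.sum_eq_single X]
      · rw [if_pos ⟨ht, hen⟩]
        have : ∃ Y ∈ S, Y ≠ X ∧ D.tail e ∉ Y := by
          by_contra! hc
          refine hen.1 (Finset.mem_filter.2 ⟨ht, fun Y hY => ?_⟩)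
          rw [Finset.mem_erase] at hY
          exact hc Y hY.2 hY.1
        obtain ⟨Y, hY, hne, htY⟩ := this
        have hle := Finset.single_le_sum (f := fun Y => if D.tail e ∈ F ∧ D.Enters e Y then w e
          else 0) (fun _ _ => zero_le) hY
        refine le_trans ?_ hle
        rw [if_pos ⟨ht, htY, hPY X _ hen.2 Y hY hne⟩]
      · intro Y hY hne
        rw [if_neg]
        rintro ⟨-, -, hY'⟩
        exact Finset.disjoint_left.1 (hdisj Y hY X hX hne) hY' hen.2
      · exact fun h => absurd hX h
    · push Not at h
      rw [Finset.sum_eq_zero]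
      · exact zero_le
      · intro X hX
        rw [if_neg]
        rintro ⟨h1, h2⟩
        exact h X hX h1 h2
  have hpair : ∀ X ∈ S, ∀ Y ∈ S, X ≠ Y → M ≤ D.cutIn w F (P X) + D.cutIn w F (P Y) :=
    fun X hX Y hY hne => hM _ _ (hPne X hX) (hPne Y hY) (hdisj X hX Y hY hne)
      (Finset.filter_subset _ _) (Finset.filter_subset _ _)
  obtain ⟨t, ht⟩ := hF
  obtain ⟨X₁, hX₁, -⟩ := hS0 t ht
  obtain ⟨X, hX, hXmin⟩ := Finset.exists_min_image S (fun X => D.cutIn w F (P X)) ⟨X₁, hX₁⟩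
  obtain ⟨x, hx⟩ := (hb X hX).2.1
  -- A second member is needed since `P X`, being the lightest, may be below M/2: it is paired with
  -- `P Y`, and every other one is at least M/2 on its own.
  obtain ⟨Y, hY, hxY⟩ := hS0 x ((hb X hX).1 hx)
  have hYX : Y ≠ X := fun h => hxY (h ▸ hx)
  have hYS : Y ∈ S.erase X := Finset.mem_erase.2 ⟨hYX, hY⟩
  have hother : ∀ Z ∈ (S.erase X).erase Y, M ≤ 2 * D.cutIn w F (P Z) := by
    intro Z hZ
    simp only [Finset.mem_erase] at hZ
    have h1 := hpair X hX Z hZ.2.2 (Ne.symm hZ.2.1)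
    have h2 := hXmin Z hZ.2.2
    calc M ≤ _ := h1
      _ ≤ _ := add_le_add_left h2 _
      _ = _ := (two_mul _).symm
  have h1 : ∑ Z ∈ S, M ≤ ∑ Z ∈ S, 2 * D.cutIn w F (P Z) := by
    rw [← Finset.add_sum_erase S _ hX, ← Finset.add_sum_erase _ _ hYS,
      ← Finset.add_sum_erase S _ hX, ← Finset.add_sum_erase _ _ hYS, ← add_assoc, ← add_assoc]
    refine add_le_add ?_ (Finset.sum_le_sum hother)
    rw [← mul_add, two_mul]
    exact add_le_add (hpair X hX Y hY hYX.symm) (hpair X hX Y hY hYX.symm)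
  have h2 : ∑ Z ∈ S, 2 * D.cutIn w F Z < ∑ Z ∈ S, M :=
    Finset.sum_lt_sum_of_nonempty ⟨X, hX⟩ fun Z hZ => (hb Z hZ).2.2
  rw [← Finset.mul_sum] at h1 h2
  exact absurd (h1.trans (mul_le_mul_right hsum 2)) (not_le.2 h2)

theorem inDeg_induce (D : MultiDigraph V A) (w : A → ℝ≥0) (F : Finset V)
    (Z : Finset {v : V // v ∈ F}) :
    (D.induce F).inDeg (fun a => w a.1) Z = D.cutIn w F (Z.map (Function.Embedding.subtype _)) := by
  unfold inDeg cutIn weight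
  refine Finset.sum_bij (fun a _ => a.1) ?_ ?_ ?_ ?_
  · intro a ha
    rw [Finset.mem_filter] at ha ⊢
    obtain ⟨-, h1, h2⟩ := ha
    simp only [induce] at h1 h2
    refine ⟨Finset.mem_univ _, a.2.1, ?_, ?_⟩
    · simpa using fun _ => h1
    · simpa using ⟨a.2.2, h2⟩
  · intro a _ b _ h
    exact Subtype.ext h
  · intro a ha
    rw [Finset.mem_filter] at ha
    obtain ⟨-, h1, h2, h3⟩ := ha
    simp only [Finset.mem_map, Function.Embedding.subtype_apply, Subtype.exists, exists_and_right,
      exists_eq_right] at h2 h3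
    obtain ⟨h4, h5⟩ := h3
    refine ⟨⟨a, h1, h4⟩, ?_, rfl⟩
    rw [Finset.mem_filter]
    exact ⟨Finset.mem_univ _, fun h => h2 ⟨h1, h⟩, h5⟩
  · intro a _
    rfl

theorem map_subtype_self {F Z : Finset V} (h : Z ⊆ F) :
    (Z.subtype (· ∈ F)).map (Function.Embedding.subtype _) = Z := by
  rw [Finset.subtype_map]
  exact Finset.filter_true_of_mem fun x hx => h hx

theorem inDeg_induce_subtype (D : MultiDigraph V A) (w : A → ℝ≥0) {F Z : Finset V} (h : Z ⊆ F) :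
    (D.induce F).inDeg (fun a => w a.1) (Z.subtype (· ∈ F)) = D.cutIn w F Z := by
  rw [inDeg_induce, map_subtype_self h]

omit [DecidableEq V] in
theorem map_subtype_subset {F : Finset V} (Z : Finset {v : V // v ∈ F}) :
    Z.map (Function.Embedding.subtype _) ⊆ F := by
  intro x hx
  simp only [Finset.mem_map, Function.Embedding.subtype_apply, Subtype.exists, exists_and_right,
    exists_eq_right] at hx
  exact hx.1

theorem le_muOn_iff (D : MultiDigraph V A) (w : A → ℝ≥0) (F : Finset V) (M : ℝ≥0∞) :
    M ≤ D.muOn w F ↔ ∀ Z₁ Z₂ : Finset V, Z₁.Nonempty → Z₂.Nonempty → Disjoint Z₁ Z₂ → Z₁ ⊆ F →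
      Z₂ ⊆ F → M ≤ (D.cutIn w F Z₁ : ℝ≥0∞) + D.cutIn w F Z₂ := by
  unfold muOn mu
  simp only [le_iInf_iff]
  constructor
  · intro h Z₁ Z₂ h₁ h₂ hd hs₁ hs₂
    have := h (Z₁.subtype (· ∈ F)) (Z₂.subtype (· ∈ F)) ⟨?_, ?_, ?_⟩
    · rwa [inDeg_induce_subtype D w hs₁, inDeg_induce_subtype D w hs₂] at this
    · obtain ⟨x, hx⟩ := h₁
      exact ⟨⟨x, hs₁ hx⟩, by simpa using hx⟩
    · obtain ⟨x, hx⟩ := h₂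
      exact ⟨⟨x, hs₂ hx⟩, by simpa using hx⟩
    · rw [Finset.disjoint_left] at hd ⊢
      intro x hx hx'
      rw [Finset.mem_subtype] at hx hx'
      exact hd hx hx'
  · rintro h Z₁ Z₂ ⟨h₁, h₂, hd⟩
    rw [inDeg_induce, inDeg_induce]
    exact h _ _ (h₁.map) (h₂.map) ((Finset.disjoint_map _).2 hd) (map_subtype_subset _)
      (map_subtype_subset _)

theorem muOn_le (D : MultiDigraph V A) (w : A → ℝ≥0) {F Z₁ Z₂ : Finset V} (h₁ : Z₁.Nonempty)
    (h₂ : Z₂.Nonempty) (hd : Disjoint Z₁ Z₂) (hs₁ : Z₁ ⊆ F) (hs₂ : Z₂ ⊆ F) :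
    D.muOn w F ≤ (D.cutIn w F Z₁ : ℝ≥0∞) + D.cutIn w F Z₂ :=
  (le_muOn_iff D w F _).1 le_rfl Z₁ Z₂ h₁ h₂ hd hs₁ hs₂

theorem isAnchorOn_iff (D : MultiDigraph V A) (w : A → ℝ≥0) (F : Finset V) (t : {v : V // v ∈ F}) :
    D.IsAnchorOn w F t ↔ ∀ Z : Finset V, Z.Nonempty → Z ⊆ F → t.1 ∉ Z →
      D.muOn w F / 2 ≤ (D.cutIn w F Z : ℝ≥0∞) := by
  unfold IsAnchorOn IsAnchor
  constructor
  · intro h Z hZ hs ht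
    have := h (Z.subtype (· ∈ F)) (by
      obtain ⟨x, hx⟩ := hZ
      exact ⟨⟨x, hs hx⟩, by simpa using hx⟩) (by simpa using ht)
    rwa [inDeg_induce_subtype D w hs] at this
  · intro h Z hZ ht
    rw [inDeg_induce]
    exact h _ hZ.map (map_subtype_subset _) (by simpa using ht)

theorem exists_isAnchorOn (D : MultiDigraph V A) (w : A → ℝ≥0) {F : Finset V} (hF : F.Nonempty) :
    ∃ t, D.IsAnchorOn w F t := by
  by_cases htop : D.muOn w F = ⊤
  -- With an infinite value there is no double cut, hence no non-empty set avoiding t: otherwise it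
  -- and {t} would form one.
  · obtain ⟨t, ht⟩ := hF
    refine ⟨⟨t, ht⟩, (isAnchorOn_iff D w F _).2 fun Z hZ hs htZ => ?_⟩
    have := muOn_le D w (Z₁ := {t}) (by simp) hZ (by simpa using htZ) (by simpa using ht) hs
    rw [htop, top_le_iff] at this
    exact absurd this (by simp)
  · lift D.muOn w F to ℝ≥0 using htop with M hM
    obtain ⟨t, ht, h⟩ := D.exists_anchor w hF (M := M) (by
      intro Z₁ Z₂ h₁ h₂ hd hs₁ hs₂
      have := muOn_le D w h₁ h₂ hd hs₁ hs₂
      rw [← hM] at this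
      exact_mod_cast this)
    refine ⟨⟨t, ht⟩, (isAnchorOn_iff D w F _).2 fun Z hZ hs htZ => ?_⟩
    rw [← hM]
    apply ENNReal.div_le_of_le_mul
    rw [mul_comm]
    exact_mod_cast h Z hZ hs htZ

/-! ### The first phase -/

/-- The two digraphs have the same arcs inside `F`. -/
def AgreeOn (F : Finset V) (D E : MultiDigraph V A) : Prop :=
  (∀ e, D.head e = E.head e) ∧
    ∀ e, D.head e ∈ F → D.tail e = E.tail e ∨ (D.tail e ∉ F ∧ E.tail e ∉ F)

theorem AgreeOn.cutIn_eq {F Z : Finset V} {D E : MultiDigraph V A} (h : AgreeOn F D E)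
    (w : A → ℝ≥0) (hZ : Z ⊆ F) : D.cutIn w F Z = E.cutIn w F Z := by
  unfold cutIn Enters
  congr 1
  ext e
  simp only [Finset.mem_filter, Finset.mem_univ, true_and]
  rw [← h.1 e]
  by_cases he : D.head e ∈ Z
  · rcases h.2 e (hZ he) with h1 | h1
    · rw [h1]
    · simp [h1.1, h1.2]
  · simp [he]

theorem AgreeOn.muOn_eq {F : Finset V} {D E : MultiDigraph V A} (h : AgreeOn F D E)
    (w : A → ℝ≥0) : D.muOn w F = E.muOn w F := by
  refine eq_of_forall_le_iff fun M => ?_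
  rw [le_muOn_iff, le_muOn_iff]
  constructor
  · intro h' Z₁ Z₂ h₁ h₂ hd hs₁ hs₂
    rw [← h.cutIn_eq w hs₁, ← h.cutIn_eq w hs₂]
    exact h' Z₁ Z₂ h₁ h₂ hd hs₁ hs₂
  · intro h' Z₁ Z₂ h₁ h₂ hd hs₁ hs₂
    rw [h.cutIn_eq w hs₁, h.cutIn_eq w hs₂]
    exact h' Z₁ Z₂ h₁ h₂ hd hs₁ hs₂

-- An arc with head in F and tail outside F cannot be moved into F: a member left by it and
-- containing a would lie inside F, like its tail. This is why `D_a[F]` may be computed before the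
-- first phase is finished.
omit [Fintype A] in
theorem AgreeOn.relocateAll {L : Finset (Finset V)} (hL : IsLaminar L) {F : Finset V}
    (hF : F ∈ L) {D E : MultiDigraph V A} (h : AgreeOn F D E) {a : V} (ha : a ∈ F) :
    AgreeOn F (D.relocateAll L a) (E.relocateAll L a) := by
  have out : ∀ (D : MultiDigraph V A) e, D.head e ∈ F → D.tail e ∉ F →
      (D.relocateAll L a).tail e ∉ F := by
    intro D e hh ht
    rcases D.relocateAll_tail L a e with h1 | h1
    · exfalso
      have hne : (D.relocateAll L a).tail e ≠ D.tail e := fun h2 => ht (by rw [← h2, h1]; exact ha)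
      rcases (D.lEquiv_relocateAll L a).tail e with h2 | ⟨G, hG, h2, h3, h4⟩
      · exact hne h2.symm
      · rw [h1] at h3
        rcases hL.nested hG hF h3 ha with h5 | h5
        · exact ht (h5 h2)
        · exact h4 (h5 hh)
    · rwa [h1.1]
  refine ⟨h.1, fun e he => ?_⟩
  change D.head e ∈ F at he
  rcases h.2 e he with h1 | ⟨h1, h2⟩
  · left
    have : ∀ G, D.Leaves e G ↔ E.Leaves e G := fun G => by
      unfold Leaves
      rw [h1, h.1 e]
    simp only [MultiDigraph.relocateAll, this, h1]
  · exact .inr ⟨out D e he h1, out E e (h.1 e ▸ he) h2⟩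

/-- The first phase, with an arbitrary criterion `Q` for anchors. -/
inductive Run (Q : MultiDigraph V A → Finset V → V → Prop) (D : MultiDigraph V A)
    (L : Finset (Finset V)) : MultiDigraph V A → Finset (Finset V) → Prop
  | start : Run Q D L D L
  | step {D' : MultiDigraph V A} {L' : Finset (Finset V)} {F : Finset V} {t : V} :
      Run Q D L D' L' → Minimal (fun X => X ∈ L') F → t ∈ F → Q D' F t →
      Run Q D L (D'.relocate F t) (L'.erase F)

/-- The criterion is left open in `Run` because the program, too, is analysed as such a run, with
`GoodAnchor` in place of the definition of an anchor. -/
theorem FirstPhase.run {D : MultiDigraph V A} {w : A → ℝ≥0} {L : Finset (Finset V)}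
    {D' : MultiDigraph V A} {L' : Finset (Finset V)} (h : D.FirstPhase w L D' L') :
    D.Run (fun E F t => ∀ Z : Finset V, Z.Nonempty → Z ⊆ F → t ∉ Z →
      E.muOn w F / 2 ≤ (E.cutIn w F Z : ℝ≥0∞)) L D' L' := by
  induction h with
  | start => exact .start
  | @step D' L' F t _ hmin ht ih => exact .step ih hmin t.2 ((isAnchorOn_iff D' w F t).1 ht)

omit [Fintype A] in
theorem relocate_tail (D : MultiDigraph V A) (F : Finset V) (t : V) (e : A) :
    (D.Leaves e F ∧ (D.relocate F t).tail e = t) ∨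
      (¬ D.Leaves e F ∧ (D.relocate F t).tail e = D.tail e) := by
  by_cases h : D.Leaves e F
  · exact .inl ⟨h, by simp only [relocate, if_pos h]⟩
  · exact .inr ⟨h, by simp only [relocate, if_neg h]⟩

omit [Fintype A] in
theorem Run.subset {Q : MultiDigraph V A → Finset V → V → Prop} {D : MultiDigraph V A}
    {L : Finset (Finset V)} {D' : MultiDigraph V A} {L' : Finset (Finset V)}
    (h : D.Run Q L D' L') : L' ⊆ L := by
  induction h with
  | start => exact subset_rfl
  | step _ _ _ _ ih => exact (Finset.erase_subset _ _).trans ih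

omit [Fintype A] in
theorem Run.lEquiv {Q : MultiDigraph V A → Finset V → V → Prop} {D : MultiDigraph V A}
    {L : Finset (Finset V)} (hL : IsLaminar L) {D' : MultiDigraph V A} {L' : Finset (Finset V)}
    (h : D.Run Q L D' L') : LEquiv L D D' := by
  induction h with
  | start => exact LEquiv.refl L D
  | @step D' L' F t hr hmin ht _ ih =>
    refine ih.trans hL ⟨fun _ => rfl, fun e => ?_⟩
    rcases D'.relocate_tail F t e with ⟨h1, h2⟩ | ⟨h1, h2⟩
    · exact .inr ⟨F, hr.subset hmin.1, h1.1, by rw [h2]; exact ht, h1.2⟩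
    · exact .inl h2.symm

-- A set processed later is never inside an earlier one, so it does not change the arcs inside that
-- one, and an earlier anchor remains valid. It may move arcs leaving an earlier set G out of G's
-- anchor only when it contains G, and then these arcs leave a larger processed set; hence the
-- restriction to arcs leaving no larger one.
omit [Fintype A] in
theorem Run.processed {Q : MultiDigraph V A → Finset V → V → Prop} {D : MultiDigraph V A}
    {L : Finset (Finset V)} (hL : IsLaminar L)
    (hQ : ∀ F ∈ L, ∀ D E t, AgreeOn F D E → Q D F t → Q E F t)
    {D' : MultiDigraph V A} {L' : Finset (Finset V)} (h : D.Run Q L D' L') :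
    (∀ F ∈ L, F ∉ L' → ∀ G ∈ L', ¬ G ⊂ F) ∧ ∀ F ∈ L, F ∉ L' → ∃ t, Q D' F t ∧
      ∀ e, D'.Leaves e F → (∀ F' ∈ L, F' ∉ L' → F ⊂ F' → ¬ D'.Leaves e F') → D'.tail e = t := by
  induction h with
  | start => exact ⟨fun F hF hF' => absurd hF hF', fun F hF hF' => absurd hF hF'⟩
  | @step D' L' F t hr hmin ht hQF ih =>
    obtain ⟨ih1, ih2⟩ := ih
    have hFL : F ∈ L := hr.subset hmin.1
    have hcase : ∀ G ∈ L, G ∉ L'.erase F → G = F ∨ G ∉ L' := fun G hG hG' => by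
      by_contra! hc
      exact hG' (Finset.mem_erase.2 hc)
    refine ⟨?_, ?_⟩
    · intro G hG hG' K hK hKG
      have hK' := Finset.mem_of_mem_erase hK
      rcases hcase G hG hG' with rfl | hG'
      · exact hKG.2 (hmin.2 hK' hKG.subset)
      · exact ih1 G hG hG' K hK' hKG
    · intro G hG hG'
      rcases hcase G hG hG' with rfl | hG'
      · refine ⟨t, hQ G hG D' _ t ⟨fun _ => rfl, fun e he => ?_⟩ hQF, ?_⟩
        · rcases D'.relocate_tail G t e with ⟨h1, -⟩ | ⟨-, h2⟩
          · exact absurd he h1.2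
          · exact .inl h2.symm
        · intro e he _
          rcases D'.relocate_tail G t e with ⟨-, h2⟩ | ⟨h1, h2⟩
          · exact h2
          · exact absurd ⟨h2 ▸ he.1, he.2⟩ h1
      · obtain ⟨t', hQt', htail⟩ := ih2 G hG hG'
        have hnot : ¬ F ⊆ G := fun h =>
          ih1 G hG hG' F hmin.1 (h.ssubset_of_ne fun h' => hG' (h' ▸ hmin.1))
        refine ⟨t', hQ G hG D' _ t' ⟨fun _ => rfl, fun e he => ?_⟩ hQt', ?_⟩
        · rcases D'.relocate_tail F t e with ⟨h1, h2⟩ | ⟨-, h2⟩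
          · right
            have hout : ∀ x ∈ F, x ∉ G := fun x hx hxG => by
              rcases hL.nested hFL hG hx hxG with h | h
              · exact hnot h
              · exact h1.2 (h he)
            exact ⟨hout _ h1.1, by rw [h2]; exact hout t ht⟩
          · exact .inl h2.symm
        · intro e he hmax
          rcases D'.relocate_tail F t e with ⟨h1, h2⟩ | ⟨h1, h2⟩
          -- The arc has just been moved to a node of G by a set F that is not inside G. So F
          -- strictly contains G and is left by the arc, which is excluded.
          · exfalso
            have h3 : t ∈ G := h2 ▸ he.1
            rcases hL.nested hFL hG ht h3 with h | h
            · exact hnot h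
            · exact hmax F hFL (by simp) (h.ssubset_of_ne fun h' => hnot (h' ▸ subset_rfl))
                ⟨by rw [h2]; exact ht, h1.2⟩
          · rw [h2]
            refine htail e ⟨h2 ▸ he.1, he.2⟩ fun F' hF' hF'' hs hl => ?_
            exact hmax F' hF' (fun h => hF'' (Finset.mem_of_mem_erase h)) hs ⟨h2 ▸ hl.1, hl.2⟩

omit [Fintype A] in
theorem Run.exists_anchors {Q : MultiDigraph V A → Finset V → V → Prop} {D : MultiDigraph V A}
    {L : Finset (Finset V)} (hL : IsLaminar L) (hV : L.Nonempty)
    (hQ : ∀ F ∈ L, ∀ D E t, AgreeOn F D E → Q D F t → Q E F t)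
    {D' : MultiDigraph V A} (h : D.Run Q L D' ∅) :
    ∃ anc : Finset V → V, ∀ F ∈ L, Q D' F (anc F) ∧
      ∀ e, D'.Leaves e F → (∀ F' ∈ L, F ⊂ F' → ¬ D'.Leaves e F') → D'.tail e = anc F := by
  classical
  obtain ⟨F₀, hF₀⟩ := hV
  obtain ⟨v₀, -⟩ := hL.1 F₀ hF₀
  have hp := (h.processed hL hQ).2
  refine ⟨fun F => if hF : F ∈ L then (hp F hF (Finset.notMem_empty F)).choose else v₀, ?_⟩
  intro F hF
  simp only [dif_pos hF]
  obtain ⟨h1, h2⟩ := (hp F hF (Finset.notMem_empty F)).choose_spec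
  exact ⟨h1, fun e he hmax => h2 e he fun F' hF' _ => hmax F' hF'⟩

/-! ### Correctness of the algorithm -/

theorem FirstPhase.exists_anchor {D : MultiDigraph V A} {w : A → ℝ≥0} {L : Finset (Finset V)}
    (hL : IsLaminar L) {D' : MultiDigraph V A} {L' : Finset (Finset V)}
    (h : D.FirstPhase w L D' L') {F : Finset V} (hF : F ∈ L') : ∃ t, D'.IsAnchorOn w F t :=
  D'.exists_isAnchorOn w (hL.1 F (h.run.subset hF))

theorem FirstPhase.complete {D : MultiDigraph V A} {w : A → ℝ≥0} {L : Finset (Finset V)}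
    (hL : IsLaminar L) : ∀ (n : ℕ) {D' : MultiDigraph V A} {L' : Finset (Finset V)},
    L'.card = n → D.FirstPhase w L D' L' → ∃ D'', D.FirstPhase w L D'' ∅
  | 0, D', L', hn, h => ⟨D', Finset.card_eq_zero.1 hn ▸ h⟩
  | n + 1, D', L', hn, h => by
    obtain ⟨F, hF⟩ := L'.exists_minimal (Finset.card_pos.1 (by omega))
    obtain ⟨t, ht⟩ := h.exists_anchor hL hF.1
    exact FirstPhase.complete hL n (by rw [Finset.card_erase_of_mem hF.1, hn]; rfl)
      (h.step hF ht)

variable [Fintype V] [DecidableEq A]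

theorem LEquiv.gamma_le {D E : MultiDigraph V A} {w : A → ℝ≥0} {L : Finset (Finset V)}
    (hL : IsLaminar L) (hE : LEquiv L D E) {F : Finset V} (hF : F ∈ L) :
    D.gamma w L ≤ E.muOn w F := by
  rw [le_muOn_iff]
  intro Z₁ Z₂ h₁ h₂ hd hs₁ hs₂
  have := iInf₂_le (f := fun (H : Finset A) (_ : D.CoversTight L H) => (weight w H : ℝ≥0∞))
    _ (hE.covers_double_cut hL hF h₁ h₂ hd hs₁ hs₂)
  rw [weight_double_cut E w F hd] at this
  exact_mod_cast this

theorem FirstPhase.secondPhase_eq {D : MultiDigraph V A} {w : A → ℝ≥0} {L : Finset (Finset V)}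
    (hL : IsLaminar L) (hV : Finset.univ ∈ L) {D' : MultiDigraph V A}
    (h : D.FirstPhase w L D' ∅) : D'.secondPhase w L = D.gamma w L := by
  have hE := h.run.lEquiv hL
  apply le_antisymm
  · refine le_iInf₂ fun H hH => ?_
    by_contra hlt
    -- A finite M strictly above w(H) is chosen, as the returned value may be infinite.
    obtain ⟨M, hM1, hM2⟩ := ENNReal.lt_iff_exists_nnreal_btwn.1 (not_le.1 hlt)
    have hterm : ∀ F ∈ L, (M : ℝ≥0∞) ≤ D'.muOn w F ∧
        ∀ a ∈ F, (M : ℝ≥0∞) ≤ (D'.relocateAll L a).muOn w F := by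
      intro F hF
      have := hM2.le.trans (iInf₂_le F hF)
      rw [le_inf_iff] at this
      exact ⟨this.1, fun a ha => this.2.trans (iInf₂_le a ha)⟩
    obtain ⟨anc, hanc⟩ := h.run.exists_anchors hL ⟨_, hV⟩ (by
      intro F hF D E t hag hD Z hZ hs ht
      rw [← hag.muOn_eq, ← hag.cutIn_eq w hs]
      exact hD Z hZ hs ht)
    have hA : D'.Anchored w L M anc := by
      refine ⟨fun F hF => (hanc F hF).2, ?_, ?_, ?_⟩
      · intro F hF Z₁ Z₂ h₁ h₂ hd hs₁ hs₂
        exact_mod_cast (hterm F hF).1.trans (muOn_le D' w h₁ h₂ hd hs₁ hs₂)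
      · intro F hF a Z₁ Z₂ h₁ h₂ hd hs₁ hs₂
        exact_mod_cast ((hterm F hF).2 a (hs₁ h₁)).trans (muOn_le _ w ⟨a, h₁⟩ h₂ hd hs₁ hs₂)
      · intro F hF Z hZ hs ht
        have h1 := (ENNReal.div_le_div_right (hterm F hF).1 2).trans ((hanc F hF).1 Z hZ hs ht)
        rw [ENNReal.div_le_iff_le_mul (by simp) (by simp), mul_comm] at h1
        exact_mod_cast h1
    have := hA.le_of_covers hL hV ((hE.coversTight_iff hL).1 hH)
    exact absurd hM1 (not_lt.2 (by exact_mod_cast this))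
  · refine le_iInf₂ fun F hF => le_inf (hE.gamma_le hL hF) (le_iInf₂ fun a ha => ?_)
    exact (hE.trans hL (D'.lEquiv_relocateAll L a)).gamma_le hL hF

end MultiDigraph

end CoverArb

namespace CoverArb

/-! ### Reasoning about programs -/

/-- The value of a scalar. -/
abbrev NExpr.var (x : ℕ) : NExpr := .get x (.lit 0) (.lit 0)

/-- An entry of the first column. -/
abbrev NExpr.col (x : ℕ) (i : NExpr) : NExpr := .get x i (.lit 0)

/-- The value of a scalar. -/
abbrev RExpr.var (x : ℕ) : RExpr := .get x (.lit 0) (.lit 0)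

/-- An entry of the first column. -/
abbrev RExpr.col (x : ℕ) (i : NExpr) : RExpr := .get x i (.lit 0)

/-- Disjunction of tests. -/
abbrev BExpr.or (a b : BExpr) : BExpr := .neg (.and (.neg a) (.neg b))

/-- Equality of natural numbers. -/
abbrev BExpr.eq (a b : NExpr) : BExpr := .and (.nle a b) (.nle b a)

/-- Strict inequality of real numbers. -/
abbrev BExpr.rlt (a b : RExpr) : BExpr := .neg (.rle b a)

theorem BExpr.holds_or (a b : BExpr) (σ : Mem) :
    (BExpr.or a b).holds σ ↔ a.holds σ ∨ b.holds σ := by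
  simp only [BExpr.holds]
  tauto

theorem BExpr.holds_eq (a b : NExpr) (σ : Mem) : (BExpr.eq a b).holds σ ↔ a.eval σ = b.eval σ := by
  simp only [BExpr.holds]
  omega

theorem BExpr.holds_rlt (a b : RExpr) (σ : Mem) :
    (BExpr.rlt a b).holds σ ↔ a.eval σ < b.eval σ := by
  simp only [BExpr.holds, not_le]

attribute [simp] NExpr.eval RExpr.eval BExpr.holds

/-- The network with the given lists of tails, heads and capacities. -/
def mkNet (N M : ℕ) (tl hd : ℕ → ℕ) (cp : ℕ → ℝ) (s t : ℕ) : Network where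
  N := N
  M := M
  tail e := tl e
  head e := hd e
  cap e := cp e
  s := s
  t := t

namespace Prog

open Classical in
/-- The final memory of a program. -/
noncomputable def exec (O : Network → Finset ℕ) : Prog → Mem → Mem
  | skip, σ => σ
  | setNat x i j e, σ => σ.setNat x (i.eval σ) (j.eval σ) (e.eval σ)
  | setReal x i j e, σ => σ.setReal x (i.eval σ) (j.eval σ) (e.eval σ)
  | seq p q, σ => q.exec O (p.exec O σ)
  | ite b p q, σ => if b.holds σ then p.exec O σ else q.exec O σ
  | loop x e p, σ => Nat.rec σ (fun i τ => p.exec O (τ.setNat x 0 0 i)) (e.eval σ)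
  | minCut N M s t tl hd cp out, σ =>
      { σ with
        nat := fun x i j =>
          if x = out ∧ i < N.eval σ ∧ j = 0 then
            (if i ∈ O (mkNet (N.eval σ) (M.eval σ) (fun e => σ.nat tl e 0) (fun e => σ.nat hd e 0)
              (fun e => σ.real cp e 0) (s.eval σ) (t.eval σ)) then 1 else 0)
          else σ.nat x i j }

section

variable (O : Network → Finset ℕ) (σ : Mem)

@[simp] theorem exec_skip : skip.exec O σ = σ := rfl

@[simp] theorem exec_setNat (x : ℕ) (i j e : NExpr) :
    (setNat x i j e).exec O σ = σ.setNat x (i.eval σ) (j.eval σ) (e.eval σ) := rfl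

@[simp] theorem exec_setReal (x : ℕ) (i j : NExpr) (e : RExpr) :
    (setReal x i j e).exec O σ = σ.setReal x (i.eval σ) (j.eval σ) (e.eval σ) := rfl

@[simp] theorem exec_seq (p q : Prog) : (seq p q).exec O σ = q.exec O (p.exec O σ) := rfl

open Classical in
theorem exec_ite (b : BExpr) (p q : Prog) :
    (ite b p q).exec O σ = if b.holds σ then p.exec O σ else q.exec O σ := rfl

theorem exec_ite_pos {b : BExpr} (p q : Prog) (h : b.holds σ) :
    (ite b p q).exec O σ = p.exec O σ := by
  rw [exec_ite, if_pos h]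

theorem exec_ite_neg {b : BExpr} (p q : Prog) (h : ¬ b.holds σ) :
    (ite b p q).exec O σ = q.exec O σ := by
  rw [exec_ite, if_neg h]

end

/-- The memory evolves independently of the step count, so correctness is proved for `exec` and the
cost separately through `costBound`. -/
theorem run_fst (O : Network → Finset ℕ) (T : ℕ → ℕ → ℕ) (p : Prog) (σ : Mem) :
    (p.run O T σ).1 = p.exec O σ := by
  induction p generalizing σ with
  | skip => rfl
  | setNat => rfl
  | setReal => rfl
  | seq p q ihp ihq => simp only [run, exec, ihp, ihq]
  | ite b p q ihp ihq =>
    simp only [run, exec]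
    split_ifs <;> simp only [ihp, ihq]
  | loop x e p ih =>
    simp only [run, exec]
    induction e.eval σ with
    | zero => rfl
    | succ N ihN =>
      rw [List.range_succ, List.foldl_append]
      simp only [List.foldl_cons, List.foldl_nil]
      rw [ih, ihN]
  | minCut => rfl

/-- The program may write into the natural number array `y`. -/
def writesNat : Prog → ℕ → Bool
  | skip, _ => false
  | setNat x _ _ _, y => y == x
  | setReal _ _ _ _, _ => false
  | seq p q, y => p.writesNat y || q.writesNat y
  | ite _ p q, y => p.writesNat y || q.writesNat y
  | loop x _ p, y => y == x || p.writesNat y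
  | minCut _ _ _ _ _ _ _ out, y => y == out

/-- The program may write into the real array `y`. -/
def writesReal : Prog → ℕ → Bool
  | skip, _ => false
  | setNat _ _ _ _, _ => false
  | setReal x _ _ _, y => y == x
  | seq p q, y => p.writesReal y || q.writesReal y
  | ite _ p q, y => p.writesReal y || q.writesReal y
  | loop _ _ p, y => p.writesReal y
  | minCut _ _ _ _ _ _ _ _, _ => false

end Prog

@[simp] theorem Mem.setNat_nat (σ : Mem) (x i j v x' i' j' : ℕ) :
    (σ.setNat x i j v).nat x' i' j' = if x' = x ∧ i' = i ∧ j' = j then v else σ.nat x' i' j' := rfl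

@[simp] theorem Mem.setNat_real (σ : Mem) (x i j v : ℕ) : (σ.setNat x i j v).real = σ.real := rfl

@[simp] theorem Mem.setReal_nat (σ : Mem) (x i j : ℕ) (v : ℝ) : (σ.setReal x i j v).nat = σ.nat := rfl

@[simp] theorem Mem.setReal_real (σ : Mem) (x i j : ℕ) (v : ℝ) (x' i' j' : ℕ) :
    (σ.setReal x i j v).real x' i' j' = if x' = x ∧ i' = i ∧ j' = j then v else σ.real x' i' j' :=
  rfl

theorem Mem.setNat_nat_of_ne (σ : Mem) {x y : ℕ} (i j v : ℕ) (h : y ≠ x) :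
    (σ.setNat x i j v).nat y = σ.nat y := by
  funext i' j'
  simp [Mem.setNat_nat, h]

theorem Mem.setReal_real_of_ne (σ : Mem) {x y : ℕ} (i j : ℕ) (v : ℝ) (h : y ≠ x) :
    (σ.setReal x i j v).real y = σ.real y := by
  funext i' j'
  simp [Mem.setReal_real, h]

/-- `τ` differs from `σ` at most in the arrays written by `p`. -/
def Frame (p : Prog) (σ τ : Mem) : Prop :=
  (∀ y, p.writesNat y = false → τ.nat y = σ.nat y) ∧
    ∀ y, p.writesReal y = false → τ.real y = σ.real y

theorem Frame.refl (p : Prog) (σ : Mem) : Frame p σ σ := ⟨fun _ _ => rfl, fun _ _ => rfl⟩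

theorem Frame.trans {p : Prog} {σ τ ρ : Mem} (h : Frame p σ τ) (h' : Frame p τ ρ) : Frame p σ ρ :=
  ⟨fun y hy => (h'.1 y hy).trans (h.1 y hy), fun y hy => (h'.2 y hy).trans (h.2 y hy)⟩

namespace Prog

variable (O : Network → Finset ℕ)

theorem frame (p : Prog) (σ : Mem) : Frame p σ (p.exec O σ) := by
  induction p generalizing σ with
  | skip => exact Frame.refl _ _
  | setNat x i j e =>
    refine ⟨fun y hy => ?_, fun y _ => rfl⟩
    exact Mem.setNat_nat_of_ne _ _ _ _ (by simpa [writesNat] using hy)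
  | setReal x i j e =>
    refine ⟨fun y _ => rfl, fun y hy => ?_⟩
    exact Mem.setReal_real_of_ne _ _ _ _ (by simpa [writesReal] using hy)
  | seq p q ihp ihq =>
    refine ⟨fun y hy => ?_, fun y hy => ?_⟩
    · simp only [writesNat, Bool.or_eq_false_iff] at hy
      exact ((ihq _).1 y hy.2).trans ((ihp _).1 y hy.1)
    · simp only [writesReal, Bool.or_eq_false_iff] at hy
      exact ((ihq _).2 y hy.2).trans ((ihp _).2 y hy.1)
  | ite b p q ihp ihq =>
    refine ⟨fun y hy => ?_, fun y hy => ?_⟩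
    · simp only [writesNat, Bool.or_eq_false_iff] at hy
      simp only [exec]
      split_ifs
      · exact (ihp _).1 y hy.1
      · exact (ihq _).1 y hy.2
    · simp only [writesReal, Bool.or_eq_false_iff] at hy
      simp only [exec]
      split_ifs
      · exact (ihp _).2 y hy.1
      · exact (ihq _).2 y hy.2
  | loop x e p ih =>
    simp only [exec]
    induction e.eval σ with
    | zero => exact Frame.refl _ _
    | succ N ihN =>
      refine ⟨fun y hy => ?_, fun y hy => ?_⟩
      · have h := hy
        simp only [writesNat, Bool.or_eq_false_iff, beq_eq_false_iff_ne] at h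
        exact ((ih _).1 y h.2).trans ((Mem.setNat_nat_of_ne _ _ _ _ h.1).trans (ihN.1 y hy))
      · have h := hy
        simp only [writesReal] at h
        exact ((ih _).2 y h).trans (ihN.2 y hy)
  | minCut N M s t tl hd cp out =>
    refine ⟨fun y hy => ?_, fun y _ => rfl⟩
    funext i j
    simp only [writesNat, beq_eq_false_iff_ne] at hy
    simp [exec, hy]

/-- The rule for loops: an invariant, and the arrays that are not written. -/
theorem exec_loop {x : ℕ} {e : NExpr} {p : Prog} {σ : Mem} {N : ℕ} (hN : e.eval σ = N)
    (I : ℕ → Mem → Prop) (h0 : I 0 σ)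
    (hs : ∀ i τ, i < N → Frame (loop x e p) σ τ → I i τ →
      I (i + 1) (p.exec O (τ.setNat x 0 0 i))) :
    I N ((loop x e p).exec O σ) := by
  subst hN
  simp only [exec]
  have key : ∀ N, N ≤ e.eval σ →
      Frame (loop x e p) σ (Nat.rec σ (fun i τ => p.exec O (τ.setNat x 0 0 i)) N) ∧
      I N (Nat.rec σ (fun i τ => p.exec O (τ.setNat x 0 0 i)) N) := by
    intro N
    induction N with
    | zero => exact fun _ => ⟨Frame.refl _ _, h0⟩
    | succ N ih =>
      intro hN
      obtain ⟨h1, h2⟩ := ih (by omega)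
      refine ⟨h1.trans ⟨fun y hy => ?_, fun y hy => ?_⟩, hs N _ (by omega) h1 h2⟩
      · simp only [writesNat, Bool.or_eq_false_iff, beq_eq_false_iff_ne] at hy
        exact ((p.frame O _).1 y hy.2).trans (Mem.setNat_nat_of_ne _ _ _ _ hy.1)
      · simp only [writesReal] at hy
        exact (p.frame O _).2 y hy
  exact (key _ le_rfl).2

end Prog

/-! ### Bounds for the number of steps -/

/-- The expression reads only natural number arrays outside `W`. -/
def NExpr.avoids (W : ℕ → Bool) : NExpr → Bool
  | lit _ => true
  | get x i j => !W x && i.avoids W && j.avoids W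
  | add a b => a.avoids W && b.avoids W
  | sub a b => a.avoids W && b.avoids W

theorem NExpr.eval_congr {W : ℕ → Bool} {σ τ : Mem} (h : ∀ y, W y = false → τ.nat y = σ.nat y)
    (e : NExpr) (he : e.avoids W = true) : e.eval τ = e.eval σ := by
  induction e with
  | lit k => rfl
  | get x i j ihi ihj =>
    simp only [avoids, Bool.and_eq_true, Bool.not_eq_true'] at he
    simp only [eval, ihi he.1.2, ihj he.2, h x he.1.1]
  | add a b iha ihb =>
    simp only [avoids, Bool.and_eq_true] at he
    simp only [eval, iha he.1, ihb he.2]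
  | sub a b iha ihb =>
    simp only [avoids, Bool.and_eq_true] at he
    simp only [eval, iha he.1, ihb he.2]

namespace Prog

/-- The numbers of iterations and the sizes of the networks depend on arrays outside `W` only. -/
def stable (W : ℕ → Bool) : Prog → Bool
  | skip => true
  | setNat _ _ _ _ => true
  | setReal _ _ _ _ => true
  | seq p q => p.stable W && q.stable W
  | ite _ p q => p.stable W && q.stable W
  | loop _ e p => e.avoids W && p.stable W
  | minCut N M _ _ _ _ _ _ => N.avoids W && M.avoids W

/-- A bound for the number of steps of a stable program. -/
def costBound (T : ℕ → ℕ → ℕ) (σ : Mem) : Prog → ℕ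
  | skip => 1
  | setNat _ i j e => 1 + i.cost + j.cost + e.cost
  | setReal _ i j e => 1 + i.cost + j.cost + e.cost
  | seq p q => p.costBound T σ + q.costBound T σ
  | ite b p q => 1 + b.cost + (p.costBound T σ + q.costBound T σ)
  | loop _ e p => 1 + e.cost + e.eval σ * (1 + p.costBound T σ)
  | minCut N M s t _ _ _ _ => 1 + N.cost + M.cost + s.cost + t.cost + T (N.eval σ) (M.eval σ)

/-- All quantities that determine the cost are read from arrays the program never writes, so they
can be evaluated once in the initial memory, whatever the program has computed in between. -/
theorem run_snd_le (O : Network → Finset ℕ) (T : ℕ → ℕ → ℕ) {W : ℕ → Bool} (p : Prog)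
    (hp : p.stable W = true) (hW : ∀ y, W y = false → p.writesNat y = false) {σ τ : Mem}
    (h : ∀ y, W y = false → τ.nat y = σ.nat y) : (p.run O T τ).2 ≤ p.costBound T σ := by
  induction p generalizing τ with
  | skip => exact le_rfl
  | setNat => exact le_rfl
  | setReal => exact le_rfl
  | seq p q ihp ihq =>
    simp only [stable, Bool.and_eq_true] at hp
    simp only [writesNat, Bool.or_eq_false_iff] at hW
    simp only [run, costBound]
    refine add_le_add (ihp hp.1 (fun y hy => (hW y hy).1) h)
      (ihq hp.2 (fun y hy => (hW y hy).2) fun y hy => ?_)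
    rw [run_fst]
    exact ((p.frame O τ).1 y (hW y hy).1).trans (h y hy)
  | ite b p q ihp ihq =>
    simp only [stable, Bool.and_eq_true] at hp
    simp only [writesNat, Bool.or_eq_false_iff] at hW
    simp only [run, costBound]
    have h1 := ihp hp.1 (fun y hy => (hW y hy).1) h
    have h2 := ihq hp.2 (fun y hy => (hW y hy).2) h
    split_ifs <;> omega
  | loop x e p ih =>
    simp only [stable, Bool.and_eq_true] at hp
    simp only [writesNat, Bool.or_eq_false_iff, beq_eq_false_iff_ne] at hW
    simp only [run, costBound]
    rw [NExpr.eval_congr h e hp.1]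
    induction e.eval σ with
    | zero => simp
    | succ N ihN =>
      rw [List.range_succ, List.foldl_append]
      simp only [List.foldl_cons, List.foldl_nil]
      set ρ := List.foldl (fun (ρ : Mem × ℕ) i =>
        ((p.run O T (ρ.1.setNat x 0 0 i)).1, ρ.2 + 1 + (p.run O T (ρ.1.setNat x 0 0 i)).2))
        (τ, 1 + e.cost) (List.range N) with hρ
      have hfr : ∀ y, W y = false → ρ.1.nat y = σ.nat y := by
        intro y hy
        rw [hρ]
        clear ihN
        clear_value ρ
        clear hρ ρ
        induction N with
        | zero => exact h y hy
        | succ N ihN =>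
          rw [List.range_succ, List.foldl_append]
          simp only [List.foldl_cons, List.foldl_nil]
          rw [run_fst]
          exact ((p.frame O _).1 y (hW y hy).2).trans
            ((Mem.setNat_nat_of_ne _ _ _ _ (hW y hy).1).trans ihN)
      have hstep := ih hp.2 (fun y hy => (hW y hy).2) (τ := ρ.1.setNat x 0 0 N) fun y hy =>
        (Mem.setNat_nat_of_ne _ _ _ _ (hW y hy).1).trans (hfr y hy)
      calc _ ≤ (1 + e.cost + N * (1 + p.costBound T σ)) + 1 + p.costBound T σ := by omega
        _ = _ := by ring
  | minCut N M s t =>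
    simp only [stable, Bool.and_eq_true] at hp
    simp only [run, costBound]
    rw [NExpr.eval_congr h N hp.1, NExpr.eval_congr h M hp.2]

end Prog

end CoverArb

namespace CoverArb

/-! ### Double cuts as minimum cuts -/

section Network

variable {n m : ℕ} (D : MultiDigraph (Fin n) (Fin m)) (w : Fin m → ℝ≥0) (F : Finset (Fin n))

/-- The weight of an arc in the sub-digraph induced by `F`. -/
noncomputable def capIn (e : Fin m) : ℝ := if D.tail e ∈ F ∧ D.head e ∈ F then (w e : ℝ) else 0

/-- A capacity exceeding the weight of all arcs. -/
noncomputable def bigCap : ℝ := 1 + ∑ e, (w e : ℝ)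

/-- The lists describe the network on two copies of the nodes in which double cuts of `D[F]` are
cuts: the arcs of `D[F]`, the reverse arcs on the second copy, and an arc of large capacity from the
second copy of each node to the first one. -/
structure IsDoubleNet (tl hd : ℕ → ℕ) (cp : ℕ → ℝ) : Prop where
  tl₁ : ∀ e : Fin m, tl e = D.tail e
  hd₁ : ∀ e : Fin m, hd e = D.head e
  cp₁ : ∀ e : Fin m, cp e = capIn D w F e
  tl₂ : ∀ e : Fin m, tl (m + e) = n + D.head e
  hd₂ : ∀ e : Fin m, hd (m + e) = n + D.tail e
  cp₂ : ∀ e : Fin m, cp (m + e) = capIn D w F e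
  tl₃ : ∀ v : Fin n, tl (m + m + v) = n + v
  hd₃ : ∀ v : Fin n, hd (m + m + v) = v
  cp₃ : ∀ v : Fin n, cp (m + m + v) = bigCap w

/-- The part of the first copy of `F` on the sink side of a cut. -/
def sinkSide (X : Finset ℕ) : Finset (Fin n) := F.filter fun v => (v : ℕ) ∉ X

/-- The part of the second copy of `F` on the source side of a cut. -/
def sourceSide (X : Finset ℕ) : Finset (Fin n) := F.filter fun v => n + (v : ℕ) ∈ X

variable {D w F}

theorem cutIn_eq_real (Z : Finset (Fin n)) :
    (D.cutIn w F Z : ℝ) = ∑ e, if D.tail e ∈ F ∧ D.Enters e Z then (w e : ℝ) else 0 := by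
  rw [MultiDigraph.cutIn_eq_sum]
  push_cast
  refine Finset.sum_congr rfl fun e _ => ?_
  split_ifs <;> simp

variable {tl hd : ℕ → ℕ} {cp : ℕ → ℝ}

/-- In the first copy an arc leaves X when it enters the sink side; in the reversed second copy it
leaves X when the original arc enters the source side. The links count the nodes that lie in both
sets. -/
theorem IsDoubleNet.cut_eq (h : IsDoubleNet D w F tl hd cp) (s t : ℕ) (X : Finset ℕ) :
    (mkNet (n + n) (m + m + n) tl hd cp s t).cut X =
      D.cutIn w F (sinkSide F X) + D.cutIn w F (sourceSide F X) +
        ∑ v : Fin n, if n + (v : ℕ) ∈ X ∧ (v : ℕ) ∉ X then bigCap w else 0 := by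
  unfold Network.cut
  change (∑ e : Fin (m + m + n), if tl e ∈ X ∧ hd e ∉ X then cp e else 0) = _
  rw [Fin.sum_univ_add, Fin.sum_univ_add, cutIn_eq_real, cutIn_eq_real]
  simp only [Fin.val_castAdd, Fin.val_natAdd, h.tl₁, h.hd₁, h.cp₁, h.tl₂, h.hd₂, h.cp₂, h.tl₃,
    h.hd₃, h.cp₃]
  congr 1
  congr 1
  · refine Finset.sum_congr rfl fun e _ => ?_
    unfold capIn MultiDigraph.Enters sinkSide
    simp only [Finset.mem_filter]
    by_cases h1 : D.tail e ∈ F <;> by_cases h2 : D.head e ∈ F <;> simp [h1, h2]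
  · refine Finset.sum_congr rfl fun e _ => ?_
    unfold capIn MultiDigraph.Enters sourceSide
    simp only [Finset.mem_filter]
    by_cases h1 : D.tail e ∈ F <;> by_cases h2 : D.head e ∈ F <;> simp [h1, h2, and_comm]

theorem bigCap_pos : 0 < bigCap w := by
  unfold bigCap
  positivity

theorem double_cut_lt_bigCap {Z₁ Z₂ : Finset (Fin n)} (hd : Disjoint Z₁ Z₂) :
    (D.cutIn w F Z₁ : ℝ) + D.cutIn w F Z₂ < bigCap w := by
  have h := MultiDigraph.double_cut_le (w := w) (E := D) (F := F) (H := Finset.univ) hd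
    (fun e he => absurd (Finset.mem_univ e) he) (fun e he => absurd (Finset.mem_univ e) he)
  have h' : (D.cutIn w F Z₁ : ℝ) + D.cutIn w F Z₂ ≤ ∑ e, (w e : ℝ) := by
    have := NNReal.coe_le_coe.2 h
    push_cast [weight] at this
    exact this
  unfold bigCap
  linarith

theorem IsDoubleNet.wellFormed (h : IsDoubleNet D w F tl hd cp) {s t : ℕ} (hs : s < n + n)
    (ht : t < n + n) (hst : s ≠ t) : (mkNet (n + n) (m + m + n) tl hd cp s t).WellFormed := by
  have hcap : ∀ e, 0 ≤ capIn D w F e := fun e => by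
    unfold capIn
    split_ifs <;> simp
  have key : ∀ e : Fin (m + m + n), tl e < n + n ∧ hd e < n + n ∧ 0 ≤ cp e := by
    refine Fin.addCases (fun e => ?_) (fun v => ?_)
    · refine Fin.addCases (fun e => ?_) (fun e => ?_) e
      · simp only [Fin.val_castAdd, h.tl₁, h.hd₁, h.cp₁]
        exact ⟨by omega, by omega, hcap e⟩
      · simp only [Fin.val_castAdd, Fin.val_natAdd, h.tl₂, h.hd₂, h.cp₂]
        exact ⟨by omega, by omega, hcap e⟩
    · simp only [Fin.val_natAdd, h.tl₃, h.hd₃, h.cp₃]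
      exact ⟨by omega, by omega, bigCap_pos.le⟩
  exact ⟨key, hs, ht, hst⟩

/-- The cut that belongs to a pair of node sets. -/
def cutOf (Z₁ Z₂ : Finset (Fin n)) : Finset ℕ :=
  ((Finset.univ.filter fun v => v ∉ Z₁).image fun v : Fin n => (v : ℕ)) ∪
    Z₂.image fun v : Fin n => n + (v : ℕ)

theorem mem_cutOf_fst {Z₁ Z₂ : Finset (Fin n)} (v : Fin n) : (v : ℕ) ∈ cutOf Z₁ Z₂ ↔ v ∉ Z₁ := by
  simp only [cutOf, Finset.mem_union, Finset.mem_image, Finset.mem_filter, Finset.mem_univ,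
    true_and]
  constructor
  · rintro (⟨u, hu, huv⟩ | ⟨u, hu, huv⟩)
    · rwa [← Fin.ext huv]
    · omega
  · exact fun h => .inl ⟨v, h, rfl⟩

theorem mem_cutOf_snd {Z₁ Z₂ : Finset (Fin n)} (v : Fin n) : n + (v : ℕ) ∈ cutOf Z₁ Z₂ ↔ v ∈ Z₂ := by
  simp only [cutOf, Finset.mem_union, Finset.mem_image, Finset.mem_filter, Finset.mem_univ,
    true_and]
  constructor
  · rintro (⟨u, hu, huv⟩ | ⟨u, hu, huv⟩)
    · omega
    · rwa [← Fin.ext (Nat.add_left_cancel huv)]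
  · exact fun h => .inr ⟨v, h, rfl⟩

theorem IsDoubleNet.cut_cutOf (h : IsDoubleNet D w F tl hd cp) (s t : ℕ) {Z₁ Z₂ : Finset (Fin n)}
    (hd' : Disjoint Z₁ Z₂) (h₁ : Z₁ ⊆ F) (h₂ : Z₂ ⊆ F) :
    (mkNet (n + n) (m + m + n) tl hd cp s t).cut (cutOf Z₁ Z₂) =
      D.cutIn w F Z₁ + D.cutIn w F Z₂ := by
  rw [h.cut_eq]
  have e1 : sinkSide F (cutOf Z₁ Z₂) = Z₁ := by
    ext v
    simp only [sinkSide, Finset.mem_filter, mem_cutOf_fst, not_not]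
    exact ⟨fun h => h.2, fun h => ⟨h₁ h, h⟩⟩
  have e2 : sourceSide F (cutOf Z₁ Z₂) = Z₂ := by
    ext v
    simp only [sourceSide, Finset.mem_filter, mem_cutOf_snd]
    exact ⟨fun h => h.2, fun h => ⟨h₂ h, h⟩⟩
  rw [e1, e2, Finset.sum_eq_zero, add_zero]
  intro v _
  rw [if_neg]
  rw [mem_cutOf_fst, mem_cutOf_snd, not_not]
  exact fun h => Finset.disjoint_left.1 hd' h.2 h.1

/-- `X` is a cut without arcs of large capacity that is at most as large as the double cuts with
property `P`. -/
structure IsBestCut (D : MultiDigraph (Fin n) (Fin m)) (w : Fin m → ℝ≥0) (F : Finset (Fin n))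
    (P : Finset (Fin n) → Finset (Fin n) → Prop) (X : Finset ℕ) : Prop where
  disjoint : Disjoint (sinkSide F X) (sourceSide F X)
  le : ∀ Z₁ Z₂ : Finset (Fin n), Disjoint Z₁ Z₂ → Z₁ ⊆ F → Z₂ ⊆ F → P Z₁ Z₂ →
    D.cutIn w F (sinkSide F X) + D.cutIn w F (sourceSide F X) ≤
      D.cutIn w F Z₁ + D.cutIn w F Z₂

/-- The property P must imply separation of s and t, so that the pairs with P compete with the
minimum cut; one such pair is needed to keep that cut below the large capacity. -/
theorem IsDoubleNet.isBestCut (h : IsDoubleNet D w F tl hd cp) {O : Network → Finset ℕ}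
    (hO : IsMinCutOracle O) {s t : ℕ} (hs : s < n + n) (ht : t < n + n) (hst : s ≠ t)
    {P : Finset (Fin n) → Finset (Fin n) → Prop}
    (hP : ∀ Z₁ Z₂ : Finset (Fin n), P Z₁ Z₂ → s ∈ cutOf Z₁ Z₂ ∧ t ∉ cutOf Z₁ Z₂)
    (hPex : ∃ Z₁ Z₂ : Finset (Fin n), Disjoint Z₁ Z₂ ∧ Z₁ ⊆ F ∧ Z₂ ⊆ F ∧ P Z₁ Z₂) :
    s ∈ O (mkNet (n + n) (m + m + n) tl hd cp s t) ∧
      t ∉ O (mkNet (n + n) (m + m + n) tl hd cp s t) ∧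
      IsBestCut D w F P (O (mkNet (n + n) (m + m + n) tl hd cp s t)) := by
  obtain ⟨h1, h2, h3⟩ := hO _ (h.wellFormed hs ht hst)
  refine ⟨h1, h2, ?_⟩
  set X := O (mkNet (n + n) (m + m + n) tl hd cp s t)
  have hle : ∀ Z₁ Z₂ : Finset (Fin n), Disjoint Z₁ Z₂ → Z₁ ⊆ F → Z₂ ⊆ F → P Z₁ Z₂ →
      (mkNet (n + n) (m + m + n) tl hd cp s t).cut X ≤ D.cutIn w F Z₁ + D.cutIn w F Z₂ := by
    intro Z₁ Z₂ hd' h₁ h₂ hPZ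
    rw [← h.cut_cutOf s t hd' h₁ h₂]
    exact h3 _ (hP _ _ hPZ).1 (hP _ _ hPZ).2
  -- A single link in the cut would already outweigh any double cut.
  have hno : ∀ v : Fin n, ¬ (n + (v : ℕ) ∈ X ∧ (v : ℕ) ∉ X) := by
    intro v hv
    obtain ⟨Z₁, Z₂, hd', h₁, h₂, hPZ⟩ := hPex
    have h4 := hle Z₁ Z₂ hd' h₁ h₂ hPZ
    rw [h.cut_eq] at h4
    have h5 := Finset.single_le_sum (f := fun v : Fin n => if n + (v : ℕ) ∈ X ∧ (v : ℕ) ∉ X then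
      bigCap w else 0) (fun v _ => by
        split_ifs
        exacts [bigCap_pos.le, le_rfl]) (Finset.mem_univ v)
    simp only [if_pos hv] at h5
    have h6 := double_cut_lt_bigCap (D := D) (w := w) (F := F) hd'
    have h7 : (0 : ℝ) ≤ D.cutIn w F (sinkSide F X) := NNReal.coe_nonneg _
    have h8 : (0 : ℝ) ≤ D.cutIn w F (sourceSide F X) := NNReal.coe_nonneg _
    linarith
  refine ⟨?_, fun Z₁ Z₂ hd' h₁ h₂ hPZ => ?_⟩
  · rw [Finset.disjoint_left]
    intro v hv hv'
    simp only [sinkSide, sourceSide, Finset.mem_filter] at hv hv'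
    exact hno v ⟨hv'.2, hv.2⟩
  · have h4 := hle Z₁ Z₂ hd' h₁ h₂ hPZ
    rw [h.cut_eq, Finset.sum_eq_zero, add_zero] at h4
    · exact_mod_cast h4
    · intro v _
      rw [if_neg (hno v)]

/-- Double cuts separating `t` from `s`. -/
theorem IsDoubleNet.double_cut (h : IsDoubleNet D w F tl hd cp) {O : Network → Finset ℕ}
    (hO : IsMinCutOracle O) {s t : Fin n} (hst : s ≠ t) (hs : s ∈ F) (ht : t ∈ F) :
    let X := O (mkNet (n + n) (m + m + n) tl hd cp (n + t) s)
    s ∈ sinkSide F X ∧ t ∈ sourceSide F X ∧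
      IsBestCut D w F (fun Z₁ Z₂ => s ∈ Z₁ ∧ t ∈ Z₂) X := by
  obtain ⟨h1, h2, h3⟩ := h.isBestCut hO (s := n + t) (t := s) (by omega) (by omega) (by omega)
    (P := fun Z₁ Z₂ => s ∈ Z₁ ∧ t ∈ Z₂)
    (fun Z₁ Z₂ hZ => ⟨(mem_cutOf_snd t).2 hZ.2, fun h => (mem_cutOf_fst s).1 h hZ.1⟩)
    ⟨{s}, {t}, by simpa using hst, by simpa using hs, by simpa using ht, by simp⟩
  exact ⟨by simp [sinkSide, hs, h2], by simp [sourceSide, ht, h1], h3⟩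

/-- Sets containing `t` but not `s`. -/
theorem IsDoubleNet.single_cut (h : IsDoubleNet D w F tl hd cp) {O : Network → Finset ℕ}
    (hO : IsMinCutOracle O) {s t : Fin n} (hst : s ≠ t) (ht : t ∈ F) :
    let X := O (mkNet (n + n) (m + m + n) tl hd cp s t)
    s ∉ sinkSide F X ∧ t ∈ sinkSide F X ∧
      IsBestCut D w F (fun Z₁ Z₂ => s ∉ Z₁ ∧ t ∈ Z₁ ∧ Z₂ = ∅) X := by
  obtain ⟨h1, h2, h3⟩ := h.isBestCut hO (s := s) (t := t) (by omega) (by omega) (by omega)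
    (P := fun Z₁ Z₂ => s ∉ Z₁ ∧ t ∈ Z₁ ∧ Z₂ = ∅)
    (fun Z₁ Z₂ hZ => ⟨(mem_cutOf_fst s).2 hZ.1, fun h => (mem_cutOf_fst t).1 h hZ.2.1⟩)
    ⟨{t}, ∅, by simp, by simpa using ht, by simp, by simpa using hst, by simp, rfl⟩
  exact ⟨by simp [sinkSide, h1], by simp [sinkSide, ht, h2], h3⟩

end Network

end CoverArb

namespace CoverArb

/-! ### The program for tight arborescences -/

/-- Membership of a node in the currently selected set. -/
def inSel (v : NExpr) : BExpr := .nle (.lit 1) (.get 6 (.var 12) v)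

/-- The arc in the scalar `18` is inside the selected set, if `x` is the array of tails. -/
def arcInSel (x : ℕ) : BExpr := .and (inSel (.col x (.var 18))) (inSel (.col 4 (.var 18)))

/-- The two arcs of the network that belong to the arc in the scalar `18`. -/
def netArcBody (x : ℕ) : Prog :=
    .seq (.setNat 20 (.var 18) (.lit 0) (.col x (.var 18))) <|
    .seq (.setNat 21 (.var 18) (.lit 0) (.col 4 (.var 18))) <|
    .seq (.setNat 20 (.add (.var 1) (.var 18)) (.lit 0) (.add (.var 0) (.col 4 (.var 18)))) <|
    .seq (.setNat 21 (.add (.var 1) (.var 18)) (.lit 0) (.add (.var 0) (.col x (.var 18)))) <|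
    .ite (arcInSel x)
      (.seq (.setReal 13 (.var 18) (.lit 0) (.col 0 (.var 18)))
        (.setReal 13 (.add (.var 1) (.var 18)) (.lit 0) (.col 0 (.var 18))))
      (.seq (.setReal 13 (.var 18) (.lit 0) .zero)
        (.setReal 13 (.add (.var 1) (.var 18)) (.lit 0) .zero))

/-- The arcs of the network on two copies of the nodes. -/
def netArcs (x : ℕ) : Prog := .loop 18 (.var 1) (netArcBody x)

/-- The arcs of large capacity. -/
def netLinks : Prog :=
  .loop 23 (.var 0) <|
    .seq (.setNat 20 (.add (.add (.var 1) (.var 1)) (.var 23)) (.lit 0) (.add (.var 0) (.var 23))) <|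
    .seq (.setNat 21 (.add (.add (.var 1) (.var 1)) (.var 23)) (.lit 0) (.var 23)) <|
    .setReal 13 (.add (.add (.var 1) (.var 1)) (.var 23)) (.lit 0) (.var 10)

variable {n m k : ℕ}

/-- The part of the memory that is not changed: the sizes, the heads, the family of sets, the
weights and a large capacity. -/
structure Base (hd : Fin m → Fin n) (S : Fin k → Finset (Fin n)) (w : Fin m → ℝ≥0) (σ : Mem) :
    Prop where
  nodes : σ.nat 0 0 0 = n
  arcs : σ.nat 1 0 0 = m
  sets : σ.nat 2 0 0 = k
  head : ∀ e : Fin m, σ.nat 4 e 0 = hd e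
  inc : ∀ (i : Fin k) (v : Fin n), σ.nat 6 i v = if v ∈ S i then 1 else 0
  weights : ∀ e : Fin m, σ.real 0 e 0 = w e
  cap : σ.real 10 0 0 = bigCap w

/-- The tails of `D` are in the array `x`. -/
def HasTails (x : ℕ) (D : MultiDigraph (Fin n) (Fin m)) (σ : Mem) : Prop :=
  ∀ e : Fin m, σ.nat x e 0 = D.tail e

/-- The side conditions are Boolean functions of the program text, so `rfl` or `decide` settles them
at every use. -/
theorem Base.of_frame {hd : Fin m → Fin n} {S : Fin k → Finset (Fin n)} {w : Fin m → ℝ≥0}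
    {σ τ : Mem} {p : Prog} (h : Base hd S w σ) (hf : Frame p σ τ)
    (h1 : [0, 1, 2, 4, 6].all (fun y => !p.writesNat y) = true)
    (h2 : [0, 10].all (fun y => !p.writesReal y) = true) : Base hd S w τ := by
  simp only [List.all_cons, List.all_nil, Bool.and_true, Bool.and_eq_true, Bool.not_eq_true'] at h1 h2
  obtain ⟨a0, a1, a2, a4, a6⟩ := h1
  obtain ⟨b0, b10⟩ := h2
  constructor
  · rw [hf.1 0 a0, h.nodes]
  · rw [hf.1 1 a1, h.arcs]
  · rw [hf.1 2 a2, h.sets]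
  · rw [hf.1 4 a4]
    exact h.head
  · rw [hf.1 6 a6]
    exact h.inc
  · rw [hf.2 0 b0]
    exact h.weights
  · rw [hf.2 10 b10, h.cap]

theorem Base.one_le_inc {hd : Fin m → Fin n} {S : Fin k → Finset (Fin n)} {w : Fin m → ℝ≥0}
    {σ : Mem} (h : Base hd S w σ) (i : Fin k) (v : Fin n) : 1 ≤ σ.nat 6 i v ↔ v ∈ S i := by
  rw [h.inc]
  split_ifs with hv <;> simp [hv]

variable {hd : Fin m → Fin n} {S : Fin k → Finset (Fin n)} {w : Fin m → ℝ≥0} {O : Network → Finset ℕ}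
  {D : MultiDigraph (Fin n) (Fin m)} {σ : Mem} {i₀ : Fin k} {x : ℕ}

theorem inSel_holds (hb : Base hd S w σ) (hsel : σ.nat 12 0 0 = i₀) {v : NExpr} {u : Fin n}
    (hv : v.eval σ = u) : (inSel v).holds σ ↔ u ∈ S i₀ := by
  simp only [inSel, BExpr.holds, NExpr.eval, hsel, hv, hb.one_le_inc]

/-- Memory layout. Natural arrays: 3 the current tails, 17 the tails of `D_s`, 8 the sizes of sets,
12 the selected set, 13 the processed sets, 15 the anchor, 16 and 19 the nodes s and t, 20 and 21
the network, 22 the cut, 24 its arcs. Real arrays: 10 the large capacity, 11 the best candidate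
value for an anchor, 12 the value of the current candidate, 13 the network capacities, 14 the weight
of the last cut, 15 the weight of the best cover so far. Natural and real arrays of the same name
are unrelated. -/
theorem netArcs_spec (hx : x = 3 ∨ x = 17) (hb : Base D.head S w σ) (hsel : σ.nat 12 0 0 = i₀)
    (ht : HasTails x D σ) :
    let τ := (netArcs x).exec O σ
    (∀ e : Fin m, τ.nat 20 e 0 = D.tail e ∧ τ.nat 21 e 0 = D.head e ∧
        τ.real 13 e 0 = capIn D w (S i₀) e) ∧
      ∀ e : Fin m, τ.nat 20 (m + e) 0 = n + D.head e ∧ τ.nat 21 (m + e) 0 = n + D.tail e ∧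
        τ.real 13 (m + e) 0 = capIn D w (S i₀) e := by
  intro τ
  have := Prog.exec_loop (O := O) (x := 18) (e := .var 1) (N := m) (σ := σ) (p := netArcBody x) hb.arcs
    (fun i τ => ∀ e : Fin m, e < i → (τ.nat 20 e 0 = D.tail e ∧ τ.nat 21 e 0 = D.head e ∧
        τ.real 13 e 0 = capIn D w (S i₀) e) ∧ 
       τ.nat 20 (m + e) 0 = n + D.head e ∧ τ.nat 21 (m + e) 0 = n + D.tail e ∧
        τ.real 13 (m + e) 0 = capIn D w (S i₀) e) (by simp) (fun i τ hi hf hI => ?_)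
  · exact ⟨fun e => (this e e.2).1, fun e => (this e e.2).2⟩
  · have hb' : Base D.head S w τ := hb.of_frame hf
      (by rcases hx with rfl | rfl <;> decide) (by rcases hx with rfl | rfl <;> decide)
    have hsel' : τ.nat 12 0 0 = i₀ := by
      rw [hf.1 12 (by rcases hx with rfl | rfl <;> decide), hsel]
    have ht' : τ.nat x i 0 = D.tail ⟨i, hi⟩ := by
      rw [hf.1 x (by rcases hx with rfl | rfl <;> decide)]
      exact ht ⟨i, hi⟩
    have hh' := hb'.head ⟨i, hi⟩
    have hw' := hb'.weights ⟨i, hi⟩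
    have hc1 := hb'.one_le_inc i₀ (D.tail ⟨i, hi⟩)
    have hc2 := hb'.one_le_inc i₀ (D.head ⟨i, hi⟩)
    have hcap : capIn D w (S i₀) ⟨i, hi⟩ =
        if D.tail ⟨i, hi⟩ ∈ S i₀ ∧ D.head ⟨i, hi⟩ ∈ S i₀ then (w ⟨i, hi⟩ : ℝ) else 0 := rfl
    have hx1 : x ≠ 18 ∧ x ≠ 20 ∧ x ≠ 21 := by omega
    intro e he
    have hem := e.2
    have h1 : (e : ℕ) ≠ m + i := by omega
    have h2 : m + (e : ℕ) ≠ i := by omega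
    have h3 : i ≠ m + i := by omega
    simp only [netArcBody, Prog.exec_seq, Prog.exec_ite, arcInSel, inSel]
    simp only [BExpr.holds, NExpr.eval, Prog.exec_setNat, Prog.exec_setReal,
      RExpr.eval]
    simp [hx1, hb'.nodes, hb'.arcs, ht', hh', hw', hsel', hc1, hc2]
    by_cases hei : (e : ℕ) = i
    · obtain rfl : e = ⟨i, hi⟩ := Fin.ext hei
      have h4 : m ≠ 0 := by omega
      split_ifs with hc <;> simp [h4, hcap, hc]
    · have := hI e (by omega)
      split_ifs with hc <;> simp [h1, h2, hei, this]

end CoverArb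

namespace CoverArb

variable {n m k : ℕ} {S : Fin k → Finset (Fin n)} {w : Fin m → ℝ≥0}
  {O : Network → Finset ℕ} {D : MultiDigraph (Fin n) (Fin m)} {σ : Mem} {i₀ : Fin k} {x : ℕ}

theorem netLinks_spec (hb : Base D.head S w σ) :
    let τ := netLinks.exec O σ
    (∀ i, i < m + m → τ.nat 20 i = σ.nat 20 i ∧ τ.nat 21 i = σ.nat 21 i ∧
      τ.real 13 i = σ.real 13 i) ∧
    ∀ v : Fin n, τ.nat 20 (m + m + v) 0 = n + v ∧ τ.nat 21 (m + m + v) 0 = v ∧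
      τ.real 13 (m + m + v) 0 = bigCap w := by
  intro τ
  have := Prog.exec_loop (O := O) (x := 23) (e := .var 0) (N := n) (σ := σ)
    (p := .seq (.setNat 20 (.add (.add (.var 1) (.var 1)) (.var 23)) (.lit 0)
        (.add (.var 0) (.var 23))) <|
      .seq (.setNat 21 (.add (.add (.var 1) (.var 1)) (.var 23)) (.lit 0) (.var 23)) <|
      .setReal 13 (.add (.add (.var 1) (.var 1)) (.var 23)) (.lit 0) (.var 10)) hb.nodes
    (fun j τ => (∀ i, i < m + m → τ.nat 20 i = σ.nat 20 i ∧ τ.nat 21 i = σ.nat 21 i ∧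
        τ.real 13 i = σ.real 13 i) ∧
      ∀ v : Fin n, (v : ℕ) < j → τ.nat 20 (m + m + v) 0 = n + v ∧ τ.nat 21 (m + m + v) 0 = v ∧
        τ.real 13 (m + m + v) 0 = bigCap w) (by simp) (fun j τ hj hf hI => ?_)
  · exact ⟨this.1, fun v => this.2 v v.2⟩
  · have hb' : Base D.head S w τ := hb.of_frame hf (by decide) (by decide)
    refine ⟨fun i hi => ?_, fun v hv => ?_⟩
    · have := hI.1 i hi
      have h1 : i ≠ m + m + j := by omega
      refine ⟨?_, ?_, ?_⟩ <;> funext u <;> simp [hb'.arcs, this, h1]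
    · have := hI.2 v
      have h1 : ((v : ℕ) = j) ∨ (v : ℕ) ≠ j ∧ (v : ℕ) < j := by omega
      rcases h1 with h1 | ⟨h1, h2⟩
      · simp [hb'.arcs, hb'.nodes, hb'.cap, h1]
      · simp [hb'.arcs, h1, this h2]

/-- The network for the selected set and the digraph with tails `x`. -/
def netProg (x : ℕ) : Prog := .seq (netArcs x) netLinks

theorem netProg_spec (hx : x = 3 ∨ x = 17) (hb : Base D.head S w σ) (hsel : σ.nat 12 0 0 = i₀)
    (ht : HasTails x D σ) :
    let τ := (netProg x).exec O σ
    IsDoubleNet D w (S i₀) (fun e => τ.nat 20 e 0) (fun e => τ.nat 21 e 0)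
      (fun e => τ.real 13 e 0) := by
  intro τ
  obtain ⟨h1, h2⟩ := netArcs_spec (O := O) hx hb hsel ht
  have hb' : Base D.head S w ((netArcs x).exec O σ) :=
    hb.of_frame ((netArcs x).frame O σ) (by rcases hx with rfl | rfl <;> decide)
      (by rcases hx with rfl | rfl <;> decide)
  obtain ⟨h3, h4⟩ := netLinks_spec (O := O) hb'
  constructor
  · exact fun e => (congrFun (h3 e (by omega)).1 0).trans (h1 e).1
  · exact fun e => (congrFun (h3 e (by omega)).2.1 0).trans (h1 e).2.1
  · exact fun e => (congrFun (h3 e (by omega)).2.2 0).trans (h1 e).2.2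
  · exact fun e => (congrFun (h3 (m + e) (by omega)).1 0).trans (h2 e).1
  · exact fun e => (congrFun (h3 (m + e) (by omega)).2.1 0).trans (h2 e).2.1
  · exact fun e => (congrFun (h3 (m + e) (by omega)).2.2 0).trans (h2 e).2.2
  · exact fun v => (h4 v).1
  · exact fun v => (h4 v).2.1
  · exact fun v => (h4 v).2.2

/-- The arc in the scalar `18` enters one of the two sets given by the cut in the array `22`. -/
def arcInCut (x : ℕ) : BExpr :=
  .and (arcInSel x) <| .or
    (.and (.nle (.lit 1) (.col 22 (.col x (.var 18)))) (.nle (.col 22 (.col 4 (.var 18))) (.lit 0)))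
    (.and (.nle (.col 22 (.add (.var 0) (.col x (.var 18)))) (.lit 0))
      (.nle (.lit 1) (.col 22 (.add (.var 0) (.col 4 (.var 18))))))

/-- One arc of the double cut. -/
def markBody (x : ℕ) : Prog :=
  .ite (arcInCut x)
    (.seq (.setNat 24 (.var 18) (.lit 0) (.lit 1))
      (.setReal 14 (.lit 0) (.lit 0) (.add (.var 14) (.col 0 (.var 18)))))
    (.setNat 24 (.var 18) (.lit 0) (.lit 0))

/-- The arcs of the double cut and their weight. -/
def markProg (x : ℕ) : Prog :=
  .seq (.setReal 14 (.lit 0) (.lit 0) .zero) (.loop 18 (.var 1) (markBody x))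

/-- The arcs of a double cut. -/
def doubleCutArcs (D : MultiDigraph (Fin n) (Fin m)) (F Z₁ Z₂ : Finset (Fin n)) :
    Finset (Fin m) :=
  Finset.univ.filter fun e => D.tail e ∈ F ∧ (D.Enters e Z₁ ∨ D.Enters e Z₂)

theorem arcInCut_holds (hb : Base D.head S w σ) (hsel : σ.nat 12 0 0 = i₀) {e : Fin m}
    (ht : σ.nat x e 0 = D.tail e) (he : σ.nat 18 0 0 = e) {X : Finset ℕ}
    (hX : ∀ i, i < n + n → σ.nat 22 i 0 = if i ∈ X then 1 else 0) :
    (arcInCut x).holds σ ↔ e ∈ doubleCutArcs D (S i₀) (sinkSide (S i₀) X) (sourceSide (S i₀) X) := by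
  have hX1 : ∀ v : Fin n, σ.nat 22 v 0 = if (v : ℕ) ∈ X then 1 else 0 := fun v => hX v (by omega)
  have hX2 : ∀ v : Fin n, σ.nat 22 (n + v) 0 = if n + (v : ℕ) ∈ X then 1 else 0 :=
    fun v => hX (n + v) (by omega)
  have h1 : ∀ p : Prop, ∀ _ : Decidable p, (1 ≤ (if p then 1 else 0 : ℕ)) ↔ p := by
    intro p _
    split_ifs with h <;> simp [h]
  have h2 : ∀ p : Prop, ∀ _ : Decidable p, ((if p then 1 else 0 : ℕ) ≤ 0) ↔ ¬ p := by
    intro p _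
    split_ifs with h <;> simp [h]
  simp only [arcInCut, arcInSel, inSel, BExpr.holds, NExpr.eval, he, ht, hb.head,
    hsel, hb.nodes, hX1, hX2, hb.one_le_inc, h1, h2, doubleCutArcs, Finset.mem_filter,
    Finset.mem_univ, true_and, MultiDigraph.Enters, sinkSide, sourceSide]
  tauto

theorem weight_filter_succ (w : Fin m → ℝ≥0) (C : Finset (Fin m)) {i : ℕ} (hi : i < m) :
    weight w (C.filter fun e : Fin m => (e : ℕ) < i + 1) =
      weight w (C.filter fun e : Fin m => (e : ℕ) < i) +
        if (⟨i, hi⟩ : Fin m) ∈ C then w ⟨i, hi⟩ else 0 := by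
  unfold weight
  split_ifs with hc
  · rw [show (C.filter fun e : Fin m => (e : ℕ) < i + 1) =
      insert ⟨i, hi⟩ (C.filter fun e : Fin m => (e : ℕ) < i) by
        ext e
        simp only [Finset.mem_filter, Finset.mem_insert, Fin.ext_iff]
        constructor
        · intro h
          by_cases h' : (e : ℕ) = i
          · exact Or.inl h'
          · exact Or.inr ⟨h.1, by omega⟩
        · rintro (h | h)
          · exact ⟨by rwa [show e = ⟨i, hi⟩ from Fin.ext h], by omega⟩
          · exact ⟨h.1, by omega⟩, Finset.sum_insert (by simp), add_comm]
  · rw [add_zero]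
    congr 1
    ext e
    simp only [Finset.mem_filter, and_congr_right_iff]
    intro he
    have : (e : ℕ) ≠ i := fun h => hc (by rwa [show (⟨i, hi⟩ : Fin m) = e from Fin.ext h.symm])
    omega

theorem markProg_spec (hx : x = 3 ∨ x = 17) (hb : Base D.head S w σ) (hsel : σ.nat 12 0 0 = i₀)
    (ht : HasTails x D σ) {X : Finset ℕ}
    (hX : ∀ i, i < n + n → σ.nat 22 i 0 = if i ∈ X then 1 else 0) :
    let τ := (markProg x).exec O σ
    let C := doubleCutArcs D (S i₀) (sinkSide (S i₀) X) (sourceSide (S i₀) X)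
    τ.real 14 0 0 = weight w C ∧ ∀ e : Fin m, τ.nat 24 e 0 = if e ∈ C then 1 else 0 := by
  intro τ C
  have := Prog.exec_loop (O := O) (x := 18) (e := .var 1) (N := m)
    (σ := σ.setReal 14 0 0 0) (p := markBody x) hb.arcs
    (fun i τ => τ.real 14 0 0 = weight w (C.filter fun e : Fin m => (e : ℕ) < i) ∧
      ∀ e : Fin m, (e : ℕ) < i → τ.nat 24 e 0 = if e ∈ C then 1 else 0)
    (by simp [weight]) (fun i τ hi hf hI => ?_)
  · refine ⟨this.1.trans ?_, fun e => this.2 e e.2⟩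
    rw [Finset.filter_true_of_mem fun e _ => e.2]
  · have hb0 : Base D.head S w (σ.setReal 14 0 0 0) :=
      hb.of_frame (p := .setReal 14 (.lit 0) (.lit 0) .zero) (Prog.frame O _ σ)
        (by decide) (by decide)
    have hb1 : Base D.head S w τ := hb0.of_frame hf
      (by rcases hx with rfl | rfl <;> decide) (by rcases hx with rfl | rfl <;> decide)
    have hb' : Base D.head S w (τ.setNat 18 0 0 i) :=
      hb1.of_frame (p := .setNat 18 (.lit 0) (.lit 0) (.lit i)) (Prog.frame O _ τ) (by rfl) (by rfl)
    have hx18 : x ≠ 18 := by omega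
    have hiff := arcInCut_holds (σ := τ.setNat 18 0 0 i) (i₀ := i₀) (x := x) (e := ⟨i, hi⟩) (X := X) hb'
      (by
        simp only [Mem.setNat_nat]
        rw [hf.1 12 (by rcases hx with rfl | rfl <;> decide)]
        simpa using hsel)
      (by
        simp only [Mem.setNat_nat, hx18, false_and, if_false]
        rw [hf.1 x (by rcases hx with rfl | rfl <;> decide)]
        exact ht ⟨i, hi⟩)
      (by simp)
      (fun j hj => by
        simp only [Mem.setNat_nat]
        rw [hf.1 22 (by rcases hx with rfl | rfl <;> decide)]
        simpa using hX j hj)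
    have hw' := hb'.weights ⟨i, hi⟩
    have hsum := weight_filter_succ w C hi
    rw [markBody]
    by_cases hc : (⟨i, hi⟩ : Fin m) ∈ C
    · rw [Prog.exec_ite_pos _ _ _ _ (hiff.2 hc), hsum, if_pos hc]
      refine ⟨?_, fun e he => ?_⟩
      · simp [hI.1]
        simpa using hw'
      · by_cases hei : (e : ℕ) = i
        · obtain rfl : e = ⟨i, hi⟩ := Fin.ext hei
          simp [hc]
        · simp [hei, hI.2 e (by omega)]
    · rw [Prog.exec_ite_neg _ _ _ _ (fun h => hc (hiff.1 h)), hsum, if_neg hc]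
      refine ⟨?_, fun e he => ?_⟩
      · simp [hI.1]
      · by_cases hei : (e : ℕ) = i
        · obtain rfl : e = ⟨i, hi⟩ := Fin.ext hei
          simp [hc]
        · simp [hei, hI.2 e (by omega)]

/-- A double cut from a minimum cut. -/
def cutProg (x : ℕ) (src snk : NExpr) : Prog :=
  .seq (netProg x) <|
  .seq (.minCut (.add (.var 0) (.var 0)) (.add (.add (.var 1) (.var 1)) (.var 0)) src snk 20 21 13 22) <|
    markProg x

/-- Source and sink are evaluated after the network has been written, so their expressions must not
read the arrays used for that. -/
theorem cutProg_spec (hx : x = 3 ∨ x = 17) (hb : Base D.head S w σ) (hsel : σ.nat 12 0 0 = i₀)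
    (ht : HasTails x D σ) {src snk : NExpr} {s t : ℕ}
    (hs : src.avoids (fun y => y == 18 || y == 20 || y == 21 || y == 23) = true)
    (hs' : src.eval σ = s)
    (ht : snk.avoids (fun y => y == 18 || y == 20 || y == 21 || y == 23) = true)
    (ht' : snk.eval σ = t) :
    let τ := (cutProg x src snk).exec O σ
    ∃ tl hd cp, IsDoubleNet D w (S i₀) tl hd cp ∧
      let X := O (mkNet (n + n) (m + m + n) tl hd cp s t)
      let C := doubleCutArcs D (S i₀) (sinkSide (S i₀) X) (sourceSide (S i₀) X)
      τ.real 14 0 0 = weight w C ∧ ∀ e : Fin m, τ.nat 24 e 0 = if e ∈ C then 1 else 0 := by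
  intro τ
  set ρ := (netProg x).exec O σ with hρ
  have hf := (netProg x).frame O σ
  rw [← hρ] at hf
  have hnet := netProg_spec (O := O) hx hb hsel (by assumption)
  refine ⟨_, _, _, hnet, ?_⟩
  have hev : ∀ e : NExpr, e.avoids (fun y => y == 18 || y == 20 || y == 21 || y == 23) = true →
      e.eval ρ = e.eval σ := by
    intro e he
    refine NExpr.eval_congr (fun y hy => hf.1 y ?_) e he
    simp only [Bool.or_eq_false_iff, beq_eq_false_iff_ne] at hy
    simp [netProg, netArcs, netArcBody, netLinks, Prog.writesNat]
    omega
  have hb1 : Base D.head S w ρ := hb.of_frame hf rfl rfl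
  set mc : Prog := .minCut (.add (.var 0) (.var 0)) (.add (.add (.var 1) (.var 1)) (.var 0)) src snk
    20 21 13 22 with hmc
  have hf2 := mc.frame O ρ
  have hb2 : Base D.head S w (mc.exec O ρ) := hb1.of_frame hf2 rfl rfl
  refine markProg_spec (O := O) hx hb2 (i₀ := i₀) ?_ ?_ ?_
  · rw [hf2.1 12 rfl, hf.1 12 rfl, hsel]
  · intro e
    rw [hf2.1 x (by rcases hx with rfl | rfl <;> rfl),
      hf.1 x (by rcases hx with rfl | rfl <;> rfl)]
    apply_assumption
  · intro i hi
    rw [hmc]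
    simp [Prog.exec, hb1.nodes, hb1.arcs, hi, hev _ hs, hs', hev _ ht, ht']
    rfl

end CoverArb

namespace CoverArb

variable {n m k : ℕ} {S : Fin k → Finset (Fin n)} {w : Fin m → ℝ≥0}
  {O : Network → Finset ℕ} {D E : MultiDigraph (Fin n) (Fin m)} {σ : Mem} {i₀ : Fin k} {x : ℕ}
  {P : Finset (Fin m) → Prop}

/-! ### The best set found so far -/

/-- The scalar `15` is the weight of the set in the array `5`, which has property `P`, or larger than
the weight of all arcs. -/
structure IsBest (P : Finset (Fin m) → Prop) (w : Fin m → ℝ≥0) (σ : Mem) : Prop where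
  le : σ.real 15 0 0 ≤ bigCap w
  or : σ.real 15 0 0 = bigCap w ∨
    P (outputArcs m σ) ∧ σ.real 15 0 0 = weight w (outputArcs m σ)

theorem outputArcs_congr {σ τ : Mem} (h : τ.nat 5 = σ.nat 5) : outputArcs m τ = outputArcs m σ := by
  unfold outputArcs
  rw [h]

theorem IsBest.congr {σ τ : Mem} (h : IsBest P w σ) (h1 : τ.nat 5 = σ.nat 5)
    (h2 : τ.real 15 = σ.real 15) : IsBest P w τ := by
  constructor
  · rw [h2]
    exact h.le
  · rw [h2, outputArcs_congr h1]
    exact h.or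

theorem weight_lt_bigCap (w : Fin m → ℝ≥0) (H : Finset (Fin m)) : (weight w H : ℝ) < bigCap w := by
  have : (weight w H : ℝ) ≤ ∑ e, (w e : ℝ) := by
    exact_mod_cast Finset.sum_le_univ_sum_of_nonneg (fun _ => zero_le)
  unfold bigCap
  linarith

/-- Copy the marks of the double cut into the output. -/
def copyMarks : Prog := .loop 18 (.var 1) (.setNat 5 (.var 18) (.lit 0) (.col 24 (.var 18)))

theorem copyMarks_spec (hm : σ.nat 1 0 0 = m) (e : Fin m) :
    (copyMarks.exec O σ).nat 5 e 0 = σ.nat 24 e 0 := by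
  have := Prog.exec_loop (O := O) (x := 18) (e := .var 1) (N := m) (σ := σ)
    (p := .setNat 5 (.var 18) (.lit 0) (.col 24 (.var 18))) hm
    (fun i τ => ∀ e : Fin m, (e : ℕ) < i → τ.nat 5 e 0 = σ.nat 24 e 0) (by simp)
    (fun i τ hi hf hI e he => ?_)
  · exact this e e.2
  · have h24 := hf.1 24 rfl
    by_cases hei : (e : ℕ) = i
    · simp [hei, h24]
    · simp [hei, hI e (by omega)]

/-- Try the double cuts that separate the nodes in the scalars `16` and `19`. -/
def tryDouble (x : ℕ) : Prog :=
  .seq (cutProg x (.add (.var 0) (.var 19)) (.var 16)) <|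
  .ite (.rlt (.var 14) (.var 15))
    (.seq (.setReal 15 (.lit 0) (.lit 0) (.var 14)) copyMarks) .skip

/-- The property P of the recorded set is a parameter: it will be that of covering all tight
arborescences of the original digraph, whichever relocated digraph the cut comes from. -/
theorem tryDouble_spec (hO : IsMinCutOracle O) (hx : x = 3 ∨ x = 17) (hb : Base D.head S w σ)
    (hsel : σ.nat 12 0 0 = i₀) (ht : HasTails x D σ) {s t : Fin n} (hs' : σ.nat 16 0 0 = s)
    (ht' : σ.nat 19 0 0 = t) (hs : s ∈ S i₀) (htF : t ∈ S i₀) (hst : s ≠ t)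
    (hP : ∀ Z₁ Z₂ : Finset (Fin n), Z₁.Nonempty → Z₂.Nonempty → Disjoint Z₁ Z₂ → Z₁ ⊆ S i₀ →
      Z₂ ⊆ S i₀ → P (doubleCutArcs D (S i₀) Z₁ Z₂))
    (hbest : IsBest P w σ) :
    let τ := (tryDouble x).exec O σ
    IsBest P w τ ∧ τ.real 15 0 0 ≤ σ.real 15 0 0 ∧
      ∀ Z₁ Z₂ : Finset (Fin n), Disjoint Z₁ Z₂ → Z₁ ⊆ S i₀ → Z₂ ⊆ S i₀ → s ∈ Z₁ → t ∈ Z₂ →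
        τ.real 15 0 0 ≤ D.cutIn w (S i₀) Z₁ + D.cutIn w (S i₀) Z₂ := by
  intro τ
  obtain ⟨tl, hd, cp, hnet, hspec⟩ := cutProg_spec (O := O) hx hb hsel ht
    (src := .add (.var 0) (.var 19)) (snk := .var 16) rfl
    (show _ = n + (t : ℕ) by simp [hb.nodes, ht']) rfl hs'
  obtain ⟨hsX, htX, hX⟩ := hnet.double_cut hO hst hs htF
  have hf := (cutProg x (.add (.var 0) (.var 19)) (.var 16)).frame O σ
  set ρ := (cutProg x (.add (.var 0) (.var 19)) (.var 16)).exec O σ with hρ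
  set X := O (mkNet (n + n) (m + m + n) tl hd cp (n + t) s)
  set C := doubleCutArcs D (S i₀) (sinkSide (S i₀) X) (sourceSide (S i₀) X) with hC
  have hPC : P C := hP _ _ ⟨s, hsX⟩ ⟨t, htX⟩ hX.disjoint (Finset.filter_subset _ _)
    (Finset.filter_subset _ _)
  have hw : (weight w C : ℝ) = D.cutIn w (S i₀) (sinkSide (S i₀) X) +
      D.cutIn w (S i₀) (sourceSide (S i₀) X) := by
    rw [hC, doubleCutArcs, MultiDigraph.weight_double_cut D w (S i₀) hX.disjoint]
    simp
  have hle : ∀ Z₁ Z₂ : Finset (Fin n), Disjoint Z₁ Z₂ → Z₁ ⊆ S i₀ → Z₂ ⊆ S i₀ → s ∈ Z₁ → t ∈ Z₂ →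
      (weight w C : ℝ) ≤ D.cutIn w (S i₀) Z₁ + D.cutIn w (S i₀) Z₂ := by
    intro Z₁ Z₂ h1 h2 h3 h4 h5
    rw [hw]
    exact_mod_cast hX.le Z₁ Z₂ h1 h2 h3 ⟨h4, h5⟩
  have hbest' : IsBest P w ρ := hbest.congr (hf.1 5 rfl) (hf.2 15 rfl)
  have h15 : ρ.real 15 0 0 = σ.real 15 0 0 := by rw [hf.2 15 rfl]
  show IsBest P w ((Prog.ite _ _ _).exec O ρ) ∧ ((Prog.ite _ _ _).exec O ρ).real 15 0 0 ≤ _ ∧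
    ∀ Z₁ Z₂ : Finset (Fin n), _ → _ → _ → _ → _ → ((Prog.ite _ _ _).exec O ρ).real 15 0 0 ≤ _
  by_cases hlt : ρ.real 14 0 0 < ρ.real 15 0 0
  · rw [Prog.exec_ite_pos _ _ _ _ ((BExpr.holds_rlt (.var 14) (.var 15) ρ).2 hlt)]
    set ρ' := ρ.setReal 15 0 0 (ρ.real 14 0 0) with hρ'
    have hexec : (Prog.seq (.setReal 15 (.lit 0) (.lit 0) (.var 14)) copyMarks).exec O ρ =
      copyMarks.exec O ρ' := rfl
    rw [hexec]
    have hf' := copyMarks.frame O ρ'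
    have hout : outputArcs m (copyMarks.exec O ρ') = C := by
      ext e
      simp only [outputArcs, Finset.mem_filter, Finset.mem_univ, true_and]
      rw [copyMarks_spec (by
        show ρ.nat 1 0 0 = m
        rw [hf.1 1 rfl, hb.arcs])]
      show ρ.nat 24 e 0 = 1 ↔ _
      rw [hspec.2 e]
      simp [hC]
    have hval : (copyMarks.exec O ρ').real 15 0 0 = weight w C := by
      rw [hf'.2 15 rfl, hρ']
      simpa using hspec.1
    refine ⟨⟨?_, .inr ?_⟩, ?_, ?_⟩
    · rw [hval]
      exact (weight_lt_bigCap w C).le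
    · rw [hout, hval]
      exact ⟨hPC, rfl⟩
    · rw [hval, ← hspec.1, ← h15]
      exact hlt.le
    · rw [hval]
      exact hle
  · rw [Prog.exec_ite_neg _ _ _ _ (fun h => hlt ((BExpr.holds_rlt (.var 14) (.var 15) ρ).1 h)), Prog.exec_skip]
    refine ⟨hbest', h15.le, fun Z₁ Z₂ h1 h2 h3 h4 h5 => ?_⟩
    exact (not_lt.1 hlt).trans (hspec.1.le.trans (hle Z₁ Z₂ h1 h2 h3 h4 h5))

/-- The scalar `12` is not smaller than some cut avoiding `s`, unless it is large. -/
def Attained (D : MultiDigraph (Fin n) (Fin m)) (w : Fin m → ℝ≥0) (F : Finset (Fin n)) (s : Fin n)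
    (l : ℝ) : Prop :=
  l = bigCap w ∨ ∃ Z : Finset (Fin n), Z.Nonempty ∧ Z ⊆ F ∧ s ∉ Z ∧ (D.cutIn w F Z : ℝ) ≤ l

theorem Attained.nonneg {F : Finset (Fin n)} {s : Fin n} {l : ℝ} (h : Attained D w F s l) : 0 ≤ l := by
  rcases h with rfl | ⟨Z, -, -, -, h⟩
  · exact bigCap_pos.le
  · exact (NNReal.coe_nonneg _).trans h

/-- Try the sets that contain the node in the scalar `19`, but not the one in the scalar `16`. -/
def trySingle : Prog :=
  .seq (cutProg 3 (.var 16) (.var 19)) <|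
  .ite (.rlt (.var 14) (.var 12)) (.setReal 12 (.lit 0) (.lit 0) (.var 14)) .skip

/-- With source and sink both in the first copy, the second set of the cut is unconstrained and only
adds weight. So the value found is at least the in-degree of the first set and at most every
in-degree obtained with an empty second set. -/
theorem trySingle_spec (hO : IsMinCutOracle O) (hb : Base D.head S w σ)
    (hsel : σ.nat 12 0 0 = i₀) (ht : HasTails 3 D σ) {s t : Fin n} (hs' : σ.nat 16 0 0 = s)
    (ht' : σ.nat 19 0 0 = t) (htF : t ∈ S i₀) (hst : s ≠ t)
    (hatt : Attained D w (S i₀) s (σ.real 12 0 0)) :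
    let τ := trySingle.exec O σ
    Attained D w (S i₀) s (τ.real 12 0 0) ∧ τ.real 12 0 0 ≤ σ.real 12 0 0 ∧
      ∀ Z : Finset (Fin n), Z ⊆ S i₀ → s ∉ Z → t ∈ Z → τ.real 12 0 0 ≤ D.cutIn w (S i₀) Z := by
  intro τ
  obtain ⟨tl, hd, cp, hnet, hspec⟩ := cutProg_spec (O := O) (Or.inl rfl) hb hsel ht
    (src := .var 16) (snk := .var 19) rfl hs' rfl ht'
  obtain ⟨hsX, htX, hX⟩ := hnet.single_cut hO hst htF
  have hf := (cutProg 3 (.var 16) (.var 19)).frame O σ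
  set ρ := (cutProg 3 (.var 16) (.var 19)).exec O σ with hρ
  set X := O (mkNet (n + n) (m + m + n) tl hd cp s t)
  have hw : ρ.real 14 0 0 = D.cutIn w (S i₀) (sinkSide (S i₀) X) +
      D.cutIn w (S i₀) (sourceSide (S i₀) X) := by
    rw [hspec.1, doubleCutArcs, MultiDigraph.weight_double_cut D w (S i₀) hX.disjoint]
    simp
  have hle : ∀ Z : Finset (Fin n), Z ⊆ S i₀ → s ∉ Z → t ∈ Z →
      ρ.real 14 0 0 ≤ D.cutIn w (S i₀) Z := by
    intro Z h1 h2 h3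
    rw [hw]
    have := hX.le Z ∅ (by simp) h1 (by simp) ⟨h2, h3, rfl⟩
    rw [show D.cutIn w (S i₀) ∅ = 0 by simp [MultiDigraph.cutIn, MultiDigraph.Enters, weight],
      add_zero] at this
    exact_mod_cast this
  have h12 : ρ.real 12 0 0 = σ.real 12 0 0 := by rw [hf.2 12 rfl]
  show Attained D w (S i₀) s (((Prog.ite _ _ _).exec O ρ).real 12 0 0) ∧
    ((Prog.ite _ _ _).exec O ρ).real 12 0 0 ≤ _ ∧
    ∀ Z : Finset (Fin n), _ → _ → _ → ((Prog.ite _ _ _).exec O ρ).real 12 0 0 ≤ _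
  by_cases hlt : ρ.real 14 0 0 < ρ.real 12 0 0
  · rw [Prog.exec_ite_pos _ _ _ _ ((BExpr.holds_rlt (.var 14) (.var 12) ρ).2 hlt), Prog.exec_setReal]
    simp only [Mem.setReal_real, NExpr.eval, and_self, if_true, RExpr.eval]
    refine ⟨.inr ⟨_, ⟨t, htX⟩, Finset.filter_subset _ _, hsX, ?_⟩, h12 ▸ hlt.le, hle⟩
    rw [hw]
    exact le_add_of_nonneg_right (NNReal.coe_nonneg _)
  · rw [Prog.exec_ite_neg _ _ _ _ (fun h => hlt ((BExpr.holds_rlt (.var 14) (.var 12) ρ).1 h)), Prog.exec_skip]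
    refine ⟨h12.symm ▸ hatt, h12.le, fun Z h1 h2 h3 => ?_⟩
    exact (not_lt.1 hlt).trans (hle Z h1 h2 h3)

/-! ### The loop over pairs of nodes -/

/-- One pair of nodes. -/
def pairBody : Prog :=
  .ite (.and (inSel (.var 19)) (.neg (.eq (.var 16) (.var 19))))
    (.seq (tryDouble 3) (.seq (tryDouble 17) trySingle)) .skip

/-- The double cuts with `s` in the first set and `t` in the second one have weight at least `b`. -/
def PairOK (D : MultiDigraph (Fin n) (Fin m)) (w : Fin m → ℝ≥0) (F : Finset (Fin n)) (s t : Fin n)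
    (b : ℝ) : Prop :=
  ∀ Z₁ Z₂ : Finset (Fin n), Disjoint Z₁ Z₂ → Z₁ ⊆ F → Z₂ ⊆ F → s ∈ Z₁ → t ∈ Z₂ →
    b ≤ D.cutIn w F Z₁ + D.cutIn w F Z₂

/-- The sets containing `t` but not `s` have in-degree at least `b`. -/
def SingleOK (D : MultiDigraph (Fin n) (Fin m)) (w : Fin m → ℝ≥0) (F : Finset (Fin n)) (s t : Fin n)
    (b : ℝ) : Prop :=
  ∀ Z : Finset (Fin n), Z ⊆ F → s ∉ Z → t ∈ Z → b ≤ D.cutIn w F Z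

/-- For fixed s, the double cuts of the relocation to s are examined only with s in the first set.
No others are needed by `Anchored.cutAt`. -/
theorem pairs_spec (hO : IsMinCutOracle O) (hb : Base D.head S w σ) (hsel : σ.nat 12 0 0 = i₀)
    (hD : HasTails 3 D σ) (hE : HasTails 17 E σ) (hDE : E.head = D.head) {s : Fin n}
    (hs' : σ.nat 16 0 0 = s) (hs : s ∈ S i₀)
    (hPD : ∀ Z₁ Z₂ : Finset (Fin n), Z₁.Nonempty → Z₂.Nonempty → Disjoint Z₁ Z₂ → Z₁ ⊆ S i₀ →
      Z₂ ⊆ S i₀ → P (doubleCutArcs D (S i₀) Z₁ Z₂))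
    (hPE : ∀ Z₁ Z₂ : Finset (Fin n), Z₁.Nonempty → Z₂.Nonempty → Disjoint Z₁ Z₂ → Z₁ ⊆ S i₀ →
      Z₂ ⊆ S i₀ → P (doubleCutArcs E (S i₀) Z₁ Z₂))
    (hbest : IsBest P w σ) (hatt : Attained D w (S i₀) s (σ.real 12 0 0)) :
    let τ := (Prog.loop 19 (.var 0) pairBody).exec O σ
    IsBest P w τ ∧ τ.real 15 0 0 ≤ σ.real 15 0 0 ∧ Attained D w (S i₀) s (τ.real 12 0 0) ∧
      ∀ t ∈ S i₀, s ≠ t → PairOK D w (S i₀) s t (τ.real 15 0 0) ∧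
        PairOK E w (S i₀) s t (τ.real 15 0 0) ∧ SingleOK D w (S i₀) s t (τ.real 12 0 0) := by
  intro τ
  have := Prog.exec_loop (O := O) (x := 19) (e := .var 0) (N := n) (σ := σ) (p := pairBody) hb.nodes
    (fun j τ => IsBest P w τ ∧ τ.real 15 0 0 ≤ σ.real 15 0 0 ∧
      Attained D w (S i₀) s (τ.real 12 0 0) ∧
      ∀ t ∈ S i₀, (t : ℕ) < j → s ≠ t → PairOK D w (S i₀) s t (τ.real 15 0 0) ∧
        PairOK E w (S i₀) s t (τ.real 15 0 0) ∧ SingleOK D w (S i₀) s t (τ.real 12 0 0))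
    ⟨hbest, le_rfl, hatt, by simp⟩ (fun j τ hj hf hI => ?_)
  · exact ⟨this.1, this.2.1, this.2.2.1, fun t ht => this.2.2.2 t ht t.2⟩
  · obtain ⟨h1, h2, h3, h4⟩ := hI
    set t : Fin n := ⟨j, hj⟩ with htdef
    set τ₀ := τ.setNat 19 0 0 j with hτ₀
    have hnat : ∀ y, y ≠ 19 → (Prog.loop 19 (.var 0) pairBody).writesNat y = false →
        τ₀.nat y = σ.nat y := fun y hy hy' =>
      (Mem.setNat_nat_of_ne _ _ _ _ hy).trans (hf.1 y hy')
    have hb₀ : Base D.head S w τ₀ := by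
      refine (hb.of_frame hf rfl rfl).of_frame (p := .setNat 19 (.lit 0) (.lit 0) (.lit j))
        (Prog.frame O _ τ) rfl rfl
    have hsel₀ : τ₀.nat 12 0 0 = i₀ := by rw [hnat 12 (by decide) rfl, hsel]
    have hD₀ : HasTails 3 D τ₀ := fun e => by rw [hnat 3 (by decide) rfl, hD e]
    have hE₀ : HasTails 17 E τ₀ := fun e => by rw [hnat 17 (by decide) rfl, hE e]
    have hs₀ : τ₀.nat 16 0 0 = s := by rw [hnat 16 (by decide) rfl, hs']
    have ht₀ : τ₀.nat 19 0 0 = t := by simp [hτ₀, htdef]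
    have hbest₀ : IsBest P w τ₀ := h1.congr (Mem.setNat_nat_of_ne _ _ _ _ (by decide)) rfl
    have hiff : (BExpr.and (inSel (.var 19)) (.neg (.eq (.var 16) (.var 19)))).holds τ₀ ↔
        t ∈ S i₀ ∧ s ≠ t := by
      rw [BExpr.holds, inSel_holds (v := .var 19) hb₀ hsel₀ ht₀, BExpr.holds, BExpr.holds_eq]
      simp only [NExpr.eval, hs₀, ht₀, Fin.val_inj, ne_eq]
    rw [pairBody]
    by_cases hc : t ∈ S i₀ ∧ s ≠ t
    · rw [Prog.exec_ite_pos _ _ _ _ (hiff.2 hc), Prog.exec_seq, Prog.exec_seq]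
      obtain ⟨a1, a2, a3⟩ := tryDouble_spec hO (Or.inl rfl) hb₀ hsel₀ hD₀ hs₀ ht₀ hs hc.1 hc.2 hPD
        hbest₀
      have hfa := (tryDouble 3).frame O τ₀
      set τ₁ := (tryDouble 3).exec O τ₀
      have hb₁ : Base D.head S w τ₁ := hb₀.of_frame hfa rfl rfl
      obtain ⟨b1, b2, b3⟩ := tryDouble_spec (x := 17) (D := E) hO (Or.inr rfl) (hDE ▸ hb₁)
        (by rw [hfa.1 12 rfl, hsel₀]) (fun e => by rw [hfa.1 17 rfl, hE₀ e])
        (by rw [hfa.1 16 rfl, hs₀]) (by rw [hfa.1 19 rfl, ht₀]) hs hc.1 hc.2 hPE a1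
      have hfb := (tryDouble 17).frame O τ₁
      set τ₂ := (tryDouble 17).exec O τ₁
      have h12 : τ₂.real 12 = τ.real 12 := by rw [hfb.2 12 rfl, hfa.2 12 rfl, hτ₀, Mem.setNat_real]
      obtain ⟨c1, c2, c3⟩ := trySingle_spec hO (hb₁.of_frame hfb rfl rfl)
        (by rw [hfb.1 12 rfl, hfa.1 12 rfl, hsel₀])
        (fun e => by rw [hfb.1 3 rfl, hfa.1 3 rfl, hD₀ e])
        (by rw [hfb.1 16 rfl, hfa.1 16 rfl, hs₀]) (by rw [hfb.1 19 rfl, hfa.1 19 rfl, ht₀]) hc.1 hc.2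
        (h12 ▸ h3)
      have hfc := trySingle.frame O τ₂
      set τ₃ := trySingle.exec O τ₂
      have h15 : τ₃.real 15 = τ₂.real 15 := hfc.2 15 rfl
      rw [h12] at c2
      have hle1 : τ₃.real 15 0 0 ≤ τ₁.real 15 0 0 := h15 ▸ b2
      have hle : τ₃.real 15 0 0 ≤ τ.real 15 0 0 := hle1.trans a2
      refine ⟨b1.congr (hfc.1 5 rfl) h15, hle.trans h2, c1, fun t' ht' hlt hne => ?_⟩
      by_cases hte : t' = t
      · subst hte
        refine ⟨fun Z₁ Z₂ d1 d2 d3 d4 d5 => hle1.trans (a3 Z₁ Z₂ d1 d2 d3 d4 d5), ?_, c3⟩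
        rw [h15]
        exact b3
      · obtain ⟨e1, e2, e3⟩ := h4 t' ht' (by
          have : (t' : ℕ) ≠ j := fun h => hte (Fin.ext h)
          omega) hne
        exact ⟨fun Z₁ Z₂ d1 d2 d3 d4 d5 => hle.trans (e1 Z₁ Z₂ d1 d2 d3 d4 d5),
          fun Z₁ Z₂ d1 d2 d3 d4 d5 => hle.trans (e2 Z₁ Z₂ d1 d2 d3 d4 d5),
          fun Z d1 d2 d3 => c2.trans (e3 Z d1 d2 d3)⟩
    · rw [Prog.exec_ite_neg _ _ _ _ (fun h => hc (hiff.1 h)), Prog.exec_skip]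
      refine ⟨hbest₀, h2, h3, fun t' ht' hlt hne => h4 t' ht' ?_ hne⟩
      have : (t' : ℕ) ≠ j := fun h => hc ⟨by rwa [show t = t' from Fin.ext h.symm],
        by rwa [show t = t' from Fin.ext h.symm]⟩
      omega

end CoverArb

namespace CoverArb

variable {n m k : ℕ} {S : Fin k → Finset (Fin n)} {w : Fin m → ℝ≥0}
  {O : Network → Finset ℕ} {D E : MultiDigraph (Fin n) (Fin m)} {σ : Mem} {i₀ : Fin k} {x : ℕ}
  {P : Finset (Fin m) → Prop}

theorem Base.setNat {hd : Fin m → Fin n} (h : Base hd S w σ) {y : ℕ} (i j v : ℕ)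
    (hy : [0, 1, 2, 4, 6].all (fun z => !(z == y)) = true) : Base hd S w (σ.setNat y i j v) :=
  h.of_frame (p := .setNat y (.lit i) (.lit j) (.lit v)) (Prog.frame (fun _ => ∅) _ σ) hy rfl

theorem Base.setReal {hd : Fin m → Fin n} (h : Base hd S w σ) {y : ℕ} (i j : ℕ) (v : ℝ)
    (hy : [0, 10].all (fun z => !(z == y)) = true) : Base hd S w (σ.setReal y i j v) := by
  have h0 : y ≠ 0 ∧ y ≠ 10 := by
    simp at hy
    omega
  exact ⟨h.nodes, h.arcs, h.sets, h.head, h.inc,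
    fun e => by rw [Mem.setReal_real_of_ne _ _ _ _ h0.1.symm, h.weights],
    by rw [Mem.setReal_real_of_ne _ _ _ _ h0.2.symm, h.cap]⟩

/-! ### The digraph with all arcs leaving the sets around a node relocated -/

/-- Some set containing the node in the scalar `16` is left by the arc in the scalar `18`. -/
def leavesAround : BExpr :=
  .and (.nle (.lit 1) (.get 6 (.var 7) (.var 16))) <|
    .and (.nle (.lit 1) (.get 6 (.var 7) (.col 3 (.var 18))))
      (.nle (.get 6 (.var 7) (.col 4 (.var 18))) (.lit 0))

/-- The new tail of one arc. -/
def aroundBody : Prog :=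
  .seq (.setNat 17 (.var 18) (.lit 0) (.col 3 (.var 18))) <|
  .loop 7 (.var 2) <| .ite leavesAround (.setNat 17 (.var 18) (.lit 0) (.var 16)) .skip

/-- The tails after the relocation to the node in the scalar `16`. -/
def aroundProg : Prog := .loop 18 (.var 1) aroundBody

theorem Base.inc_le_zero {hd : Fin m → Fin n} (h : Base hd S w σ) (i : Fin k) (v : Fin n) :
    σ.nat 6 i v ≤ 0 ↔ v ∉ S i := by
  rw [h.inc]
  split_ifs with hv <;> simp [hv]

theorem aroundProg_spec (hb : Base D.head S w σ) (ht : HasTails 3 D σ) {s : Fin n}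
    (hs : σ.nat 16 0 0 = s) :
    HasTails 17 (D.relocateAll (Finset.univ.image S) s) (aroundProg.exec O σ) := by
  have := Prog.exec_loop (O := O) (x := 18) (e := .var 1) (N := m) (σ := σ) (p := aroundBody)
    hb.arcs (fun i τ => ∀ e : Fin m, (e : ℕ) < i →
      τ.nat 17 e 0 = (D.relocateAll (Finset.univ.image S) s).tail e) (by simp)
    (fun i τ hi hf hI => ?_)
  · exact fun e => this e e.2
  · set e₀ : Fin m := ⟨i, hi⟩ with he₀
    have hb₀ : Base D.head S w (τ.setNat 18 0 0 i) := (hb.of_frame hf rfl rfl).setNat _ _ _ rfl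
    have ht₀ : ∀ e : Fin m, (τ.setNat 18 0 0 i).nat 3 e 0 = D.tail e := by
      intro e
      rw [Mem.setNat_nat_of_ne _ _ _ _ (by decide), hf.1 3 rfl]
      exact ht e
    have hs₀ : (τ.setNat 18 0 0 i).nat 16 0 0 = s := by
      rw [Mem.setNat_nat_of_ne _ _ _ _ (by decide), hf.1 16 rfl, hs]
    rw [aroundBody, Prog.exec_seq, Prog.exec_setNat]
    set ρ := (τ.setNat 18 0 0 i).setNat 17 i 0 (D.tail e₀) with hρ
    have hρ' : (τ.setNat 18 0 0 i).setNat 17 (NExpr.eval (τ.setNat 18 0 0 i) (.var 18))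
        (NExpr.eval (τ.setNat 18 0 0 i) (.lit 0)) (NExpr.eval (τ.setNat 18 0 0 i) (.col 3 (.var 18)))
        = ρ := by
      rw [hρ]
      congr 1
      exact ht₀ e₀
    rw [hρ']
    have hbρ : Base D.head S w ρ := hb₀.setNat _ _ _ rfl
    have h16 : ρ.nat 16 0 0 = s := by
      rw [hρ, Mem.setNat_nat_of_ne _ _ _ _ (by decide), hs₀]
    have h18 : ρ.nat 18 0 0 = i := by simp [hρ]
    have h3 : ρ.nat 3 i 0 = D.tail e₀ := by
      rw [hρ, Mem.setNat_nat_of_ne _ _ _ _ (by decide)]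
      exact ht₀ e₀
    -- The tests read the original tail in array 3, not the one being rewritten, so several
    -- successful tests all write the same node s.
    have inner := Prog.exec_loop (O := O) (x := 7) (e := .var 2) (N := k) (σ := ρ)
      (p := .ite leavesAround (.setNat 17 (.var 18) (.lit 0) (.var 16)) .skip) hbρ.sets
      (fun j υ => (∀ e : Fin m, e ≠ e₀ → υ.nat 17 e 0 = ρ.nat 17 e 0) ∧
        υ.nat 17 i 0 = if ∃ l : Fin k, (l : ℕ) < j ∧ s ∈ S l ∧ D.Leaves e₀ (S l) then (s : ℕ)
          else D.tail e₀)
      (by simp [hρ]) (fun j υ hj hg hJ => ?_)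
    · intro e he
      by_cases hee : e = e₀
      · rw [hee]
        refine inner.2.trans ?_
        simp only [MultiDigraph.relocateAll]
        have : (∃ l : Fin k, (l : ℕ) < k ∧ s ∈ S l ∧ D.Leaves e₀ (S l)) ↔
            ∃ F ∈ Finset.univ.image S, s ∈ F ∧ D.Leaves e₀ F := by
          simp
        simp only [this]
        split_ifs <;> rfl
      · rw [inner.1 e hee]
        have hne : (e : ℕ) ≠ i := fun h => hee (Fin.ext h)
        simp [hρ, hne, hI e (by omega)]
    · set υ₀ := υ.setNat 7 0 0 j with hυ₀
      have hbυ : Base D.head S w υ₀ := (hbρ.of_frame hg rfl rfl).setNat _ _ _ rfl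
      have hiff : leavesAround.holds υ₀ ↔ s ∈ S ⟨j, hj⟩ ∧ D.Leaves e₀ (S ⟨j, hj⟩) := by
        have e1 : υ₀.nat 7 0 0 = (⟨j, hj⟩ : Fin k) := by simp [hυ₀]
        have e2 : υ₀.nat 16 0 0 = s := by
          rw [hυ₀, Mem.setNat_nat_of_ne _ _ _ _ (by decide), hg.1 16 rfl, h16]
        have e3 : υ₀.nat 18 0 0 = e₀ := by
          rw [hυ₀, Mem.setNat_nat_of_ne _ _ _ _ (by decide), hg.1 18 rfl, h18]
        have e4 : υ₀.nat 3 e₀ 0 = D.tail e₀ := by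
          rw [hυ₀, Mem.setNat_nat_of_ne _ _ _ _ (by decide), hg.1 3 rfl]
          exact h3
        generalize (⟨j, hj⟩ : Fin k) = l₀ at e1 ⊢
        simp only [leavesAround, BExpr.holds, NExpr.eval, e1, e2, e3, e4, hbυ.one_le_inc, hbυ.head,
          hbυ.inc_le_zero]
        rfl
      have h16' : υ₀.nat 16 0 0 = s := by
        rw [hυ₀, Mem.setNat_nat_of_ne _ _ _ _ (by decide), hg.1 16 rfl, h16]
      have h18' : υ₀.nat 18 0 0 = i := by
        rw [hυ₀, Mem.setNat_nat_of_ne _ _ _ _ (by decide), hg.1 18 rfl, h18]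
      by_cases hc : s ∈ S ⟨j, hj⟩ ∧ D.Leaves e₀ (S ⟨j, hj⟩)
      · rw [Prog.exec_ite_pos _ _ _ _ (hiff.2 hc), Prog.exec_setNat]
        simp only [NExpr.eval, h16', h18']
        refine ⟨fun e he => ?_, ?_⟩
        · have hne : (e : ℕ) ≠ i := fun h => he (Fin.ext h)
          simp [hne, hυ₀, hJ.1 e he]
        · rw [if_pos ⟨⟨j, hj⟩, by simp, hc⟩]
          simp
      · rw [Prog.exec_ite_neg _ _ _ _ (fun h => hc (hiff.1 h)), Prog.exec_skip]
        refine ⟨fun e he => ?_, ?_⟩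
        · simp [hυ₀, hJ.1 e he]
        · have : (∃ l : Fin k, (l : ℕ) < j + 1 ∧ s ∈ S l ∧ D.Leaves e₀ (S l)) ↔
              ∃ l : Fin k, (l : ℕ) < j ∧ s ∈ S l ∧ D.Leaves e₀ (S l) := by
            constructor
            · rintro ⟨l, hl, h⟩
              refine ⟨l, ?_, h⟩
              have : (l : ℕ) ≠ j := fun h' => hc (by
                rwa [show (⟨j, hj⟩ : Fin k) = l from Fin.ext h'.symm])
              omega
            · rintro ⟨l, hl, h⟩
              exact ⟨l, by omega, h⟩
          simp only [this]
          rw [← hJ.2]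
          simp [hυ₀]

/-! ### Anchors -/

/-- The candidate for an anchor in the scalar `16`. -/
def nodeBody : Prog :=
  .ite (inSel (.var 16))
    (.seq aroundProg <|
    .seq (.setReal 12 (.lit 0) (.lit 0) (.var 10)) <|
    .seq (.loop 19 (.var 0) pairBody) <|
    .ite (.rlt (.var 11) (.var 12))
      (.seq (.setReal 11 (.lit 0) (.lit 0) (.var 12)) (.setNat 15 (.lit 0) (.lit 0) (.var 16))) .skip)
    .skip

/-- Find an anchor of the selected set. -/
def anchorProg : Prog :=
  .seq (.setReal 11 (.lit 0) (.lit 0) (.sub .zero .one)) <| .loop 16 (.var 0) nodeBody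

/-- The cuts of a set `F` with anchor `a` have weight at least `M`. -/
structure GoodAnchor (w : Fin m → ℝ≥0) (L : Finset (Finset (Fin n))) (M : ℝ≥0)
    (D : MultiDigraph (Fin n) (Fin m)) (F : Finset (Fin n)) (a : Fin n) : Prop where
  cut : ∀ Z₁ Z₂ : Finset (Fin n), Z₁.Nonempty → Z₂.Nonempty → Disjoint Z₁ Z₂ → Z₁ ⊆ F →
    Z₂ ⊆ F → M ≤ D.cutIn w F Z₁ + D.cutIn w F Z₂
  cutAt : ∀ b, ∀ Z₁ Z₂ : Finset (Fin n), b ∈ Z₁ → Z₂.Nonempty → Disjoint Z₁ Z₂ → Z₁ ⊆ F →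
    Z₂ ⊆ F → M ≤ (D.relocateAll L b).cutIn w F Z₁ + (D.relocateAll L b).cutIn w F Z₂
  anchor : ∀ Z : Finset (Fin n), Z.Nonempty → Z ⊆ F → a ∉ Z → M ≤ 2 * D.cutIn w F Z

/-- The chosen node maximizes the minimum in-degree of the sets avoiding it. As some node is an
anchor, the maximizer is one. The claim is made for every M up to the best weight recorded; this
weight only decreases, so the claim survives later updates. -/
theorem anchorProg_spec (hO : IsMinCutOracle O) (hb : Base D.head S w σ) (hsel : σ.nat 12 0 0 = i₀)
    (hD : HasTails 3 D σ) (hF : (S i₀).Nonempty)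
    (hP : ∀ E : MultiDigraph (Fin n) (Fin m), E = D ∨
      (∃ a, E = D.relocateAll (Finset.univ.image S) a) →
      ∀ Z₁ Z₂ : Finset (Fin n), Z₁.Nonempty → Z₂.Nonempty → Disjoint Z₁ Z₂ → Z₁ ⊆ S i₀ →
      Z₂ ⊆ S i₀ → P (doubleCutArcs E (S i₀) Z₁ Z₂))
    (hbest : IsBest P w σ) :
    let τ := anchorProg.exec O σ
    IsBest P w τ ∧ τ.real 15 0 0 ≤ σ.real 15 0 0 ∧ ∃ a ∈ S i₀, τ.nat 15 0 0 = a ∧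
      ∀ M : ℝ≥0, (M : ℝ) ≤ τ.real 15 0 0 → GoodAnchor w (Finset.univ.image S) M D (S i₀) a := by
  intro τ
  set L := Finset.univ.image S with hL
  set σ' := σ.setReal 11 0 0 (0 - 1) with hσ'
  have hb' : Base D.head S w σ' := hb.setReal _ _ _ rfl
  have := Prog.exec_loop (O := O) (x := 16) (e := .var 0) (N := n) (σ := σ') (p := nodeBody)
    hb'.nodes
    (fun j τ => IsBest P w τ ∧ τ.real 15 0 0 ≤ σ.real 15 0 0 ∧
      (∀ s ∈ S i₀, (s : ℕ) < j → ∀ t ∈ S i₀, s ≠ t → PairOK D w (S i₀) s t (τ.real 15 0 0) ∧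
        PairOK (D.relocateAll L s) w (S i₀) s t (τ.real 15 0 0)) ∧
      (∀ s ∈ S i₀, (s : ℕ) < j → ∃ l ≤ τ.real 11 0 0, Attained D w (S i₀) s l) ∧
      (τ.real 11 0 0 = 0 - 1 ∨ ∃ a ∈ S i₀, τ.nat 15 0 0 = a ∧
        ∀ t ∈ S i₀, a ≠ t → SingleOK D w (S i₀) a t (τ.real 11 0 0)))
    ⟨hbest.congr rfl (Mem.setReal_real_of_ne _ _ _ _ (by decide)),
      by rw [hσ', Mem.setReal_real_of_ne _ _ _ _ (by decide)], by simp, by simp, by simp [hσ']⟩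
    (fun j τ hj hf hI => ?_)
  · obtain ⟨h1, h2, h3, h4, h5⟩ := this
    refine ⟨h1, h2, ?_⟩
    change _ at h1
    have h4' : ∀ s ∈ S i₀, ∃ l ≤ τ.real 11 0 0, Attained D w (S i₀) s l := fun s hs => h4 s hs s.2
    obtain ⟨s₀, hs₀⟩ := hF
    obtain ⟨l₀, hl₀, hatt₀⟩ := h4' s₀ hs₀
    -- The initial value -1 cannot persist, because the value of any node of the selected set is
    -- non-negative.
    rcases h5 with h5 | ⟨a, ha, ha', hsing⟩
    · exfalso
      have := hatt₀.nonneg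
      change τ.real 11 0 0 = 0 - 1 at h5
      linarith
    · refine ⟨a, ha, ha', fun M hM => ?_⟩
      have hcut : ∀ Z₁ Z₂ : Finset (Fin n), Z₁.Nonempty → Z₂.Nonempty → Disjoint Z₁ Z₂ →
          Z₁ ⊆ S i₀ → Z₂ ⊆ S i₀ → M ≤ D.cutIn w (S i₀) Z₁ + D.cutIn w (S i₀) Z₂ := by
        rintro Z₁ Z₂ ⟨s, hs⟩ ⟨t, ht⟩ hd' e1 e2
        have := (h3 s (e1 hs) s.2 t (e2 ht) (fun h => Finset.disjoint_left.1 hd' hs (h ▸ ht))).1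
          Z₁ Z₂ hd' e1 e2 hs ht
        exact_mod_cast hM.trans this
      refine ⟨hcut, ?_, ?_⟩
      · rintro b Z₁ Z₂ hs ⟨t, ht⟩ hd' e1 e2
        have := (h3 b (e1 hs) b.2 t (e2 ht) (fun h => Finset.disjoint_left.1 hd' hs (h ▸ ht))).2
          Z₁ Z₂ hd' e1 e2 hs ht
        exact_mod_cast hM.trans this
      · rintro Z ⟨t, ht⟩ hZ haZ
        obtain ⟨s, hs, hanc⟩ := D.exists_anchor w ⟨s₀, hs₀⟩ hcut
        obtain ⟨l, hl, hatt⟩ := h4' s hs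
        have hZ' := hsing t (hZ ht) (fun h => haZ (h ▸ ht)) Z hZ haZ ht
        have hMl : (M : ℝ) ≤ 2 * l := by
          -- The large value occurs when no set avoiding s was examined; M is below it because the
          -- recorded weight never exceeds it.
          rcases hatt with rfl | ⟨Y, hY, hYF, hsY, hYl⟩
          · have := hM.trans h1.le
            have := bigCap_pos (w := w)
            linarith
          · have : (M : ℝ) ≤ 2 * D.cutIn w (S i₀) Y := by exact_mod_cast hanc Y hY hYF hsY
            linarith
        have : (M : ℝ) ≤ 2 * D.cutIn w (S i₀) Z := by
          have := hl.trans hZ'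
          linarith
        exact_mod_cast this
  · obtain ⟨h1, h2, h3, h4, h5⟩ := hI
    set s : Fin n := ⟨j, hj⟩ with hsdef
    set τ₀ := τ.setNat 16 0 0 j with hτ₀
    have hnat : ∀ y, y ≠ 16 → (Prog.loop 16 (.var 0) nodeBody).writesNat y = false →
        τ₀.nat y = σ.nat y := fun y hy hy' =>
      (Mem.setNat_nat_of_ne _ _ _ _ hy).trans (hf.1 y hy')
    have hb₀ : Base D.head S w τ₀ := (hb'.of_frame hf rfl rfl).setNat _ _ _ rfl
    have hsel₀ : τ₀.nat 12 0 0 = i₀ := by rw [hnat 12 (by decide) rfl, hsel]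
    have hD₀ : HasTails 3 D τ₀ := fun e => by rw [hnat 3 (by decide) rfl, hD e]
    have hs₀ : τ₀.nat 16 0 0 = s := by simp [hτ₀, hsdef]
    have hbest₀ : IsBest P w τ₀ := h1.congr (Mem.setNat_nat_of_ne _ _ _ _ (by decide)) rfl
    have h15₀ : τ₀.nat 15 = τ.nat 15 := Mem.setNat_nat_of_ne _ _ _ _ (by decide)
    have hiff := inSel_holds (v := .var 16) hb₀ hsel₀ hs₀
    rw [nodeBody]
    by_cases hc : s ∈ S i₀
    · rw [Prog.exec_ite_pos _ _ _ _ (hiff.2 hc)]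
      simp only [Prog.exec_seq, Prog.exec_setReal]
      have hE := aroundProg_spec (O := O) hb₀ hD₀ hs₀
      have hfa := aroundProg.frame O τ₀
      set τ₁ := aroundProg.exec O τ₀
      have hb₁ : Base D.head S w τ₁ := hb₀.of_frame hfa rfl rfl
      have hset : τ₁.setReal 12 (NExpr.eval τ₁ (.lit 0)) (NExpr.eval τ₁ (.lit 0))
        (RExpr.eval τ₁ (.var 10)) = τ₁.setReal 12 0 0 (bigCap w) := by
          congr 1
          exact hb₁.cap
      rw [hset]
      set τ₂ := τ₁.setReal 12 0 0 (bigCap w) with hτ₂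
      have hr₂ : ∀ y, y ≠ 12 → aroundProg.writesReal y = false → τ₂.real y = τ.real y :=
        fun y hy hy' => (Mem.setReal_real_of_ne _ _ _ _ hy).trans (hfa.2 y hy')
      have hn₂ : ∀ y, aroundProg.writesNat y = false → τ₂.nat y = τ₀.nat y :=
        fun y hy' => hfa.1 y hy'
      have hP' : ∀ E : MultiDigraph (Fin n) (Fin m), _ := hP
      obtain ⟨a1, a2, a3, a4⟩ := pairs_spec (σ := τ₂) (D := D) (E := D.relocateAll L s) (s := s)
        (i₀ := i₀) (P := P) (S := S) (w := w) hO
        (hb₁.setReal _ _ _ rfl) (by rw [hn₂ 12 rfl, hsel₀])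
        (fun e => by rw [hn₂ 3 rfl, hD₀ e]) (fun e => hE e) rfl (by rw [hn₂ 16 rfl, hs₀]) hc
        (hP D (.inl rfl)) (hP _ (.inr ⟨s, rfl⟩))
        (hbest₀.congr (hn₂ 5 rfl) (hr₂ 15 (by decide) rfl)) (.inl (by simp [hτ₂]))
      have hfp := (Prog.loop 19 (.var 0) pairBody).frame O τ₂
      set τ₃ := (Prog.loop 19 (.var 0) pairBody).exec O τ₂
      rw [hr₂ 15 (by decide) rfl] at a2
      have h11 : τ₃.real 11 = τ.real 11 := by rw [hfp.2 11 rfl, hr₂ 11 (by decide) rfl]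
      have h15 : τ₃.nat 15 = τ.nat 15 := by rw [hfp.1 15 rfl, hn₂ 15 rfl, h15₀]
      have h16 : τ₃.nat 16 0 0 = s := by rw [hfp.1 16 rfl, hn₂ 16 rfl, hs₀]
      have pairs : ∀ s' ∈ S i₀, (s' : ℕ) < j + 1 → ∀ t ∈ S i₀, s' ≠ t →
          PairOK D w (S i₀) s' t (τ₃.real 15 0 0) ∧
          PairOK (D.relocateAll L s') w (S i₀) s' t (τ₃.real 15 0 0) := by
        intro s' hs' hlt t ht hne
        by_cases hss : s' = s
        · subst hss
          exact ⟨(a4 t ht hne).1, (a4 t ht hne).2.1⟩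
        · obtain ⟨e1, e2⟩ := h3 s' hs' (by
            have : (s' : ℕ) ≠ j := fun h => hss (Fin.ext h)
            omega) t ht hne
          exact ⟨fun Z₁ Z₂ d1 d2 d3 d4 d5 => a2.trans (e1 Z₁ Z₂ d1 d2 d3 d4 d5),
            fun Z₁ Z₂ d1 d2 d3 d4 d5 => a2.trans (e2 Z₁ Z₂ d1 d2 d3 d4 d5)⟩
      have old : ∀ s' ∈ S i₀, (s' : ℕ) < j + 1 → s' = s ∨ (s' : ℕ) < j := by
        intro s' _ hlt
        by_cases hss : s' = s
        · exact .inl hss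
        · have : (s' : ℕ) ≠ j := fun h => hss (Fin.ext h)
          exact .inr (by omega)
      by_cases hlt : τ₃.real 11 0 0 < τ₃.real 12 0 0
      · rw [Prog.exec_ite_pos _ _ _ _ ((BExpr.holds_rlt (.var 11) (.var 12) τ₃).2 hlt)]
        simp only [Prog.exec_seq, Prog.exec_setReal, Prog.exec_setNat]
        set τ₄ := (τ₃.setReal 11 0 0 (τ₃.real 12 0 0)).setNat 15 0 0 (τ₃.nat 16 0 0) with hτ₄
        have r15 : τ₄.real 15 = τ₃.real 15 := by
          rw [hτ₄, Mem.setNat_real]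
          exact Mem.setReal_real_of_ne _ _ _ _ (by decide)
        have r11 : τ₄.real 11 0 0 = τ₃.real 12 0 0 := by simp [hτ₄]
        have n15 : τ₄.nat 15 0 0 = s := by simp [hτ₄, h16]
        change IsBest P w τ₄ ∧ τ₄.real 15 0 0 ≤ _ ∧ _
        refine ⟨a1.congr (Mem.setNat_nat_of_ne _ _ _ _ (by decide)) r15, r15 ▸ a2.trans h2,
          fun s' => r15 ▸ pairs s', fun s' hs' hlt' => ?_, .inr ⟨s, hc, n15, fun t ht hne => ?_⟩⟩
        · change ∃ l ≤ τ₄.real 11 0 0, _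
          rw [r11]
          rcases old s' hs' hlt' with rfl | h
          · exact ⟨_, le_rfl, a3⟩
          · obtain ⟨l, hl, hl'⟩ := h4 s' hs' h
            exact ⟨l, hl.trans (h11 ▸ hlt.le), hl'⟩
        · change SingleOK D w (S i₀) s t (τ₄.real 11 0 0)
          rw [r11]
          exact (a4 t ht hne).2.2
      · rw [Prog.exec_ite_neg _ _ _ _ (fun h => hlt ((BExpr.holds_rlt (.var 11) (.var 12) τ₃).1 h)),
          Prog.exec_skip]
        refine ⟨a1, a2.trans h2, pairs, fun s' hs' hlt' => ?_, ?_⟩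
        · rcases old s' hs' hlt' with rfl | h
          · exact ⟨_, not_lt.1 hlt, a3⟩
          · rw [h11]
            exact h4 s' hs' h
        · rw [h11, h15]
          exact h5
    · rw [Prog.exec_ite_neg _ _ _ _ (fun h => hc (hiff.1 h)), Prog.exec_skip]
      have old : ∀ s' ∈ S i₀, (s' : ℕ) < j + 1 → (s' : ℕ) < j := by
        intro s' hs' hlt
        have : (s' : ℕ) ≠ j := fun h => hc (by rwa [show s = s' from Fin.ext h.symm])
        omega
      refine ⟨hbest₀, h2, fun s' hs' h => h3 s' hs' (old s' hs' h),
        fun s' hs' h => h4 s' hs' (old s' hs' h), ?_⟩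
      rw [h15₀]
      exact h5

end CoverArb

namespace CoverArb

variable {n m k N : ℕ} {S : Fin k → Finset (Fin n)} {w : Fin m → ℝ≥0}
  {O : Network → Finset ℕ} {D E : MultiDigraph (Fin n) (Fin m)} {σ : Mem} {i₀ : Fin k} {x num : ℕ}
  {P : Finset (Fin m) → Prop}

/-! ### Relocation of the tails -/

/-- Relocate the tails of the arcs leaving the selected set. -/
def moveProg : Prog :=
  .loop 18 (.var 1) <|
    .ite (.and (inSel (.col 3 (.var 18))) (.neg (inSel (.col 4 (.var 18)))))
      (.setNat 3 (.var 18) (.lit 0) (.var 15)) .skip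

/-- The tails are overwritten in place. Each arc is tested against its own old tail only, so the
invariant splits the arcs into those already treated and the others. -/
theorem moveProg_spec (hb : Base D.head S w σ) (hsel : σ.nat 12 0 0 = i₀) (ht : HasTails 3 D σ)
    {a : Fin n} (ha : σ.nat 15 0 0 = a) :
    HasTails 3 (D.relocate (S i₀) a) (moveProg.exec O σ) := by
  have := Prog.exec_loop (O := O) (x := 18) (e := .var 1) (N := m) (σ := σ)
    (p := .ite (.and (inSel (.col 3 (.var 18))) (.neg (inSel (.col 4 (.var 18)))))
      (.setNat 3 (.var 18) (.lit 0) (.var 15)) .skip) hb.arcs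
    (fun i τ => ∀ e : Fin m, τ.nat 3 e 0 =
      if (e : ℕ) < i then ((D.relocate (S i₀) a).tail e : ℕ) else D.tail e)
    (by simpa using fun e => ht e) (fun i τ hi hf hI => ?_)
  · intro e
    exact (this e).trans (if_pos e.2)
  · set e₀ : Fin m := ⟨i, hi⟩ with he₀
    set τ₀ := τ.setNat 18 0 0 i with hτ₀
    have hb₀ : Base D.head S w τ₀ := (hb.of_frame hf rfl rfl).setNat _ _ _ rfl
    have hsel₀ : τ₀.nat 12 0 0 = i₀ := by
      rw [hτ₀, Mem.setNat_nat_of_ne _ _ _ _ (by decide), hf.1 12 rfl, hsel]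
    have ha₀ : τ₀.nat 15 0 0 = a := by
      rw [hτ₀, Mem.setNat_nat_of_ne _ _ _ _ (by decide), hf.1 15 rfl, ha]
    have h18 : τ₀.nat 18 0 0 = e₀ := by simp [hτ₀, he₀]
    have h3 : ∀ e, τ₀.nat 3 e 0 = τ.nat 3 e 0 := fun e => by
      rw [hτ₀, Mem.setNat_nat_of_ne _ _ _ _ (by decide)]
    have ht₀ : τ₀.nat 3 e₀ 0 = D.tail e₀ := by
      rw [h3, hI e₀, if_neg (by simp [he₀])]
    have hiff : (BExpr.and (inSel (.col 3 (.var 18))) (.neg (inSel (.col 4 (.var 18))))).holds τ₀ ↔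
        D.Leaves e₀ (S i₀) := by
      rw [BExpr.holds, BExpr.holds, inSel_holds (u := D.tail e₀) hb₀ hsel₀,
        inSel_holds (u := D.head e₀) hb₀ hsel₀]
      · rfl
      · simp only [NExpr.eval, h18, hb₀.head]
      · simp only [NExpr.eval, h18, ht₀]
    by_cases hc : D.Leaves e₀ (S i₀)
    · rw [Prog.exec_ite_pos _ _ _ _ (hiff.2 hc), Prog.exec_setNat]
      intro e
      by_cases hee : e = e₀
      · subst hee
        simp only [NExpr.eval, h18, ha₀, Mem.setNat_nat, and_self, if_true]
        rw [if_pos (by simp [he₀])]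
        simp [MultiDigraph.relocate, hc]
      · have hne : (e : ℕ) ≠ i := fun h => hee (Fin.ext h)
        simp only [NExpr.eval, h18, he₀, Mem.setNat_nat, hne, false_and, and_false, if_false, h3, hI e]
        have : (e : ℕ) < i ↔ (e : ℕ) < i + 1 := by omega
        simp only [this]
    · rw [Prog.exec_ite_neg _ _ _ _ (fun h => hc (hiff.1 h)), Prog.exec_skip]
      intro e
      rw [h3, hI e]
      by_cases hee : e = e₀
      · subst hee
        rw [if_neg (by simp [he₀]), if_pos (by simp [he₀])]
        simp [MultiDigraph.relocate, hc]
      · have hne : (e : ℕ) ≠ i := fun h => hee (Fin.ext h)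
        have : (e : ℕ) < i ↔ (e : ℕ) < i + 1 := by omega
        simp only [this]

/-! ### Sizes and selection -/

/-- The sizes of the sets given by the incidence matrix `x`. -/
def sizesProg (x num : ℕ) : Prog :=
  .loop 9 (.var num) <|
    .seq (.setNat 8 (.var 9) (.lit 0) (.lit 0)) <|
    .loop 7 (.var 0) <|
      .ite (.nle (.lit 1) (.get x (.var 9) (.var 7)))
        (.setNat 8 (.var 9) (.lit 0) (.add (.col 8 (.var 9)) (.lit 1))) .skip

theorem card_filter_succ {n : ℕ} (C : Finset (Fin n)) {i : ℕ} (hi : i < n) :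
    (C.filter fun e : Fin n => (e : ℕ) < i + 1).card =
      (C.filter fun e : Fin n => (e : ℕ) < i).card + if (⟨i, hi⟩ : Fin n) ∈ C then 1 else 0 := by
  have := weight_filter_succ (fun _ => 1) C hi
  simp only [weight, Finset.sum_const, nsmul_eq_mul, mul_one] at this
  exact_mod_cast this

/-- Needed for two matrices: the given family, and the predecessor sets of the dual algorithm. -/
theorem sizesProg_spec (hx : x = 6 ∧ num = 2 ∨ x = 31 ∧ num = 0) (hn : σ.nat 0 0 0 = n)
    (hN : σ.nat num 0 0 = N) {R : Fin N → Finset (Fin n)}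
    (hR : ∀ (i : Fin N) (v : Fin n), σ.nat x i v = if v ∈ R i then 1 else 0) (i : Fin N) :
    ((sizesProg x num).exec O σ).nat 8 i 0 = (R i).card := by
  have := Prog.exec_loop (O := O) (x := 9) (e := .var num) (N := N) (σ := σ)
    (p := .seq (.setNat 8 (.var 9) (.lit 0) (.lit 0)) <|
    .loop 7 (.var 0) <|
      .ite (.nle (.lit 1) (.get x (.var 9) (.var 7)))
        (.setNat 8 (.var 9) (.lit 0) (.add (.col 8 (.var 9)) (.lit 1))) .skip) hN
    (fun j τ => ∀ i : Fin N, (i : ℕ) < j → τ.nat 8 i 0 = (R i).card) (by simp)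
    (fun j τ hj hf hI => ?_)
  · exact this i i.2
  · have hx' : x ≠ 9 ∧ x ≠ 8 ∧ x ≠ 7 := by omega
    rw [Prog.exec_seq]
    set ρ := (Prog.setNat 8 (.var 9) (.lit 0) (.lit 0)).exec O (τ.setNat 9 0 0 j) with hρ
    have hρ8 : ∀ l, ρ.nat 8 l 0 = if l = j then 0 else τ.nat 8 l 0 := by
      intro l
      simp [hρ]
    have hρ9 : ρ.nat 9 0 0 = j := by simp [hρ]
    have hρx : ∀ (i : Fin N) (v : Fin n), ρ.nat x i v = if v ∈ R i then 1 else 0 := by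
      intro i v
      have : ρ.nat x = τ.nat x := by
        simp only [hρ, Prog.exec_setNat]
        rw [Mem.setNat_nat_of_ne _ _ _ _ hx'.2.1, Mem.setNat_nat_of_ne _ _ _ _ hx'.1]
      rw [this, hf.1 x (by rcases hx with ⟨rfl, rfl⟩ | ⟨rfl, rfl⟩ <;> rfl), hR]
    have hρ0 : ρ.nat 0 0 0 = n := by
      have : ρ.nat 0 = τ.nat 0 := by
        simp only [hρ, Prog.exec_setNat]
        rw [Mem.setNat_nat_of_ne _ _ _ _ (by decide), Mem.setNat_nat_of_ne _ _ _ _ (by decide)]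
      rw [this, hf.1 0 rfl, hn]
    clear_value ρ
    have inner := Prog.exec_loop (O := O) (x := 7) (e := .var 0) (N := n) (σ := ρ)
      (p := .ite (.nle (.lit 1) (.get x (.var 9) (.var 7)))
        (.setNat 8 (.var 9) (.lit 0) (.add (.col 8 (.var 9)) (.lit 1))) .skip) hρ0
      (fun v υ => (∀ l, l ≠ j → υ.nat 8 l 0 = τ.nat 8 l 0) ∧
        υ.nat 8 j 0 = ((R ⟨j, hj⟩).filter fun u : Fin n => (u : ℕ) < v).card)
      (by
        refine ⟨fun l hl => by rw [hρ8, if_neg hl], ?_⟩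
        rw [hρ8, if_pos rfl]
        simp) (fun v υ hv hg hJ => ?_)
    · intro i hi
      by_cases hij : (i : ℕ) = j
      · rw [hij, inner.2, Finset.filter_true_of_mem fun u _ => u.2]
        congr 2
        exact Fin.ext hij.symm
      · rw [inner.1 i hij, hI i (by omega)]
    · set υ₀ := υ.setNat 7 0 0 v with hυ₀
      have e9 : υ₀.nat 9 0 0 = j := by
        rw [hυ₀, Mem.setNat_nat_of_ne _ _ _ _ (by decide), hg.1 9 rfl, hρ9]
      have e7 : υ₀.nat 7 0 0 = v := by simp [hυ₀]
      have e8 : υ₀.nat 8 = υ.nat 8 := Mem.setNat_nat_of_ne _ _ _ _ (by decide)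
      have ex := hρx ⟨j, hj⟩ ⟨v, hv⟩
      rw [← hg.1 x (by rcases hx with ⟨rfl, rfl⟩ | ⟨rfl, rfl⟩ <;> rfl),
        ← Mem.setNat_nat_of_ne υ 0 0 v hx'.2.2, ← hυ₀] at ex
      have hiff : (BExpr.nle (.lit 1) (.get x (.var 9) (.var 7))).holds υ₀ ↔
          (⟨v, hv⟩ : Fin n) ∈ R ⟨j, hj⟩ := by
        simp only [BExpr.holds, NExpr.eval, e9, e7]
        simp only at ex
        rw [ex]
        split_ifs with h <;> simp [h]
      rw [card_filter_succ _ hv]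
      by_cases hc : (⟨v, hv⟩ : Fin n) ∈ R ⟨j, hj⟩
      · rw [Prog.exec_ite_pos _ _ _ _ (hiff.2 hc), Prog.exec_setNat, if_pos hc]
        simp only [NExpr.eval, e9, e8, hJ.2]
        refine ⟨fun l hl => ?_, by simp⟩
        simp [hl, e8, hJ.1 l hl]
      · rw [Prog.exec_ite_neg _ _ _ _ (fun h => hc (hiff.1 h)), Prog.exec_skip, if_neg hc, e8]
        exact hJ

/-- Select a set of minimum size among those not marked in the array `13`. -/
def selectProg (num : ℕ) : Prog :=
  .seq (.setNat 8 (.var num) (.lit 0) (.add (.var 0) (.lit 1))) <|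
  .seq (.setNat 12 (.lit 0) (.lit 0) (.var num)) <|
  .loop 9 (.var num) <|
    .ite (.and (.nle (.col 13 (.var 9)) (.lit 0))
        (.nle (.add (.col 8 (.var 9)) (.lit 1)) (.col 8 (.var 12))))
      (.setNat 12 (.lit 0) (.lit 0) (.var 9)) .skip

/-- The cell after the last set holds the sentinel size n + 1, larger than any set; it remains
selected exactly when every set is marked. -/
theorem selectProg_spec (hnum : num = 2 ∨ num = 0) (hn : σ.nat 0 0 0 = n) (hN : σ.nat num 0 0 = N)
    (hle : ∀ i < N, σ.nat 8 i 0 ≤ n) :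
    let τ := (selectProg num).exec O σ
    (∀ i < N, τ.nat 8 i 0 = σ.nat 8 i 0) ∧
    (τ.nat 12 0 0 = N ∧ (∀ i < N, σ.nat 13 i 0 ≠ 0) ∨
    τ.nat 12 0 0 < N ∧ σ.nat 13 (τ.nat 12 0 0) 0 = 0 ∧
      ∀ i < N, σ.nat 13 i 0 = 0 → σ.nat 8 (τ.nat 12 0 0) 0 ≤ σ.nat 8 i 0) := by
  intro τ
  set ρ := (σ.setNat 8 N 0 (n + 1)).setNat 12 0 0 N with hρ
  have hnum' : num ≠ 8 ∧ num ≠ 12 ∧ num ≠ 9 := by omega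
  set body : Prog := .ite (.and (.nle (.col 13 (.var 9)) (.lit 0))
        (.nle (.add (.col 8 (.var 9)) (.lit 1)) (.col 8 (.var 12))))
      (.setNat 12 (.lit 0) (.lit 0) (.var 9)) .skip with hbody
  have hτ : τ = (Prog.loop 9 (.var num) body).exec O ρ := by
    simp only [τ, selectProg, Prog.exec_seq, Prog.exec_setNat, NExpr.eval, hN, hn, Mem.setNat_nat,
      hnum'.1, false_and, if_false, ← hbody, hρ]
  have hρN : ρ.nat num 0 0 = N := by simp [hρ, hnum', hN]
  have hρ8 : ∀ i < N, ρ.nat 8 i 0 = σ.nat 8 i 0 := by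
    intro i hi
    have : i ≠ N := by omega
    simp [hρ, this]
  have hρ8' : ρ.nat 8 N 0 = n + 1 := by simp [hρ]
  have hρ13 : ρ.nat 13 = σ.nat 13 := by
    rw [hρ, Mem.setNat_nat_of_ne _ _ _ _ (by decide), Mem.setNat_nat_of_ne _ _ _ _ (by decide)]
  have hρ12 : ρ.nat 12 0 0 = N := by simp [hρ]
  have hf := (Prog.loop 9 (.var num) body).frame O ρ
  clear_value ρ
  have := Prog.exec_loop (O := O) (x := 9) (e := .var num) (N := N) (σ := ρ) (p := body) hρN
    (fun j τ => (τ.nat 12 0 0 = N ∨ τ.nat 12 0 0 < j ∧ ρ.nat 13 (τ.nat 12 0 0) 0 = 0) ∧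
      ∀ i < j, ρ.nat 13 i 0 = 0 → ρ.nat 8 (τ.nat 12 0 0) 0 ≤ ρ.nat 8 i 0)
    (by simp [hρ12]) (fun j τ hj hf hI => ?_)
  · rw [← hτ] at this hf
    obtain ⟨h1, h2⟩ := this
    refine ⟨fun i hi => by rw [hf.1 8 rfl, hρ8 i hi], ?_⟩
    rw [hρ13] at h1 h2
    rcases h1 with h1 | ⟨h1, h3⟩
    · refine .inl ⟨h1, fun i hi h0 => ?_⟩
      have := h2 i hi h0
      rw [h1, hρ8', hρ8 i hi] at this
      have := hle i hi
      omega
    · refine .inr ⟨h1, h3, fun i hi h0 => ?_⟩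
      have := h2 i hi h0
      rwa [hρ8 i hi, hρ8 _ h1] at this
  · set τ₀ := τ.setNat 9 0 0 j with hτ₀
    have e9 : τ₀.nat 9 0 0 = j := by simp [hτ₀]
    have e13 : τ₀.nat 13 = ρ.nat 13 := by
      rw [hτ₀, Mem.setNat_nat_of_ne _ _ _ _ (by decide), hf.1 13 rfl]
    have e8 : τ₀.nat 8 = ρ.nat 8 := by
      rw [hτ₀, Mem.setNat_nat_of_ne _ _ _ _ (by decide), hf.1 8 rfl]
    have e12 : τ₀.nat 12 = τ.nat 12 := Mem.setNat_nat_of_ne _ _ _ _ (by decide)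
    have hiff : (BExpr.and (.nle (.col 13 (.var 9)) (.lit 0))
        (.nle (.add (.col 8 (.var 9)) (.lit 1)) (.col 8 (.var 12)))).holds τ₀ ↔
        ρ.nat 13 j 0 = 0 ∧ ρ.nat 8 j 0 < ρ.nat 8 (τ.nat 12 0 0) 0 := by
      simp only [BExpr.holds, NExpr.eval, e9, e13, e8, e12]
      omega
    rw [hbody]
    by_cases hc : ρ.nat 13 j 0 = 0 ∧ ρ.nat 8 j 0 < ρ.nat 8 (τ.nat 12 0 0) 0
    · rw [Prog.exec_ite_pos _ _ _ _ (hiff.2 hc), Prog.exec_setNat]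
      simp only [NExpr.eval, e9, Mem.setNat_nat, and_self, if_true]
      refine ⟨.inr ⟨by omega, hc.1⟩, fun i hi h0 => ?_⟩
      by_cases hij : i = j
      · rw [hij]
      · have := hI.2 i (by omega) h0
        omega
    · rw [Prog.exec_ite_neg _ _ _ _ (fun h => hc (hiff.1 h)), Prog.exec_skip, e12]
      refine ⟨hI.1.imp id fun h => ⟨by omega, h.2⟩, fun i hi h0 => ?_⟩
      by_cases hij : i = j
      · subst hij
        by_contra h
        exact hc ⟨h0, not_le.1 h⟩
      · exact hI.2 i (by omega) h0

end CoverArb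

namespace CoverArb

variable {n m k : ℕ} {S : Fin k → Finset (Fin n)} {w : Fin m → ℝ≥0}
  {O : Network → Finset ℕ} {D E : MultiDigraph (Fin n) (Fin m)} {σ : Mem}

/-! ### Initialization -/

/-- Clear the output. -/
def clearOut : Prog := .loop 18 (.var 1) (.setNat 5 (.var 18) (.lit 0) (.lit 0))

theorem clearOut_spec (hm : σ.nat 1 0 0 = m) : outputArcs m (clearOut.exec O σ) = ∅ := by
  have := Prog.exec_loop (O := O) (x := 18) (e := .var 1) (N := m) (σ := σ)
    (p := .setNat 5 (.var 18) (.lit 0) (.lit 0)) hm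
    (fun i τ => ∀ e : ℕ, e < i → τ.nat 5 e 0 = 0) (by simp)
    (fun i τ hi hf hI e he => ?_)
  · ext e
    simp only [outputArcs, Finset.mem_filter, Finset.mem_univ, true_and, Finset.notMem_empty,
      iff_false]
    have h := this e e.2
    change (clearOut.exec O σ).nat 5 e 0 = 0 at h
    omega
  · by_cases hei : e = i
    · simp [hei]
    · simp [hei, hI e (by omega)]

/-- Compute the large capacity. -/
def capProg : Prog :=
  .seq (.setReal 10 (.lit 0) (.lit 0) .one) <|
  .loop 18 (.var 1) (.setReal 10 (.lit 0) (.lit 0) (.add (.var 10) (.col 0 (.var 18))))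

theorem capProg_spec (hm : σ.nat 1 0 0 = m) (hw : ∀ e : Fin m, σ.real 0 e 0 = w e) :
    (capProg.exec O σ).real 10 0 0 = bigCap w := by
  have := Prog.exec_loop (O := O) (x := 18) (e := .var 1) (N := m) (σ := σ.setReal 10 0 0 1)
    (p := .setReal 10 (.lit 0) (.lit 0) (.add (.var 10) (.col 0 (.var 18)))) hm
    (fun i τ => τ.real 10 0 0 = 1 + weight w (Finset.univ.filter fun e : Fin m => (e : ℕ) < i))
    (by simp [weight]) (fun i τ hi hf hI => ?_)
  · refine Eq.trans this ?_
    rw [Finset.filter_true_of_mem fun e _ => e.2, bigCap, weight]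
    push_cast
    rfl
  · have h0 : τ.real 0 i 0 = w ⟨i, hi⟩ := by
      rw [hf.2 0 rfl, Mem.setReal_real_of_ne _ _ _ _ (by decide)]
      exact hw ⟨i, hi⟩
    rw [weight_filter_succ w _ hi, if_pos (Finset.mem_univ _)]
    simp [hI, h0, add_assoc]

/-- Mark all sets as not processed. -/
def clearDone : Prog := .loop 9 (.var 2) (.setNat 13 (.var 9) (.lit 0) (.lit 0))

theorem clearDone_spec (hk : σ.nat 2 0 0 = k) : ∀ i < k, (clearDone.exec O σ).nat 13 i 0 = 0 := by
  refine Prog.exec_loop (O := O) (x := 9) (e := .var 2) (N := k) (σ := σ)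
    (p := .setNat 13 (.var 9) (.lit 0) (.lit 0)) hk
    (fun i τ => ∀ e : ℕ, e < i → τ.nat 13 e 0 = 0) (by simp)
    (fun i τ hi hf hI e he => ?_)
  by_cases hei : e = i
  · simp [hei]
  · simp [hei, hI e (by omega)]

/-! ### The main loop -/

/-- Process one set. -/
def processBody : Prog :=
  .seq (selectProg 2) <|
  .seq (.setNat 13 (.var 12) (.lit 0) (.lit 1)) <|
  .seq anchorProg moveProg

/-- A remaining set of minimum size is inclusionwise minimal, so this is a legitimate pass of the
first phase. The bound M in the criterion may be any number up to the recorded weight: when that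
weight drops, fewer values of M are admitted, and the earlier passes stay valid for them. -/
theorem processBody_spec (hO : IsMinCutOracle O) (hL : IsLaminar (Finset.univ.image S))
    (hinj : Function.Injective S) (hb : Base D.head S w σ) (hsize : ∀ i : Fin k, σ.nat 8 i 0 = (S i).card)
    {U : Finset (Fin k)} (hU : U.Nonempty) (hdone : ∀ i : Fin k, σ.nat 13 i 0 = 0 ↔ i ∈ U)
    (ht : HasTails 3 E σ) (hbest : IsBest (D.CoversTight (Finset.univ.image S)) w σ)
    (hE : MultiDigraph.LEquiv (Finset.univ.image S) D E)
    (hrun : ∀ M : ℝ≥0, (M : ℝ) ≤ σ.real 15 0 0 →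
      D.Run (GoodAnchor w (Finset.univ.image S) M) (Finset.univ.image S) E (U.image S)) :
    let τ := processBody.exec O σ
    IsBest (D.CoversTight (Finset.univ.image S)) w τ ∧ (∀ i : Fin k, τ.nat 8 i 0 = (S i).card) ∧
    ∃ i₀ ∈ U, (∀ i : Fin k, τ.nat 13 i 0 = 0 ↔ i ∈ U.erase i₀) ∧
    ∃ E', HasTails 3 E' τ ∧ MultiDigraph.LEquiv (Finset.univ.image S) D E' ∧
      ∀ M : ℝ≥0, (M : ℝ) ≤ τ.real 15 0 0 →
      D.Run (GoodAnchor w (Finset.univ.image S) M) (Finset.univ.image S) E' ((U.erase i₀).image S) := by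
  intro τ
  have hhead : E.head = D.head := by
    funext e
    exact (hE.head e).symm
  obtain ⟨hs8, hs⟩ := selectProg_spec (O := O) (σ := σ) (.inl rfl) hb.nodes hb.sets
    (fun i hi => by
      rw [hsize ⟨i, hi⟩]
      exact (Finset.card_le_univ _).trans (by simp))
  have hf1 := (selectProg 2).frame O σ
  set τ₁ := (selectProg 2).exec O σ with hτ₁
  have hsel : ∃ i₀ ∈ U, τ₁.nat 12 0 0 = i₀ ∧ ∀ i ∈ U, (S i₀).card ≤ (S i).card := by
    rcases hs with ⟨-, h⟩ | ⟨h1, h2, h3⟩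
    · obtain ⟨i, hi⟩ := hU
      exact absurd ((hdone i).2 hi) (h i i.2)
    · refine ⟨⟨_, h1⟩, (hdone ⟨_, h1⟩).1 h2, rfl, fun i hi => ?_⟩
      have := h3 i i.2 ((hdone i).2 hi)
      rwa [hsize i, hsize ⟨_, h1⟩] at this
  obtain ⟨i₀, hi₀, h12, hmin⟩ := hsel
  set τ₂ := τ₁.setNat 13 i₀ 0 1 with hτ₂
  have hex : τ = moveProg.exec O (anchorProg.exec O τ₂) := by
    simp only [τ, processBody, Prog.exec_seq, Prog.exec_setNat, NExpr.eval, ← hτ₁, h12, hτ₂]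
  have hn₂ : ∀ y, y ≠ 13 → τ₂.nat y = τ₁.nat y := fun y hy => Mem.setNat_nat_of_ne _ _ _ _ hy
  have hbE : Base E.head S w σ := hhead ▸ hb
  have hb₂ : Base E.head S w τ₂ := (hbE.of_frame hf1 rfl rfl).setNat _ _ _ rfl
  have hsel₂ : τ₂.nat 12 0 0 = i₀ := by rw [hn₂ 12 (by decide), h12]
  have ht₂ : HasTails 3 E τ₂ := fun e => by rw [hn₂ 3 (by decide), hf1.1 3 rfl, ht e]
  have hmem : S i₀ ∈ Finset.univ.image S := Finset.mem_image_of_mem _ (Finset.mem_univ _)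
  have hr₂ : τ₂.real 15 0 0 = σ.real 15 0 0 := by
    rw [hτ₂, Mem.setNat_real, hf1.2 15 rfl]
  have hbest₂ : IsBest (D.CoversTight (Finset.univ.image S)) w τ₂ :=
    hbest.congr (by rw [hn₂ 5 (by decide), hf1.1 5 rfl]) (by rw [hτ₂, Mem.setNat_real, hf1.2 15 rfl])
  obtain ⟨a1, a2, a, haF, ha15, ha⟩ := anchorProg_spec hO hb₂ hsel₂ ht₂ (hL.1 _ hmem)
    (P := D.CoversTight (Finset.univ.image S))
    (fun E' hE' Z₁ Z₂ z1 z2 z3 z4 z5 => by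
      have : MultiDigraph.LEquiv (Finset.univ.image S) D E' := by
        rcases hE' with rfl | ⟨b, rfl⟩
        · exact hE
        · exact hE.trans hL (E.lEquiv_relocateAll _ b)
      exact this.covers_double_cut hL hmem z1 z2 z3 z4 z5) hbest₂
  have hf3 := anchorProg.frame O τ₂
  set τ₃ := anchorProg.exec O τ₂
  have ht' := moveProg_spec (O := O) (hb₂.of_frame hf3 rfl rfl) (by rw [hf3.1 12 rfl, hsel₂])
    (fun e => by rw [hf3.1 3 rfl, ht₂ e]) ha15
  have hf4 := moveProg.frame O τ₃
  rw [← hex] at ht' hf4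
  have h15 : τ.real 15 = τ₃.real 15 := hf4.2 15 rfl
  have hrun' : ∀ M : ℝ≥0, (M : ℝ) ≤ τ.real 15 0 0 →
      D.Run (GoodAnchor w (Finset.univ.image S) M) (Finset.univ.image S) (E.relocate (S i₀) a)
        ((U.erase i₀).image S) := by
    intro M hM
    rw [h15] at hM
    rw [Finset.image_erase hinj]
    refine (hrun M (hM.trans (a2.trans hr₂.le))).step ⟨Finset.mem_image_of_mem _ hi₀, ?_⟩ haF
      (ha M hM)
    intro X hX hXle
    obtain ⟨i, hi, rfl⟩ := Finset.mem_image.1 hX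
    exact (Finset.eq_of_subset_of_card_le hXle (hmin i hi)).ge
  refine ⟨a1.congr (hf4.1 5 rfl) h15, fun i => ?_, i₀, hi₀, fun i => ?_, _, ht', ?_, hrun'⟩
  · rw [hf4.1 8 rfl, hf3.1 8 rfl, hn₂ 8 (by decide), hs8 i i.2, hsize i]
  · rw [hf4.1 13 rfl, hf3.1 13 rfl, hτ₂, Mem.setNat_nat, hf1.1 13 rfl]
    by_cases hii : i = i₀
    · simp [hii]
    · have : (i : ℕ) ≠ i₀ := fun h => hii (Fin.ext h)
      simp [this, hii, hdone]
  -- The run is available only for M up to the recorded weight; M = 0 is always admitted.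
  · have hM : ((0 : ℝ≥0) : ℝ) ≤ τ.real 15 0 0 := by
      rcases (a1.congr (hf4.1 5 rfl) h15 : IsBest _ w τ).or with h | h
      · rw [h]
        exact bigCap_pos.le
      · rw [h.2]
        exact NNReal.coe_nonneg _
    exact (hrun' 0 hM).lEquiv hL

/-! ### The program -/

/-- The arc sets covering all tight arborescences, if there are enough arcs. -/
def tightMain : Prog :=
  .seq capProg <| .seq clearDone <| .seq (sizesProg 6 2) <|
  .seq (.setReal 15 (.lit 0) (.lit 0) (.var 10)) <| .loop 25 (.var 2) processBody

/-- The program for tight arborescences. -/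
def tightProg : Prog :=
  .seq clearOut <| .ite (.nle (.var 0) (.add (.var 1) (.lit 1))) tightMain .skip

/-- The input of the program. -/
structure TightInput (D : MultiDigraph (Fin n) (Fin m)) (S : Fin k → Finset (Fin n))
    (w : Fin m → ℝ≥0) (σ : Mem) : Prop where
  nodes : σ.nat 0 0 0 = n
  arcs : σ.nat 1 0 0 = m
  sets : σ.nat 2 0 0 = k
  tail : HasTails 3 D σ
  head : ∀ e : Fin m, σ.nat 4 e 0 = D.head e
  inc : ∀ (i : Fin k) (v : Fin n), σ.nat 6 i v = if v ∈ S i then 1 else 0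
  weights : ∀ e : Fin m, σ.real 0 e 0 = w e

theorem TightInput.of_frame {τ : Mem} {p : Prog} (h : TightInput D S w σ) (hf : Frame p σ τ)
    (h1 : [0, 1, 2, 3, 4, 6].all (fun y => !p.writesNat y) = true)
    (h2 : p.writesReal 0 = false) : TightInput D S w τ := by
  simp only [List.all_cons, List.all_nil, Bool.and_true, Bool.and_eq_true, Bool.not_eq_true'] at h1
  obtain ⟨a0, a1, a2, a3, a4, a6⟩ := h1
  constructor
  · rw [hf.1 0 a0, h.nodes]
  · rw [hf.1 1 a1, h.arcs]
  · rw [hf.1 2 a2, h.sets]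
  · intro e
    rw [hf.1 3 a3, h.tail]
  · rw [hf.1 4 a4]
    exact h.head
  · rw [hf.1 6 a6]
    exact h.inc
  · rw [hf.2 0 h2]
    exact h.weights

/-- Taking the final recorded weight as M, the run makes the final digraph `Anchored`, so every
cover weighs at least M. If no double cut had been recorded, M would be the large capacity, which
exceeds the weight of every arc set, against the existence of a cover. Hence M is the weight of the
output. -/
theorem tightMain_spec (hO : IsMinCutOracle O) (hinj : Function.Injective S)
    (hL : IsLaminar (Finset.univ.image S)) (hV : Finset.univ ∈ Finset.univ.image S)
    (hin : TightInput D S w σ) (hex : ∃ H, D.CoversTight (Finset.univ.image S) H) :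
    IsMinWeight (D.CoversTight (Finset.univ.image S)) w (outputArcs m (tightMain.exec O σ)) := by
  set L := Finset.univ.image S with hLdef
  have hcap := capProg_spec (O := O) hin.arcs hin.weights
  have hf1 := capProg.frame O σ
  set τ₁ := capProg.exec O σ with hτ₁
  have hin₁ : TightInput D S w τ₁ := hin.of_frame hf1 rfl rfl
  have hdone := clearDone_spec (O := O) hin₁.sets
  have hf2 := clearDone.frame O τ₁
  set τ₂ := clearDone.exec O τ₁ with hτ₂
  have hin₂ : TightInput D S w τ₂ := hin₁.of_frame hf2 rfl rfl
  have hsize := sizesProg_spec (O := O) (.inl ⟨rfl, rfl⟩) hin₂.nodes hin₂.sets hin₂.inc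
  have hf3 := (sizesProg 6 2).frame O τ₂
  set τ₃ := (sizesProg 6 2).exec O τ₂ with hτ₃
  have hin₃ : TightInput D S w τ₃ := hin₂.of_frame hf3 rfl rfl
  have hcap₃ : τ₃.real 10 0 0 = bigCap w := by rw [hf3.2 10 rfl, hf2.2 10 rfl, hcap]
  set τ₄ := τ₃.setReal 15 0 0 (bigCap w) with hτ₄
  have hexec : tightMain.exec O σ = (Prog.loop 25 (.var 2) processBody).exec O τ₄ := by
    simp only [tightMain, Prog.exec_seq, Prog.exec_setReal, ← hτ₁, ← hτ₂, ← hτ₃, hτ₄, NExpr.eval,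
      RExpr.eval, hcap₃]
  have hb : Base D.head S w τ₄ := Base.setReal
    ⟨hin₃.nodes, hin₃.arcs, hin₃.sets, hin₃.head, hin₃.inc, hin₃.weights, hcap₃⟩ _ _ _ rfl
  have h15 : τ₄.real 15 0 0 = bigCap w := by simp [hτ₄]
  have main := Prog.exec_loop (O := O) (x := 25) (e := .var 2) (N := k) (σ := τ₄) (p := processBody)
    hb.sets
    (fun j τ => IsBest (D.CoversTight L) w τ ∧ (∀ i : Fin k, τ.nat 8 i 0 = (S i).card) ∧
      ∃ U : Finset (Fin k), U.card + j = k ∧ (∀ i : Fin k, τ.nat 13 i 0 = 0 ↔ i ∈ U) ∧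
      ∃ E, HasTails 3 E τ ∧ MultiDigraph.LEquiv L D E ∧
        ∀ M : ℝ≥0, (M : ℝ) ≤ τ.real 15 0 0 → D.Run (GoodAnchor w L M) L E (U.image S))
    ⟨⟨h15.le, .inl h15⟩, hsize, Finset.univ, by simp, fun i => by
      simp only [Finset.mem_univ, iff_true]
      change τ₃.nat 13 i 0 = 0
      rw [hf3.1 13 rfl, hdone i i.2], D, hin₃.tail, MultiDigraph.LEquiv.refl L D,
      fun M _ => .start⟩ (fun j τ hj hf hI => ?_)
  · rw [← hexec] at main
    set τ := tightMain.exec O σ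
    obtain ⟨hbest, -, U, hU, -, E, -, -, hrun⟩ := main
    obtain rfl : U = ∅ := Finset.card_eq_zero.1 (by omega)
    simp only [Finset.image_empty] at hrun
    have h0 : 0 ≤ τ.real 15 0 0 := by
      rcases hbest.or with h | h
      · rw [h]
        exact bigCap_pos.le
      · rw [h.2]
        exact NNReal.coe_nonneg _
    set M : ℝ≥0 := ⟨τ.real 15 0 0, h0⟩ with hM
    have hR := hrun M le_rfl
    have hlow : ∀ H, D.CoversTight L H → M ≤ weight w H := by
      -- The cut bounds were established in the digraph current when F was selected, and are
      -- transferred to the final one, which agrees with it inside F.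
      obtain ⟨anc, hanc⟩ := hR.exists_anchors hL ⟨_, hV⟩ (by
        intro F hF D₁ D₂ t hag hg
        refine ⟨fun Z₁ Z₂ z1 z2 z3 z4 z5 => ?_, fun b Z₁ Z₂ z1 z2 z3 z4 z5 => ?_,
          fun Z z1 z2 z3 => ?_⟩
        · rw [← hag.cutIn_eq w z4, ← hag.cutIn_eq w z5]
          exact hg.cut Z₁ Z₂ z1 z2 z3 z4 z5
        · have := hag.relocateAll hL hF (z4 z1)
          rw [← this.cutIn_eq w z4, ← this.cutIn_eq w z5]
          exact hg.cutAt b Z₁ Z₂ z1 z2 z3 z4 z5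
        · rw [← hag.cutIn_eq w z2]
          exact hg.anchor Z z1 z2 z3)
      have hA : E.Anchored w L M anc := by
        refine ⟨fun F hF => (hanc F hF).2, fun F hF => (hanc F hF).1.cut,
          fun F hF b => (hanc F hF).1.cutAt b, fun F hF => (hanc F hF).1.anchor⟩
      intro H hH
      exact hA.le_of_covers hL hV (((hR.lEquiv hL).coversTight_iff hL).1 hH)
    rcases hbest.or with h | ⟨h1, h2⟩
    · exfalso
      obtain ⟨H, hH⟩ := hex
      have h3 : (M : ℝ) ≤ weight w H := by exact_mod_cast hlow H hH
      have h4 := weight_lt_bigCap w H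
      have h5 : (M : ℝ) = bigCap w := h
      linarith
    · refine ⟨h1, fun H hH => ?_⟩
      have h3 : (M : ℝ) ≤ weight w H := by exact_mod_cast hlow H hH
      have h5 : (M : ℝ) = weight w (outputArcs m τ) := h2
      rw [h5] at h3
      exact_mod_cast h3
  · obtain ⟨hbest, hs8, U, hU, hd, E, htE, hDE, hrun⟩ := hI
    have hnat : ∀ y, y ≠ 25 → (τ.setNat 25 0 0 j).nat y = τ.nat y :=
      fun y hy => Mem.setNat_nat_of_ne _ _ _ _ hy
    obtain ⟨b1, b2, i₀, hi₀, b3, E', b4, b5, b6⟩ := processBody_spec (σ := τ.setNat 25 0 0 j)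
      (D := D) (E := E) (S := S) (w := w) (U := U) hO hL hinj
      ((hb.of_frame hf rfl rfl).setNat _ _ _ rfl)
      (fun i => by rw [hnat 8 (by decide), hs8]) (Finset.card_pos.1 (by omega))
      (fun i => by rw [hnat 13 (by decide), hd]) (fun e => by rw [hnat 3 (by decide), htE e])
      (hbest.congr (hnat 5 (by decide)) rfl) hDE hrun
    refine ⟨b1, b2, U.erase i₀, ?_, b3, E', b4, b5, b6⟩
    have := Finset.card_pos.2 ⟨i₀, hi₀⟩
    rw [Finset.card_erase_of_mem hi₀]
    omega

theorem MultiDigraph.IsArborescence.card_add_one {V A : Type*} [Fintype V] [DecidableEq V]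
    {D : MultiDigraph V A} {r : V} {B : Finset A} (h : D.IsArborescence r B) :
    B.card + 1 = Fintype.card V := by
  have h1 : B.card = ∑ v : V, (B.filter fun a => D.head a = v).card :=
    Finset.card_eq_sum_card_fiberwise fun _ _ => by simp
  rw [← Finset.add_sum_erase _ _ (Finset.mem_univ r), h.1,
    Finset.sum_congr rfl fun v hv => h.2.1 v (Finset.ne_of_mem_erase hv)] at h1
  simp only [Finset.sum_const, Finset.card_erase_of_mem (Finset.mem_univ r), Finset.card_univ,
    smul_eq_mul, mul_one] at h1
  have := Fintype.card_pos_iff.2 ⟨r⟩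
  omega

/-- With fewer than n - 1 arcs there is no arborescence and the empty set is optimal. The test is
made because the growth condition on T is assumed only for networks with at least n - 1 arcs. -/
theorem tightProg_spec (hO : IsMinCutOracle O) (hinj : Function.Injective S)
    (hL : IsLaminar (Finset.univ.image S)) (hV : Finset.univ ∈ Finset.univ.image S)
    (hin : TightInput D S w σ) (hex : ∃ H, D.CoversTight (Finset.univ.image S) H) :
    IsMinWeight (D.CoversTight (Finset.univ.image S)) w (outputArcs m (tightProg.exec O σ)) := by
  have hin' : TightInput D S w (clearOut.exec O σ) := hin.of_frame (clearOut.frame O σ) rfl rfl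
  rw [tightProg, Prog.exec_seq]
  by_cases hnm : n ≤ m + 1
  · rw [Prog.exec_ite_pos _ _ _ _ (by simpa [hin'.nodes, hin'.arcs] using hnm)]
    exact tightMain_spec hO hinj hL hV hin' hex
  · rw [Prog.exec_ite_neg _ _ _ _ (by simpa [hin'.nodes, hin'.arcs] using hnm), Prog.exec_skip,
      clearOut_spec hin.arcs]
    refine ⟨fun r B hB => ?_, fun H _ => by simp [weight]⟩
    have h1 := hB.1.card_add_one
    have h2 := Finset.card_le_univ B
    rw [Fintype.card_fin] at h1 h2
    omega

end CoverArb

namespace CoverArb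

/-! ### The number of steps -/

/-- The sizes of the loops and networks in terms of the number `n` of nodes and a number `Q` that
bounds the number of arcs and, if `C` holds, the time of a minimum cut computation. -/
structure Sizes (C : Prop) (T : ℕ → ℕ → ℕ) (σ : Mem) (n Q : ℕ) : Prop where
  pos : 1 ≤ n
  le : n ≤ Q
  nodes : σ.nat 0 0 0 = n
  arcs : σ.nat 1 0 0 ≤ Q
  sets : σ.nat 2 0 0 ≤ 2 * n
  cut : C → T (n + n) (σ.nat 1 0 0 + σ.nat 1 0 0 + n) ≤ Q

/-- The program takes `O(n ^ d * Q)` steps. -/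
def Costs (C : Prop) (p : Prog) (d : ℕ) : Prop :=
  ∃ A, ∀ T σ n Q, Sizes C T σ n Q → p.costBound T σ ≤ A * (n ^ d * Q)

/-- The program takes `O(n ^ d)` steps. -/
def Light (p : Prog) (d : ℕ) : Prop :=
  ∃ A, ∀ T σ n Q, Sizes False T σ n Q → p.costBound T σ ≤ A * n ^ d

theorem Sizes.one {C : Prop} {T : ℕ → ℕ → ℕ} {σ : Mem} {n Q : ℕ} (h : Sizes C T σ n Q) : 1 ≤ Q :=
  h.pos.trans h.le

theorem Sizes.weaken {C : Prop} {T : ℕ → ℕ → ℕ} {σ : Mem} {n Q : ℕ} (h : Sizes C T σ n Q) :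
    Sizes False T σ n Q :=
  ⟨h.pos, h.le, h.nodes, h.arcs, h.sets, False.elim⟩

variable {C : Prop} {p q : Prog} {d d' : ℕ}

theorem Light.mono (h : Light p d) (hd : d ≤ d') : Light p d' := by
  obtain ⟨A, hA⟩ := h
  refine ⟨A, fun T σ n Q hs => (hA T σ n Q hs).trans ?_⟩
  have := Nat.pow_le_pow_right hs.pos hd
  gcongr

theorem Light.costs (h : Light p d) : Costs C p d := by
  obtain ⟨A, hA⟩ := h
  refine ⟨A, fun T σ n Q hs => (hA T σ n Q hs.weaken).trans ?_⟩
  gcongr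
  exact Nat.le_mul_of_pos_right _ hs.one

theorem Light.skip : Light .skip d :=
  ⟨1, fun _ _ n _ hs => (one_mul (n ^ d)).symm ▸ Nat.pow_pos hs.pos⟩

theorem Light.setNat (x : ℕ) (i j e : NExpr) : Light (.setNat x i j e) d :=
  ⟨1 + i.cost + j.cost + e.cost, fun _ _ _ _ hs => Nat.le_mul_of_pos_right _ (Nat.pow_pos hs.pos)⟩

theorem Light.setReal (x : ℕ) (i j : NExpr) (e : RExpr) : Light (.setReal x i j e) d :=
  ⟨1 + i.cost + j.cost + e.cost, fun _ _ _ _ hs => Nat.le_mul_of_pos_right _ (Nat.pow_pos hs.pos)⟩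

theorem Costs.seq (hp : Costs C p d) (hq : Costs C q d) : Costs C (.seq p q) d := by
  obtain ⟨A, hA⟩ := hp
  obtain ⟨B, hB⟩ := hq
  refine ⟨A + B, fun T σ n Q hs => ?_⟩
  rw [Prog.costBound, add_mul]
  exact add_le_add (hA T σ n Q hs) (hB T σ n Q hs)

theorem Light.seq (hp : Light p d) (hq : Light q d) : Light (.seq p q) d := by
  obtain ⟨A, hA⟩ := hp
  obtain ⟨B, hB⟩ := hq
  refine ⟨A + B, fun T σ n Q hs => ?_⟩
  rw [Prog.costBound, add_mul]
  exact add_le_add (hA T σ n Q hs) (hB T σ n Q hs)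

theorem Costs.ite (b : BExpr) (hp : Costs C p d) (hq : Costs C q d) : Costs C (.ite b p q) d := by
  obtain ⟨A, hA⟩ := hp
  obtain ⟨B, hB⟩ := hq
  refine ⟨1 + b.cost + (A + B), fun T σ n Q hs => ?_⟩
  rw [Prog.costBound, add_mul, add_mul A]
  exact add_le_add (Nat.le_mul_of_pos_right _ (Nat.mul_pos (Nat.pow_pos hs.pos) hs.one))
    (add_le_add (hA T σ n Q hs) (hB T σ n Q hs))

theorem Light.ite (b : BExpr) (hp : Light p d) (hq : Light q d) : Light (.ite b p q) d := by
  obtain ⟨A, hA⟩ := hp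
  obtain ⟨B, hB⟩ := hq
  refine ⟨1 + b.cost + (A + B), fun T σ n Q hs => ?_⟩
  rw [Prog.costBound, add_mul, add_mul A]
  exact add_le_add (Nat.le_mul_of_pos_right _ (Nat.pow_pos hs.pos))
    (add_le_add (hA T σ n Q hs) (hB T σ n Q hs))

/-- A number of iterations that is linear in the number of nodes. -/
def Linear (e : NExpr) : Prop := ∀ T σ n Q, Sizes False T σ n Q → e.eval σ ≤ 2 * n

theorem linear_nodes : Linear (.var 0) := fun _ σ n _ hs => by
  have := hs.nodes
  simp only [NExpr.eval]
  omega

theorem linear_sets : Linear (.var 2) := fun _ _ _ _ hs => hs.sets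

theorem linear_two_nodes : Linear (.add (.var 0) (.var 0)) := fun _ σ n _ hs => by
  have := hs.nodes
  simp only [NExpr.eval]
  omega

/-- Used with n as the number of nodes, where a loop raises the degree, and also with the size bound
Q in its place, where a loop over the arcs contributes the factor Q. -/
theorem loop_cost_le {c N B A n R : ℕ} (hN : N ≤ 2 * n) (hn : 1 ≤ n) (hR : 1 ≤ R) (hB : B ≤ A * R) :
    1 + c + N * (1 + B) ≤ (1 + c + 2 * (1 + A)) * (n * R) := by
  have h1 : 1 ≤ n * R := Nat.mul_pos hn hR
  calc 1 + c + N * (1 + B) ≤ (1 + c) * (n * R) + 2 * n * (R + A * R) := by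
        gcongr
        exact Nat.le_mul_of_pos_right _ h1
    _ = _ := by ring

theorem Costs.loop (x : ℕ) {e : NExpr} (he : Linear e) (hp : Costs C p d) :
    Costs C (.loop x e p) (d + 1) := by
  obtain ⟨A, hA⟩ := hp
  refine ⟨1 + e.cost + 2 * (1 + A), fun T σ n Q hs => ?_⟩
  rw [Prog.costBound, pow_succ', mul_assoc]
  exact loop_cost_le (he T σ n Q hs.weaken) hs.pos (Nat.mul_pos (Nat.pow_pos hs.pos) hs.one)
    (hA T σ n Q hs)

theorem Light.loop (x : ℕ) {e : NExpr} (he : Linear e) (hp : Light p d) :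
    Light (.loop x e p) (d + 1) := by
  obtain ⟨A, hA⟩ := hp
  refine ⟨1 + e.cost + 2 * (1 + A), fun T σ n Q hs => ?_⟩
  rw [Prog.costBound, pow_succ']
  exact loop_cost_le (he T σ n Q hs) hs.pos (Nat.pow_pos hs.pos) (hA T σ n Q hs)

/-- The single factor Q is consumed by this loop, so its body must be free of it; hence the
distinction between `Light` and `Costs`. -/
theorem Light.loop_size (x : ℕ) {e : NExpr} (he : ∀ T σ n Q, Sizes False T σ n Q → e.eval σ ≤ 2 * Q)
    (hp : Light p d) : Costs C (.loop x e p) d := by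
  obtain ⟨A, hA⟩ := hp
  refine ⟨1 + e.cost + 2 * (1 + A), fun T σ n Q hs => ?_⟩
  rw [Prog.costBound, mul_comm (n ^ d)]
  exact loop_cost_le (he T σ n Q hs.weaken) hs.one (Nat.pow_pos hs.pos) (hA T σ n Q hs.weaken)

theorem Light.loop_arcs (x : ℕ) (hp : Light p d) : Costs C (.loop x (.var 1) p) d :=
  hp.loop_size x fun _ _ _ _ hs => hs.arcs.trans (by omega)

theorem Light.loop_nodes (x : ℕ) (hp : Light p d) : Costs C (.loop x (.var 0) p) d :=
  hp.loop_size x fun T σ n Q hs => (linear_nodes T σ n Q hs).trans (by have := hs.le; omega)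

theorem Costs.minCut (s t : NExpr) (tl hd cp out : ℕ) :
    Costs True (.minCut (.add (.var 0) (.var 0)) (.add (.add (.var 1) (.var 1)) (.var 0)) s t tl hd cp
      out) d := by
  refine ⟨1 + (NExpr.add (.var 0) (.var 0)).cost +
    (NExpr.add (.add (.var 1) (.var 1)) (.var 0)).cost + s.cost + t.cost + 1, fun T σ n Q hs => ?_⟩
  rw [Prog.costBound, add_mul, one_mul]
  have h1 : 1 ≤ n ^ d := Nat.pow_pos hs.pos
  refine add_le_add (Nat.le_mul_of_pos_right _ (Nat.mul_pos h1 hs.one)) ?_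
  simp only [NExpr.eval, hs.nodes]
  exact (hs.cut trivial).trans (Nat.le_mul_of_pos_left _ h1)

/-! ### The steps of the program for tight arborescences -/

theorem costs_cutProg (x : ℕ) (src snk : NExpr) : Costs True (cutProg x src snk) 0 := by
  refine .seq (.seq (Light.loop_arcs _ ?_) (Light.loop_nodes _ ?_)) (.seq (.minCut ..)
    (.seq (Light.setReal ..).costs (Light.loop_arcs _ ?_)))
  · exact .seq (.setNat ..) (.seq (.setNat ..) (.seq (.setNat ..) (.seq (.setNat ..) (.ite _
      (.seq (.setReal ..) (.setReal ..)) (.seq (.setReal ..) (.setReal ..))))))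
  · exact .seq (.setNat ..) (.seq (.setNat ..) (.setReal ..))
  · exact .ite _ (.seq (.setNat ..) (.setReal ..)) (.setNat ..)

theorem costs_tryDouble (x : ℕ) : Costs True (tryDouble x) 0 :=
  .seq (costs_cutProg ..) (.ite _ (.seq (Light.setReal ..).costs (Light.loop_arcs _ (.setNat ..)))
    Light.skip.costs)

theorem costs_trySingle : Costs True trySingle 0 :=
  .seq (costs_cutProg ..) (.ite _ (Light.setReal ..).costs Light.skip.costs)

theorem costs_pairBody : Costs True pairBody 0 :=
  .ite _ (.seq (costs_tryDouble _) (.seq (costs_tryDouble _) costs_trySingle)) Light.skip.costs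

theorem costs_aroundProg : Costs C aroundProg 1 :=
  Light.loop_arcs _ (.seq (.setNat ..) (.loop _ linear_sets (.ite _ (.setNat ..) .skip)))

/-- Quadratically many pairs need a bounded number of cuts each. Computing the relocation for each
node takes O(nQ), within the same total. -/
theorem costs_anchorProg : Costs True anchorProg 2 :=
  .seq (Light.setReal ..).costs <| .loop _ linear_nodes <|
    .ite _ (.seq costs_aroundProg (.seq (Light.setReal ..).costs
      (.seq (.loop _ linear_nodes costs_pairBody)
        (.ite _ (.seq (Light.setReal ..).costs (Light.setNat ..).costs) Light.skip.costs))))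
      Light.skip.costs

theorem light_selectProg {num : ℕ} (h : Linear (.var num)) : Light (selectProg num) 1 :=
  .seq (.setNat ..) (.seq (.setNat ..) (.loop _ h (.ite _ (.setNat ..) .skip)))

theorem light_sizesProg {x num : ℕ} (h : Linear (.var num)) : Light (sizesProg x num) 2 :=
  .loop _ h (.seq (.setNat ..) (.loop _ linear_nodes (.ite _ (.setNat ..) .skip)))

theorem costs_processBody : Costs True processBody 2 :=
  .seq ((light_selectProg linear_sets).mono (by decide)).costs <|
    .seq (Light.setNat ..).costs <| .seq costs_anchorProg <|
    Light.loop_arcs _ (.ite _ (.setNat ..) .skip)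

theorem costs_tightMain : Costs True tightMain 3 :=
  .seq (.seq (Light.setReal ..).costs (Light.loop_arcs _ (.setReal ..))) <|
  .seq ((Light.loop _ linear_sets (.setNat _ _ _ _ : Light _ 0)).mono (by decide)).costs <|
  .seq ((light_sizesProg linear_sets).mono (by decide)).costs <|
  .seq (Light.setReal ..).costs (.loop _ linear_sets costs_processBody)

theorem costs_clearOut : Costs C clearOut 3 := Light.loop_arcs _ (.setNat ..)

/-- The size bound is Q = (K + 1) T(n, m). It dominates n and m even for K = 0, and it dominates a
cut in the doubled network whenever `tightMain` is executed. -/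
theorem tightProg_steps : ∃ A, ∀ K T, IsCutTime K T → ∀ O (n m : ℕ) (σ : Mem), 1 ≤ n →
    σ.nat 0 0 0 = n → σ.nat 1 0 0 = m → σ.nat 2 0 0 ≤ 2 * n →
    (tightProg.run O T σ).2 ≤ A * (n ^ 3 * ((K + 1) * T n m)) := by
  obtain ⟨A₁, hA₁⟩ := costs_tightMain
  obtain ⟨A₂, hA₂⟩ := costs_clearOut (C := False)
  -- The 20 covers the test, and the 1 added to `A₁` the step of the empty branch.
  refine ⟨A₂ + (20 + (A₁ + 1)), fun K T hT O n m σ hn h0 h1 h2 => ?_⟩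
  have hTn := hT.2.1 n m
  have hQ : T n m ≤ (K + 1) * T n m := Nat.le_mul_of_pos_left _ (Nat.succ_pos K)
  have hs : Sizes False T σ n ((K + 1) * T n m) :=
    ⟨hn, by omega, h0, by omega, h2, False.elim⟩
  have hone : 1 ≤ n ^ 3 * ((K + 1) * T n m) := Nat.mul_pos (Nat.pow_pos hn) hs.one
  have hfr := clearOut.frame O σ
  rw [tightProg, Prog.run, add_mul]
  simp only [Prog.run_fst]
  refine add_le_add ((Prog.run_snd_le O T clearOut (W := clearOut.writesNat) rfl (fun _ h => h)
    fun _ _ => rfl).trans (hA₂ T σ n _ hs)) ?_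
  have e0 : (clearOut.exec O σ).nat 0 0 0 = n := by rw [hfr.1 0 rfl, h0]
  have e1 : (clearOut.exec O σ).nat 1 0 0 = m := by rw [hfr.1 1 rfl, h1]
  have e2 : (clearOut.exec O σ).nat 2 0 0 ≤ 2 * n := by rw [hfr.1 2 rfl]; exact h2
  rw [Prog.run, add_mul]
  refine add_le_add ?_ ?_
  · refine le_trans ?_ (Nat.le_mul_of_pos_right _ hone)
    simp [BExpr.cost, NExpr.cost]
  · by_cases hnm : n ≤ m + 1
    · rw [if_pos (by simpa [e0, e1] using hnm)]
      refine (Prog.run_snd_le O T tightMain (W := tightMain.writesNat) rfl (fun _ h => h)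
        fun _ _ => rfl).trans ((hA₁ T _ n _ ⟨hn, by omega, e0, by omega, e2, fun _ => ?_⟩).trans
          (Nat.mul_le_mul_right _ (Nat.le_succ _)))
      rw [e1, ← two_mul, ← two_mul]
      exact (hT.2.2 n m hnm).trans (Nat.mul_le_mul_right _ (Nat.le_succ K))
    · rw [if_neg (by simpa [e0, e1] using hnm), Prog.run]
      exact hone.trans (Nat.le_mul_of_pos_left _ (Nat.succ_pos _))

end CoverArb

namespace CoverArb

open Relation

/-! ### The size of a laminar family -/

/-- Removing a node x from the ground set loses at most two members: {x} itself, and one through the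
identification of some B with B ∪ {x}. -/
theorem IsLaminar.card_le {V : Type*} [DecidableEq V] (U : Finset V) :
    ∀ {L : Finset (Finset V)}, IsLaminar L → (∀ X ∈ L, X ⊆ U) → L.card ≤ 2 * U.card := by
  induction U using Finset.induction_on with
  | empty =>
    intro L hL hU
    have : L = ∅ := by
      rw [Finset.eq_empty_iff_forall_notMem]
      intro X hX
      obtain ⟨x, hx⟩ := hL.1 X hX
      exact Finset.notMem_empty x (hU X hX hx)
    simp [this]
  | insert x U hxU ih =>
    intro L hL hU
    set L₀ := L.erase {x} with hL₀
    have hmem : ∀ X ∈ L₀, X ∈ L ∧ (X.erase x).Nonempty := by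
      intro X hX
      obtain ⟨h1, h2⟩ := Finset.mem_erase.1 hX
      refine ⟨h2, ?_⟩
      by_contra h
      rw [Finset.not_nonempty_iff_eq_empty, Finset.erase_eq_empty_iff] at h
      rcases h with h | h
      · exact (hL.1 X h2).ne_empty h
      · exact h1 h
    have hlam : IsLaminar (L₀.image fun X => X.erase x) := by
      refine ⟨fun Y hY => ?_, fun Y hY Z hZ => ?_⟩
      · obtain ⟨X, hX, rfl⟩ := Finset.mem_image.1 hY
        exact (hmem X hX).2
      · obtain ⟨X, hX, rfl⟩ := Finset.mem_image.1 hY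
        obtain ⟨X', hX', rfl⟩ := Finset.mem_image.1 hZ
        rcases hL.2 X (hmem X hX).1 X' (hmem X' hX').1 with h | h | h
        · exact .inl (Finset.erase_subset_erase x h)
        · exact .inr (.inl (Finset.erase_subset_erase x h))
        · exact .inr (.inr (h.mono (Finset.erase_subset _ _) (Finset.erase_subset _ _)))
    have hcard := ih hlam (by
      intro Y hY
      obtain ⟨X, hX, rfl⟩ := Finset.mem_image.1 hY
      exact Finset.subset_insert_iff.1 (hU X (hmem X hX).1))
    have hunique : ∀ B ∈ L₀, ∀ C ∈ L₀, x ∉ B → x ∉ C → insert x B ∈ L₀ → insert x C ∈ L₀ →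
        insert x B ⊆ insert x C → B = C := by
      intro B hB C hC hxB hxC hB' hC' hsub
      have h1 : B ⊆ C := fun z hz => by
        rcases Finset.mem_insert.1 (hsub (Finset.mem_insert_of_mem hz)) with rfl | h
        · exact absurd hz hxB
        · exact h
      -- C and B ∪ {x} share an element of B, so they are nested. As x is not in C, this forces C ⊆
      -- B.
      obtain ⟨b, hb⟩ := hL.1 B (hmem B hB).1
      rcases hL.nested (hmem C hC).1 (hmem _ hB').1 (h1 hb) (Finset.mem_insert_of_mem hb) with h | h
      · exact h1.antisymm fun z hz => by
          rcases Finset.mem_insert.1 (h hz) with rfl | h'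
          · exact absurd hz hxC
          · exact h'
      · exact absurd (h (Finset.mem_insert_self x B)) hxC
    have hunique' : ∀ B ∈ L₀, ∀ C ∈ L₀, x ∉ B → x ∉ C → insert x B ∈ L₀ → insert x C ∈ L₀ →
        B = C := by
      intro B hB C hC hxB hxC hB' hC'
      rcases hL.nested (hmem _ hB').1 (hmem _ hC').1 (Finset.mem_insert_self x B)
        (Finset.mem_insert_self x C) with h | h
      · exact hunique B hB C hC hxB hxC hB' hC' h
      · exact (hunique C hC B hB hxC hxB hC' hB' h).symm
    have hpair : ∀ A ∈ L₀, ∀ B ∈ L₀, A.erase x = B.erase x → A ≠ B → x ∈ A →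
        x ∉ B ∧ insert x B = A := by
      intro A hA B hB hAB hne hxA
      have hxB : x ∉ B := fun hxB => hne (by
        rw [← Finset.insert_erase hxA, hAB, Finset.insert_erase hxB])
      exact ⟨hxB, by rw [← Finset.erase_eq_of_notMem hxB, ← hAB, Finset.insert_erase hxA]⟩
    have hpair' : ∀ A ∈ L₀, ∀ B ∈ L₀, A.erase x = B.erase x → A ≠ B → x ∈ A ∨ x ∈ B := by
      intro A hA B hB hAB hne
      by_contra! h
      exact hne (by rw [← Finset.erase_eq_of_notMem h.1, hAB, Finset.erase_eq_of_notMem h.2])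
    have hL₀card : L₀.card ≤ (L₀.image fun X => X.erase x).card + 1 := by
      by_cases hex : ∃ A ∈ L₀, ∃ B ∈ L₀, A.erase x = B.erase x ∧ A ≠ B ∧ x ∈ A
      · obtain ⟨A, hA, B, hB, hAB, hne, hxA⟩ := hex
        obtain ⟨hxB, hBA⟩ := hpair A hA B hB hAB hne hxA
        -- The pair {B, B ∪ {x}} is unique, so once its larger member A is dropped, deleting x is
        -- injective.
        have hno : ∀ C ∈ L₀.erase A, ∀ E ∈ L₀.erase A, C.erase x = E.erase x → x ∈ C → C = E := by
          intro C hC E hE hCE hxC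
          by_contra hne'
          obtain ⟨hC1, hC2⟩ := Finset.mem_erase.1 hC
          obtain ⟨hE1, hE2⟩ := Finset.mem_erase.1 hE
          obtain ⟨hxE, hEC⟩ := hpair C hC2 E hE2 hCE hne' hxC
          have := hunique' B hB E hE2 hxB hxE (hBA ▸ hA) (hEC ▸ hC2)
          exact hC1 (by rw [← hEC, ← this, hBA])
        have hinj : Set.InjOn (fun X : Finset V => X.erase x) (L₀.erase A : Finset (Finset V)) := by
          intro C hC E hE hCE
          by_contra hne'
          rcases hpair' C (Finset.mem_of_mem_erase hC) E (Finset.mem_of_mem_erase hE) hCE hne' with h | h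
          · exact hne' (hno C hC E hE hCE h)
          · exact hne' (hno E hE C hC hCE.symm h).symm
        have h1 := Finset.card_image_of_injOn hinj
        have h2 := Finset.card_le_card (Finset.image_subset_image (f := fun X : Finset V => X.erase x)
          (Finset.erase_subset A L₀))
        have h3 := Finset.card_erase_add_one hA
        omega
      · push Not at hex
        have hinj : Set.InjOn (fun X : Finset V => X.erase x) (L₀ : Set (Finset V)) := by
          intro C hC E hE hCE
          by_contra hne'
          rcases hpair' C hC E hE hCE hne' with h | h
          · exact hex C hC E hE hCE hne' h
          · exact hex E hE C hC hCE.symm (Ne.symm hne') h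
        rw [Finset.card_image_of_injOn hinj]
        omega
    have : L.card - 1 ≤ L₀.card := Finset.pred_card_le_card_erase
    rw [Finset.card_insert_of_notMem hxU]
    omega

namespace MultiDigraph

variable {V A : Type*}

/-! ### Tight arborescences in connected families -/

/-- When every node of each child is a root, every arc inside F is a move for `H = ∅`. So the
predecessors of any node form a closed set, which must contain v. -/
theorem mem_reaching_of_forall {E : MultiDigraph V A} {L : Finset (Finset V)} {F : Finset V} {v : V}
    (hch : ∀ G, IsChild L F G → ∀ z ∈ G, z ∈ E.roots L ∅ G) (hv : v ∈ F)
    (h : ∀ X ⊆ F, X.Nonempty → (∀ e, E.head e ∈ X → E.tail e ∈ F → E.tail e ∈ X) → v ∈ X) :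
    v ∈ E.roots L ∅ F := by
  classical
  rw [roots_eq]
  refine ⟨⟨hv, fun y hy => ?_⟩, fun G hG hvG => hch G hG v hvG⟩
  have := h (F.filter fun x => ReflTransGen (E.Move L ∅ F) x y) (Finset.filter_subset _ _)
    ⟨y, by simp [hy, ReflTransGen.refl]⟩ (fun e he ht => by
      rw [Finset.mem_filter] at he ⊢
      exact ⟨ht, .head ⟨ht, he.1, .inr ⟨e, by simp, rfl, rfl, fun G hG hz _ => hch G hG _ hz⟩⟩ he.2⟩)
  exact (Finset.mem_filter.1 this).2

theorem mem_roots_of_conn {E : MultiDigraph V A} {L : Finset (Finset V)} {L₀ : Finset (Finset V)}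
    (hL₀ : ∀ F ∈ L₀, ∀ G ∈ L, G ⊂ F → G ∈ L₀)
    (h : ∀ F ∈ L₀, ∀ X ⊆ F, X.Nonempty → (∀ e, E.head e ∈ X → E.tail e ∈ F → E.tail e ∈ X) → X = F) :
    ∀ N, ∀ F ∈ L₀, F.card < N → ∀ v ∈ F, v ∈ E.roots L ∅ F
  | 0, _, _, hN, _, _ => absurd hN (Nat.not_lt_zero _)
  | N + 1, F, hF, hN, v, hv => by
    refine mem_reaching_of_forall (fun G hG z hz => ?_) hv fun X hX hne hcl => ?_
    · exact mem_roots_of_conn hL₀ h N G (hL₀ F hF G hG.1 hG.2.1)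
        (by have := Finset.card_lt_card hG.2.1; omega) z hz
    · rw [h F hF X hX hne hcl]
      exact hv

/-- Turn the arcs in `P` into loops. -/
def looped (D : MultiDigraph V A) (P : A → Prop) [DecidablePred P] : MultiDigraph V A where
  tail e := if P e then D.head e else D.tail e
  head := D.head

theorem looped_enters {D : MultiDigraph V A} {P : A → Prop} [DecidablePred P] {e : A} {Z : Finset V} :
    (D.looped P).Enters e Z ↔ ¬ P e ∧ D.Enters e Z := by
  simp only [Enters, looped]
  split_ifs with h <;> simp [h]

/-- A loop is a cycle, so making the arcs of P loops amounts to deleting them, while the indexing of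
the arcs and their number stay the same. -/
theorem looped_isArborescence_iff [DecidableEq V] {D : MultiDigraph V A} {P : A → Prop} [DecidablePred P]
    {r : V} {B : Finset A} :
    (D.looped P).IsArborescence r B ↔ D.IsArborescence r B ∧ ∀ e ∈ B, ¬ P e := by
  constructor
  · intro h
    have hP : ∀ e ∈ B, ¬ P e := by
      intro e he hPe
      refine h.2.2 (D.head e) (.single ⟨e, he, ?_, rfl⟩)
      simp [looped, hPe]
    refine ⟨⟨h.1, h.2.1, fun v hv => h.2.2 v ?_⟩, hP⟩
    refine TransGen.mono ?_ _ _ hv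
    rintro x y ⟨a, ha, h1, h2⟩
    exact ⟨a, ha, by simp [looped, hP a ha, h1], h2⟩
  · rintro ⟨h, hP⟩
    refine ⟨h.1, h.2.1, fun v hv => h.2.2 v ?_⟩
    refine TransGen.mono ?_ _ _ hv
    rintro x y ⟨a, ha, h1, h2⟩
    exact ⟨a, ha, by simpa [looped, hP a ha] using h1, h2⟩

/-! ### Reduced costs -/

/-- The costs `c` are decomposed into a constant, the reduced costs `rc ≥ 0` and positive multiples
of the characteristic vectors of the arcs entering the members of a laminar family; the members are
strongly connected by arcs of reduced cost zero. -/
structure Dual [DecidableEq V] (D : MultiDigraph V A) (r : V) (c : A → ℝ) (k : ℕ) (S : ℕ → Finset V)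
    (rc : A → ℝ) : Prop where
  cost : ∃ (c₀ : ℝ) (y : ℕ → ℝ), (∀ i < k, 0 < y i) ∧
    ∀ e, c e = c₀ + rc e + ∑ i ∈ Finset.range k, if D.Enters e (S i) then y i else 0
  nonneg : ∀ e, 0 ≤ rc e
  root : ∀ i < k, r ∉ S i
  nonempty : ∀ i < k, (S i).Nonempty
  laminar : ∀ i < k, ∀ j < k, S i ⊆ S j ∨ S j ⊆ S i ∨ Disjoint (S i) (S j)
  conn : ∀ i < k, ∀ X ⊆ S i, X.Nonempty →
    (∀ e, rc e ≤ 0 → D.head e ∈ X → D.tail e ∈ S i → D.tail e ∈ X) → X = S i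
  enter : ∀ i < k, ∃ e, rc e ≤ 0 ∧ D.Enters e (S i)
  inj : ∀ i < k, ∀ j < k, S i = S j → i = j

variable [DecidableEq V] {D : MultiDigraph V A} {r : V} {c : A → ℝ} {k : ℕ} {S : ℕ → Finset V}
  {rc : A → ℝ}

/-- The family together with the set of all nodes. -/
def fullFamily [Fintype V] (k : ℕ) (S : ℕ → Finset V) : Finset (Finset V) :=
  insert Finset.univ ((Finset.range k).image S)

theorem mem_fullFamily [Fintype V] {F : Finset V} :
    F ∈ fullFamily k S ↔ F = Finset.univ ∨ ∃ i < k, S i = F := by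
  simp [fullFamily]

theorem Dual.isLaminar (h : Dual D r c k S rc) : IsLaminar ((Finset.range k).image S) := by
  constructor
  · intro X hX
    simp only [Finset.mem_image, Finset.mem_range] at hX
    obtain ⟨i, hi, rfl⟩ := hX
    exact h.nonempty i hi
  · intro X hX Y hY
    simp only [Finset.mem_image, Finset.mem_range] at hX hY
    obtain ⟨i, hi, rfl⟩ := hX
    obtain ⟨j, hj, rfl⟩ := hY
    exact h.laminar i hi j hj

theorem Dual.isLaminar_fullFamily [Fintype V] (h : Dual D r c k S rc) :
    IsLaminar (fullFamily k S) := by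
  constructor
  · intro X hX
    rcases mem_fullFamily.1 hX with rfl | ⟨i, hi, rfl⟩
    · exact ⟨r, Finset.mem_univ r⟩
    · exact h.nonempty i hi
  · intro X hX Y hY
    rcases mem_fullFamily.1 hX with rfl | ⟨i, hi, rfl⟩
    · exact .inr (.inl (Finset.subset_univ _))
    · rcases mem_fullFamily.1 hY with rfl | ⟨j, hj, rfl⟩
      · exact .inl (Finset.subset_univ _)
      · exact h.laminar i hi j hj

/-- The members avoid r, so the ground set of the laminar family has only n - 1 nodes. -/
theorem Dual.card_le [Fintype V] (h : Dual D r c k S rc) : k + 2 ≤ 2 * Fintype.card V := by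
  have h1 := h.isLaminar.card_le (Finset.univ.erase r) (by
    intro X hX
    simp only [Finset.mem_image, Finset.mem_range] at hX
    obtain ⟨i, hi, rfl⟩ := hX
    intro x hx
    exact Finset.mem_erase.2 ⟨fun h' => h.root i hi (h' ▸ hx), Finset.mem_univ x⟩)
  rw [Finset.card_image_of_injOn (fun i hi j hj hij => h.inj i (by simpa using hi) j (by simpa using hj)
    hij), Finset.card_range, Finset.card_erase_of_mem (Finset.mem_univ r), Finset.card_univ] at h1
  have := Fintype.card_pos_iff.2 ⟨r⟩
  omega

/-- The machinery of roots is reused with `H = ∅`: strong connectivity makes every node of a member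
a root, and r is a root of the whole set because it lies in every closed set. -/
theorem Dual.exists_tight [Fintype V] (h : Dual D r c k S rc) [DecidablePred fun e => D.head e = r ∨ 0 < rc e]
    (hr : ∀ X : Finset V, X.Nonempty → (∀ e, rc e ≤ 0 → D.head e ∈ X → D.tail e ∈ X) → r ∈ X) :
    ∃ B, (D.looped fun e => D.head e = r ∨ 0 < rc e).IsTightArborescence (fullFamily k S) r B := by
  set E := D.looped fun e => D.head e = r ∨ 0 < rc e with hE
  have hzero : ∀ X : Finset V, ∀ e, ¬ (D.head e = r ∨ 0 < rc e) → (E.tail e ∈ X ↔ D.tail e ∈ X) := by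
    intro X e he
    simp [hE, looped, he]
  have hroots : ∀ F ∈ (Finset.range k).image S, ∀ v ∈ F, v ∈ E.roots (fullFamily k S) ∅ F := by
    intro F hF
    refine mem_roots_of_conn (L₀ := (Finset.range k).image S) ?_ ?_ _ F hF (Nat.lt_succ_self _)
    · intro F hF G hG hGF
      rcases mem_fullFamily.1 hG with rfl | ⟨i, hi, rfl⟩
      · exact absurd (Finset.subset_univ F) hGF.2
      · exact Finset.mem_image_of_mem _ (Finset.mem_range.2 hi)
    · intro F hF X hX hne hcl
      simp only [Finset.mem_image, Finset.mem_range] at hF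
      obtain ⟨i, hi, rfl⟩ := hF
      refine h.conn i hi X hX hne fun e he h1 h2 => ?_
      have hb : ¬ (D.head e = r ∨ 0 < rc e) := by
        rintro (h' | h')
        · exact h.root i hi (h' ▸ hX h1)
        · exact absurd he (not_le.2 h')
      exact (hzero X e hb).1 (hcl e h1 ((hzero _ e hb).2 h2))
  have hrV : r ∈ E.roots (fullFamily k S) ∅ Finset.univ := by
    refine mem_reaching_of_forall (fun G hG z hz => ?_) (Finset.mem_univ r) fun X _ hne hcl => ?_
    · rcases mem_fullFamily.1 hG.1 with rfl | ⟨i, hi, rfl⟩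
      · exact absurd rfl hG.2.1.ne
      · exact hroots _ (Finset.mem_image_of_mem _ (Finset.mem_range.2 hi)) z hz
    · by_contra hrX
      refine hrX (hr X hne fun e he h1 => ?_)
      have hb : ¬ (D.head e = r ∨ 0 < rc e) := by
        rintro (h' | h')
        · exact hrX (h' ▸ h1)
        · exact absurd he (not_le.2 h')
      exact (hzero X e hb).1 (hcl e h1 (Finset.mem_univ _))
  classical
  obtain ⟨B, hB, -⟩ := exists_tight_of_mem_roots h.isLaminar_fullFamily
    (mem_fullFamily.2 (.inl rfl)) hrV
  exact ⟨B, hB⟩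

theorem IsArborescence.one_le_enters [Finite V] {B : Finset A} (hB : D.IsArborescence r B) {F : Finset V}
    (hF : F.Nonempty) (hr : r ∉ F) : 1 ≤ (B.filter fun a => D.Enters a F).card := by
  obtain ⟨v, hv⟩ := hF
  obtain ⟨a, ha, h1, -⟩ := exists_enters_of_reach (hB.reach v) hr hv
  exact Finset.card_pos.2 ⟨a, Finset.mem_filter.2 ⟨ha, h1⟩⟩

theorem Dual.sum_cost {c₀ : ℝ} {y : ℕ → ℝ}
    (hc : ∀ e, c e = c₀ + rc e + ∑ i ∈ Finset.range k, if D.Enters e (S i) then y i else 0)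
    (B : Finset A) : ∑ e ∈ B, c e = B.card * c₀ + ∑ e ∈ B, rc e +
      ∑ i ∈ Finset.range k, ((B.filter fun a => D.Enters a (S i)).card : ℝ) * y i := by
  rw [Finset.sum_congr rfl fun e _ => hc e, Finset.sum_add_distrib, Finset.sum_add_distrib,
    Finset.sum_const, nsmul_eq_mul, Finset.sum_comm]
  congr 1
  refine Finset.sum_congr rfl fun i _ => ?_
  rw [← Finset.sum_filter, Finset.sum_const, nsmul_eq_mul]

/-- Complementary slackness. Every arborescence has n - 1 arcs, so its cost is at least (n - 1)c₀ +
Σ yᵢ, with equality if and only if it has reduced cost zero and enters each set exactly once.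
`exists_tight` shows that the bound is attained. Making the arcs into r loops forces the root of a
tight arborescence to be r. If there is no r-arborescence, both sides are void. -/
theorem Dual.minCost_iff [Fintype V] (h : Dual D r c k S rc)
    [DecidablePred fun e => D.head e = r ∨ 0 < rc e]
    (hr : (∀ X : Finset V, X.Nonempty → (∀ e, rc e ≤ 0 → D.head e ∈ X → D.tail e ∈ X) → r ∈ X) ∨
      ∀ B, ¬ D.IsArborescence r B) (B : Finset A) :
    D.IsMinCostArborescence c r B ↔
      ∃ v, (D.looped fun e => D.head e = r ∨ 0 < rc e).IsTightArborescence (fullFamily k S) v B := by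
  set E := D.looped fun e => D.head e = r ∨ 0 < rc e with hE
  have hroot : ∀ {v B}, E.IsTightArborescence (fullFamily k S) v B →
      v = r ∧ D.IsArborescence r B ∧ ∀ e ∈ B, rc e ≤ 0 := by
    intro v B hB
    obtain ⟨h1, h2⟩ := looped_isArborescence_iff.1 hB.1
    have hvr : v = r := by
      by_contra hne
      obtain ⟨a, ha, har⟩ := h1.exists_arc (v := r) (fun h' => hne h'.symm)
      exact h2 a ha (.inl har)
    subst hvr
    exact ⟨rfl, h1, fun e he => not_lt.1 fun h' => h2 e he (.inr h')⟩
  rcases hr with hr | hr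
  swap
  · exact iff_of_false (fun hB => hr B hB.1) (fun ⟨v, hB⟩ => hr B (hroot hB).2.1)
  obtain ⟨c₀, y, hy, hc⟩ := h.cost
  have hcost := Dual.sum_cost hc
  have htight : ∀ {v B}, E.IsTightArborescence (fullFamily k S) v B →
      ∑ e ∈ B, c e = B.card * c₀ + ∑ i ∈ Finset.range k, y i := by
    intro v B hB
    obtain ⟨rfl, h1, h2⟩ := hroot hB
    rw [hcost, Finset.sum_eq_zero (fun e he => le_antisymm (h2 e he) (h.nonneg e)), add_zero]
    congr 1
    refine Finset.sum_congr rfl fun i hi => ?_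
    rw [Finset.mem_range] at hi
    have h3 := hB.2.1 (S i) (mem_fullFamily.2 (.inr ⟨i, hi, rfl⟩))
    have h4 := hB.1.one_le_enters (h.nonempty i hi) (h.root i hi)
    have h5 : (B.filter fun a => D.Enters a (S i)) = B.filter fun a => E.Enters a (S i) := by
      refine Finset.filter_congr fun e he => ?_
      rw [hE, looped_enters, iff_and_self]
      rintro - (h' | h')
      · exact h1.head_ne he h'
      · exact absurd (h2 e he) (not_le.2 h')
    rw [h5, le_antisymm h3 h4, Nat.cast_one, one_mul]
  have hlow : ∀ {B}, D.IsArborescence r B → ∀ i ∈ Finset.range k,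
      y i ≤ ((B.filter fun a => D.Enters a (S i)).card : ℝ) * y i := by
    intro B hB i hi
    rw [Finset.mem_range] at hi
    have := hB.one_le_enters (h.nonempty i hi) (h.root i hi)
    exact le_mul_of_one_le_left (hy i hi).le (by exact_mod_cast this)
  constructor
  · rintro ⟨hB, hmin⟩
    obtain ⟨B', hB'⟩ := h.exists_tight hr
    have h1 := hmin B' (hroot hB').2.1
    rw [htight hB', hcost] at h1
    have hcard : B.card = B'.card := by
      have h2 := hB.card_add_one
      have h3 := (hroot hB').2.1.card_add_one
      omega
    rw [hcard] at h1
    have h2 := Finset.sum_le_sum (hlow hB)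
    have h3 : 0 ≤ ∑ e ∈ B, rc e := Finset.sum_nonneg fun e _ => h.nonneg e
    have h4 : ∀ e ∈ B, rc e = 0 :=
      (Finset.sum_eq_zero_iff_of_nonneg fun e _ => h.nonneg e).1 (by linarith)
    have h5 := (Finset.sum_eq_sum_iff_of_le (hlow hB)).1 (by linarith)
    have h6 : ∀ e ∈ B, ¬ (D.head e = r ∨ 0 < rc e) := by
      rintro e he (h' | h')
      · exact hB.head_ne he h'
      · exact h'.ne' (h4 e he)
    have h7 : ∀ i < k, (B.filter fun a => E.Enters a (S i)).card ≤ 1 := by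
      intro i hi
      have h8 := h5 i (Finset.mem_range.2 hi)
      -- The multipliers are strictly positive; with a zero multiplier, optimality would not limit
      -- the number of entering arcs.
      have h9 : ((B.filter fun a => D.Enters a (S i)).card : ℝ) = 1 := by
        have := hy i hi
        field_simp at h8
        linarith
      refine (Finset.card_le_card fun e he => ?_).trans (Nat.cast_le_one.1 h9.le)
      rw [Finset.mem_filter] at he ⊢
      exact ⟨he.1, (looped_enters.1 he.2).2⟩
    have h8 : (B.filter fun a => E.Enters a Finset.univ).card = 0 := by
      simp [Enters]
    refine ⟨r, looped_isArborescence_iff.2 ⟨hB, h6⟩, fun F hF => ?_, fun F hF hrF => ?_⟩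
    · rcases mem_fullFamily.1 hF with rfl | ⟨i, hi, rfl⟩
      · omega
      · exact h7 i hi
    · rcases mem_fullFamily.1 hF with rfl | ⟨i, hi, rfl⟩
      · exact h8
      · exact absurd hrF (h.root i hi)
  · rintro ⟨v, hB⟩
    refine ⟨(hroot hB).2.1, fun B' hB' => ?_⟩
    rw [htight hB, hcost B']
    have hcard : B.card = B'.card := by
      have h2 := hB'.card_add_one
      have h3 := (hroot hB).2.1.card_add_one
      omega
    have h2 := Finset.sum_le_sum (hlow hB')
    have h3 : 0 ≤ ∑ e ∈ B', rc e := Finset.sum_nonneg fun e _ => h.nonneg e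
    rw [hcard]
    linarith

end MultiDigraph

end CoverArb

/-! ### The running time and correctness for tight arborescences combined -/

namespace CoverArb

variable {n m k : ℕ}

theorem tightInput_spec (D : MultiDigraph (Fin n) (Fin m)) (S : Fin k → Finset (Fin n))
    (w : Fin m → ℝ≥0) : TightInput D S w (tightInput D S w) := by
  constructor <;> simp [tightInput, scalar, column, incidence, HasTails]

theorem tight_algorithm : ∃ P : Prog, ∀ K : ℕ, ∃ C : ℕ, ∀ T, IsCutTime K T → ∀ O, IsMinCutOracle O →
      ∀ (n m k : ℕ) (D : MultiDigraph (Fin n) (Fin m)) (S : Fin k → Finset (Fin n))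
        (w : Fin m → ℝ≥0),
        Function.Injective S → IsLaminar (Finset.univ.image S) →
        Finset.univ ∈ Finset.univ.image S →
        (P.run O T (tightInput D S w)).2 ≤ C * n ^ 3 * T n m ∧
        ((∃ H, D.CoversTight (Finset.univ.image S) H) →
          IsMinWeight (D.CoversTight (Finset.univ.image S)) w
            (outputArcs m (P.run O T (tightInput D S w)).1)) := by
  obtain ⟨A, hA⟩ := tightProg_steps
  refine ⟨tightProg, fun K => ⟨A * (K + 1), fun T hT O hO n m k D S w hinj hL hV => ⟨?_, fun hex => ?_⟩⟩⟩
  · have hin := tightInput_spec D S w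
    have hk := hL.card_le Finset.univ fun X _ => Finset.subset_univ X
    rw [Finset.card_image_of_injective _ hinj, Finset.card_univ, Finset.card_univ, Fintype.card_fin,
      Fintype.card_fin] at hk
    obtain ⟨v, -⟩ := hL.1 _ hV
    refine (hA K T hT O n m _ v.pos hin.nodes hin.arcs (by rw [hin.sets]; exact hk)).trans_eq ?_
    ring
  · rw [Prog.run_fst]
    exact tightProg_spec hO hinj hL hV (tightInput_spec D S w) hex

end CoverArb

namespace CoverArb

namespace MultiDigraph

variable {V A : Type*}

/-! ### Sets closed under predecessors -/

/-- No arc of reduced cost zero enters `X`. -/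
def PredClosed (D : MultiDigraph V A) (rc : A → ℝ) (X : Finset V) : Prop :=
  ∀ e, rc e ≤ 0 → D.head e ∈ X → D.tail e ∈ X

/-- `R` is the set of nodes from which `v` can be reached by arcs of reduced cost zero. -/
structure IsHull (D : MultiDigraph V A) (rc : A → ℝ) (v : V) (R : Finset V) : Prop where
  mem : v ∈ R
  closed : D.PredClosed rc R
  least : ∀ X : Finset V, D.PredClosed rc X → v ∈ X → R ⊆ X

variable [DecidableEq V] {D : MultiDigraph V A} {r : V} {c : A → ℝ} {k : ℕ} {S : ℕ → Finset V}
  {rc : A → ℝ}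

/-- A constant may be taken from all costs, since all arborescences have the same number of arcs;
this reduces arbitrary real costs to non-negative ones. -/
theorem Dual.init (D : MultiDigraph V A) (r : V) {c : A → ℝ} (S : ℕ → Finset V) {c₀ : ℝ}
    (h : ∀ e, c₀ ≤ c e) : Dual D r c 0 S fun e => c e - c₀ := by
  refine ⟨⟨c₀, 0, by simp, by simp⟩, fun e => sub_nonneg.2 (h e), ?_, ?_, ?_, ?_, ?_, ?_⟩ <;> simp

/-- A smallest hull avoiding r is strongly connected by zero-cost arcs, and all arcs entering it
have positive cost. Its multiplier is the least of these costs, which makes some entering arc cost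
zero. Zero-cost arcs are unaffected, so the old sets keep their connectivity. -/
theorem Dual.step (h : Dual D r c k S rc) {R : V → Finset V} (hR : ∀ v, D.IsHull rc v (R v)) {v : V}
    (hv : r ∉ R v) (hmin : ∀ u, r ∉ R u → (R v).card ≤ (R u).card) {δ : ℝ}
    (hδ : ∃ e, D.Enters e (R v) ∧ rc e = δ) (hδmin : ∀ e, D.Enters e (R v) → δ ≤ rc e) :
    Dual D r c (k + 1) (Function.update S k (R v))
      (fun e => if D.Enters e (R v) then rc e - δ else rc e) := by
  have hpos : ∀ e, D.Enters e (R v) → 0 < rc e := by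
    intro e he
    by_contra h0
    exact he.1 ((hR v).closed e (not_lt.1 h0) he.2)
  have hold : ∀ i < k, Function.update S k (R v) i = S i := fun i hi =>
    Function.update_of_ne (by omega) _ _
  have hnew : Function.update S k (R v) k = R v := Function.update_self _ _ _
  have hzero : ∀ e, rc e ≤ 0 → (if D.Enters e (R v) then rc e - δ else rc e) ≤ 0 := by
    intro e he
    rw [if_neg fun h' => absurd he (not_le.2 (hpos e h'))]
    exact he
  have cases : ∀ i < k + 1, i < k ∨ i = k := by omega
  have hnest : ∀ i < k, S i ⊆ R v ∨ Disjoint (S i) (R v) := by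
    intro i hi
    by_cases hd : Disjoint (S i) (R v)
    · exact .inr hd
    · left
      -- A hull is closed under predecessors, so a strongly connected set that meets it is contained
      -- in it; this gives laminarity.
      have := h.conn i hi (S i ∩ R v) Finset.inter_subset_left
        (Finset.not_disjoint_iff_nonempty_inter.1 hd) (fun e he h1 h2 =>
          Finset.mem_inter.2 ⟨h2, (hR v).closed e he (Finset.mem_inter.1 h1).2⟩)
      exact Finset.inter_eq_left.1 this
  -- An old set is entered by an arc of cost zero, the hull is not.
  have hne : ∀ i < k, S i ≠ R v := by
    intro i hi heq
    obtain ⟨e, he, h1⟩ := h.enter i hi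
    exact absurd he (not_le.2 (hpos e (heq ▸ h1)))
  constructor
  · obtain ⟨c₀, y, hy, hc⟩ := h.cost
    refine ⟨c₀, Function.update y k δ, fun i hi => ?_, fun e => ?_⟩
    · rcases cases i hi with hi | rfl
      · rw [Function.update_of_ne (by omega)]
        exact hy i hi
      · rw [Function.update_self]
        obtain ⟨e, he, rfl⟩ := hδ
        exact hpos e he
    · rw [Finset.sum_range_succ, hnew, Function.update_self, hc e]
      have : ∀ i ∈ Finset.range k, (if D.Enters e (Function.update S k (R v) i) then
          Function.update y k δ i else 0) = if D.Enters e (S i) then y i else 0 := by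
        intro i hi
        rw [Finset.mem_range] at hi
        rw [hold i hi, Function.update_of_ne (by omega)]
      rw [Finset.sum_congr rfl this]
      split_ifs <;> ring
  · intro e
    split_ifs with he
    · exact sub_nonneg.2 (hδmin e he)
    · exact h.nonneg e
  · intro i hi
    rcases cases i hi with hi | rfl
    · rw [hold i hi]
      exact h.root i hi
    · rwa [hnew]
  · intro i hi
    rcases cases i hi with hi | rfl
    · rw [hold i hi]
      exact h.nonempty i hi
    · rw [hnew]
      exact ⟨v, (hR v).mem⟩
  · intro i hi j hj
    rcases cases i hi with hi | rfl
    · rcases cases j hj with hj | rfl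
      · rw [hold i hi, hold j hj]
        exact h.laminar i hi j hj
      · rw [hold i hi, hnew]
        rcases hnest i hi with h' | h'
        · exact .inl h'
        · exact .inr (.inr h')
    · rcases cases j hj with hj | rfl
      · rw [hold j hj, hnew]
        rcases hnest j hj with h' | h'
        · exact .inr (.inl h')
        · exact .inr (.inr h'.symm)
      · exact .inl subset_rfl
  · intro i hi X
    rcases cases i hi with hi | rfl
    · rw [hold i hi]
      exact fun hX hne' hcl => h.conn i hi X hX hne' fun e he => hcl e (hzero e he)
    · rw [hnew]
      rintro hX ⟨u, hu⟩ hcl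
      -- A subset closed inside the hull is closed altogether, so it contains the hull of each of
      -- its nodes. By minimality that hull is as large as `R v`.
      have hXcl : D.PredClosed rc X := fun e he h1 =>
        hcl e (hzero e he) h1 ((hR v).closed e he (hX h1))
      have hsub := (hR u).least X hXcl hu
      have := hmin u fun h' => hv (hX (hsub h'))
      exact hX.antisymm ((Finset.eq_of_subset_of_card_le (hsub.trans hX) this) ▸ hsub)
  · intro i hi
    rcases cases i hi with hi | rfl
    · rw [hold i hi]
      obtain ⟨e, he, h1⟩ := h.enter i hi
      exact ⟨e, hzero e he, h1⟩
    · rw [hnew]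
      obtain ⟨e, he, rfl⟩ := hδ
      exact ⟨e, by simp [he], he⟩
  · intro i hi j hj hij
    rcases cases i hi with hi | rfl
    · rcases cases j hj with hj | rfl
      · rw [hold i hi, hold j hj] at hij
        exact h.inj i hi j hj hij
      · rw [hold i hi, hnew] at hij
        exact absurd hij (hne i hi)
    · rcases cases j hj with hj | rfl
      · rw [hold j hj, hnew] at hij
        exact absurd hij.symm (hne j hj)
      · rfl

end MultiDigraph

variable {n m : ℕ} {D : MultiDigraph (Fin n) (Fin m)} {r : Fin n} {w : Fin m → ℝ≥0} {rc : Fin m → ℝ}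
  {O : Network → Finset ℕ} {σ : Mem}

/-! ### The program for minimum cost arborescences -/

/-- The digraph, the root, the weights and the reduced costs. -/
structure CostBase (D : MultiDigraph (Fin n) (Fin m)) (r : Fin n) (w : Fin m → ℝ≥0)
    (rc : Fin m → ℝ) (σ : Mem) : Prop where
  nodes : σ.nat 0 0 0 = n
  arcs : σ.nat 1 0 0 = m
  tail : ∀ e : Fin m, σ.nat 3 e 0 = D.tail e
  head : ∀ e : Fin m, σ.nat 4 e 0 = D.head e
  root : σ.nat 30 0 0 = r
  weights : ∀ e : Fin m, σ.real 0 e 0 = w e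
  costs : ∀ e : Fin m, σ.real 1 e 0 = rc e

theorem CostBase.of_frame {τ : Mem} {p : Prog} (h : CostBase D r w rc σ) (hf : Frame p σ τ)
    (h1 : [0, 1, 3, 4, 30].all (fun y => !p.writesNat y) = true)
    (h2 : [0, 1].all (fun y => !p.writesReal y) = true) : CostBase D r w rc τ := by
  simp only [List.all_cons, List.all_nil, Bool.and_true, Bool.and_eq_true, Bool.not_eq_true'] at h1 h2
  obtain ⟨a0, a1, a3, a4, a30⟩ := h1
  obtain ⟨b0, b1⟩ := h2
  constructor
  · rw [hf.1 0 a0, h.nodes]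
  · rw [hf.1 1 a1, h.arcs]
  · rw [hf.1 3 a3]
    exact h.tail
  · rw [hf.1 4 a4]
    exact h.head
  · rw [hf.1 30 a30, h.root]
  · rw [hf.2 0 b0]
    exact h.weights
  · rw [hf.2 1 b1]
    exact h.costs

theorem CostBase.setNat (h : CostBase D r w rc σ) {y : ℕ} (i j v : ℕ)
    (hy : [0, 1, 3, 4, 30].all (fun z => !(z == y)) = true) :
    CostBase D r w rc (σ.setNat y i j v) :=
  h.of_frame (p := .setNat y (.lit i) (.lit j) (.lit v)) (Prog.frame (fun _ => ∅) _ σ) hy rfl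

/-- The sets `R v` are the rows of the array `31`. -/
def HasReach (R : Fin n → Finset (Fin n)) (σ : Mem) : Prop :=
  ∀ v u : Fin n, σ.nat 31 v u = if u ∈ R v then 1 else 0

/-- Start with the sets `{v}`. -/
def reachInit : Prog :=
  .loop 7 (.var 0) <|
    .seq (.loop 9 (.var 0) (.setNat 31 (.var 7) (.var 9) (.lit 0)))
      (.setNat 31 (.var 7) (.var 7) (.lit 1))

theorem reachInit_spec (hn : σ.nat 0 0 0 = n) :
    HasReach (fun v : Fin n => {v}) (reachInit.exec O σ) := by
  have := Prog.exec_loop (O := O) (x := 7) (e := .var 0) (N := n) (σ := σ)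
    (p := .seq (.loop 9 (.var 0) (.setNat 31 (.var 7) (.var 9) (.lit 0)))
      (.setNat 31 (.var 7) (.var 7) (.lit 1))) hn
    (fun i τ => ∀ v < i, ∀ u < n, τ.nat 31 v u = if u = v then 1 else 0) (by simp)
    (fun i τ hi hf hI => ?_)
  · intro v u
    refine (this v v.2 u u.2).trans ?_
    simp [Fin.ext_iff]
  · have h0 : τ.nat 0 0 0 = n := by rw [hf.1 0 rfl, hn]
    rw [Prog.exec_seq]
    have inner := Prog.exec_loop (O := O) (x := 9) (e := .var 0) (N := n) (σ := τ.setNat 7 0 0 i)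
      (p := .setNat 31 (.var 7) (.var 9) (.lit 0)) (by simpa using h0)
      (fun j υ => (∀ v < i, ∀ u, υ.nat 31 v u = τ.nat 31 v u) ∧ ∀ u < j, υ.nat 31 i u = 0)
      (by simp) (fun j υ hj hg hJ => ?_)
    · have h7 := (Prog.loop 9 (.var 0) (.setNat 31 (.var 7) (.var 9) (.lit 0))).frame O
        (τ.setNat 7 0 0 i)
      set υ := (Prog.loop 9 (.var 0) (.setNat 31 (.var 7) (.var 9) (.lit 0))).exec O
        (τ.setNat 7 0 0 i)
      have h7' : υ.nat 7 0 0 = i := by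
        rw [h7.1 7 rfl]
        simp
      intro v hv u hu
      simp only [Prog.exec_setNat, NExpr.eval, h7', Mem.setNat_nat, true_and]
      by_cases hvi : v = i
      · subst hvi
        simp [inner.2 u hu]
      · simp [hvi, inner.1 v (by omega) u, hI v (by omega) u hu]
    · have h7 : υ.nat 7 0 0 = i := by
        rw [hg.1 7 rfl]
        simp
      refine ⟨fun v hv u => ?_, fun u hu => ?_⟩
      · have : v ≠ i := by omega
        simp [h7, this, hJ.1 v hv u]
      · by_cases huj : u = j
        · simp [h7, huj]
        · simp [h7, huj, hJ.2 u (by omega)]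

/-- The arc in the scalar `18` has reduced cost zero. -/
def zeroArc : BExpr := .rle (.col 1 (.var 18)) .zero

/-- Extend the sets along the arc in the scalar `18`. -/
def reachBody : Prog :=
  .ite zeroArc
    (.loop 7 (.var 0) <|
      .ite (.nle (.lit 1) (.get 31 (.var 7) (.col 4 (.var 18))))
        (.setNat 31 (.var 7) (.col 3 (.var 18)) (.lit 1)) .skip)
    .skip

theorem reachBody_spec (hb : CostBase D r w rc σ) {R : Fin n → Finset (Fin n)} (hR : HasReach R σ)
    {e : Fin m} (he : σ.nat 18 0 0 = e) :
    HasReach (fun v => if rc e ≤ 0 ∧ D.head e ∈ R v then insert (D.tail e) (R v) else R v)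
      (reachBody.exec O σ) := by
  have hiff : zeroArc.holds σ ↔ rc e ≤ 0 := by
    simp only [zeroArc, BExpr.holds, RExpr.eval, NExpr.eval, he, hb.costs]
  rw [reachBody]
  by_cases hz : rc e ≤ 0
  · rw [Prog.exec_ite_pos _ _ _ _ (hiff.2 hz)]
    have := Prog.exec_loop (O := O) (x := 7) (e := .var 0) (N := n) (σ := σ)
      (p := .ite (.nle (.lit 1) (.get 31 (.var 7) (.col 4 (.var 18))))
        (.setNat 31 (.var 7) (.col 3 (.var 18)) (.lit 1)) .skip) hb.nodes
      (fun i τ => HasReach (fun v => if (v : ℕ) < i ∧ D.head e ∈ R v then insert (D.tail e) (R v)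
        else R v) τ) (by simpa using hR) (fun i τ hi hf hI => ?_)
    · simpa [hz] using this
    · set τ₀ := τ.setNat 7 0 0 i with hτ₀
      have hb₀ : CostBase D r w rc τ₀ := (hb.of_frame hf rfl rfl).setNat _ _ _ rfl
      have h18 : τ₀.nat 18 0 0 = e := by
        rw [hτ₀, Mem.setNat_nat_of_ne _ _ _ _ (by decide), hf.1 18 rfl, he]
      have h7 : τ₀.nat 7 0 0 = i := by simp [hτ₀]
      have h31 : τ₀.nat 31 = τ.nat 31 := Mem.setNat_nat_of_ne _ _ _ _ (by decide)
      have h31' : τ₀.nat 31 i (D.head e) = if D.head e ∈ R ⟨i, hi⟩ then 1 else 0 := by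
        rw [h31]
        have := hI ⟨i, hi⟩ (D.head e)
        simpa using this
      have hiff' : (BExpr.nle (.lit 1) (.get 31 (.var 7) (.col 4 (.var 18)))).holds τ₀ ↔
          D.head e ∈ R ⟨i, hi⟩ := by
        simp only [BExpr.holds, NExpr.eval, h18, h7, hb₀.head, h31']
        split_ifs with h' <;> simp [h']
      have old : ∀ v : Fin n, (v : ℕ) ≠ i → ((v : ℕ) < i + 1 ↔ (v : ℕ) < i) := fun v hv => by omega
      by_cases hc : D.head e ∈ R ⟨i, hi⟩
      · rw [Prog.exec_ite_pos _ _ _ _ (hiff'.2 hc), Prog.exec_setNat]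
        intro v u
        simp only [NExpr.eval, h7, h18, hb₀.tail, Mem.setNat_nat, true_and, h31]
        by_cases hv : (v : ℕ) = i
        · obtain rfl : v = ⟨i, hi⟩ := Fin.ext hv
          rw [hI ⟨i, hi⟩ u]
          by_cases hu : u = D.tail e
          · simp [hu, hc]
          · have hu' : (u : ℕ) ≠ D.tail e := fun h' => hu (Fin.ext h')
            simp [hu, hu', hc]
        · simp only [hv, false_and, if_false, old v hv]
          exact hI v u
      · rw [Prog.exec_ite_neg _ _ _ _ (fun h => hc (hiff'.1 h)), Prog.exec_skip]
        intro v u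
        rw [h31, hI v u]
        by_cases hv : (v : ℕ) = i
        · obtain rfl : v = ⟨i, hi⟩ := Fin.ext hv
          simp [hc]
        · simp only [old v hv]
  · rw [Prog.exec_ite_neg _ _ _ _ (fun h => hz (hiff.1 h)), Prog.exec_skip]
    simpa [hz] using hR

/-- Extend the sets along all arcs. -/
def reachRound : Prog := .loop 18 (.var 1) reachBody

/-- Only bounds are claimed for the new sets, because a round already uses nodes added earlier in
the same round. -/
theorem reachRound_spec (hb : CostBase D r w rc σ) {R : Fin n → Finset (Fin n)} (hR : HasReach R σ) :
    ∃ R' : Fin n → Finset (Fin n), HasReach R' (reachRound.exec O σ) ∧ ∀ v, R v ⊆ R' v ∧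
      (∀ e, rc e ≤ 0 → D.head e ∈ R v → D.tail e ∈ R' v) ∧
      ∀ X, D.PredClosed rc X → R v ⊆ X → R' v ⊆ X := by
  have := Prog.exec_loop (O := O) (x := 18) (e := .var 1) (N := m) (σ := σ) (p := reachBody) hb.arcs
    (fun i τ => ∃ R' : Fin n → Finset (Fin n), HasReach R' τ ∧ ∀ v, R v ⊆ R' v ∧
      (∀ e : Fin m, (e : ℕ) < i → rc e ≤ 0 → D.head e ∈ R v → D.tail e ∈ R' v) ∧
      ∀ X, D.PredClosed rc X → R v ⊆ X → R' v ⊆ X)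
    ⟨R, hR, fun v => ⟨subset_rfl, by simp, fun _ _ h => h⟩⟩ (fun i τ hi hf hI => ?_)
  · obtain ⟨R', h1, h2⟩ := this
    exact ⟨R', h1, fun v => ⟨(h2 v).1, fun e => (h2 v).2.1 e e.2, (h2 v).2.2⟩⟩
  · obtain ⟨R', h1, h2⟩ := hI
    set e₀ : Fin m := ⟨i, hi⟩ with he₀
    have h3 := reachBody_spec (O := O) (σ := τ.setNat 18 0 0 i) (e := e₀)
      ((hb.of_frame hf rfl rfl).setNat _ _ _ rfl)
      (R := R') (fun v u => by rw [Mem.setNat_nat_of_ne _ _ _ _ (by decide), h1 v u]) (by simp [he₀])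
    refine ⟨_, h3, fun v => ?_⟩
    obtain ⟨a1, a2, a3⟩ := h2 v
    have hsub : R' v ⊆ if rc e₀ ≤ 0 ∧ D.head e₀ ∈ R' v then insert (D.tail e₀) (R' v) else R' v := by
      split_ifs
      · exact Finset.subset_insert _ _
      · exact subset_rfl
    refine ⟨a1.trans hsub, fun e he hz hh => ?_, fun X hX hRX => ?_⟩
    · by_cases hee : e = e₀
      · subst hee
        rw [if_pos ⟨hz, a1 hh⟩]
        exact Finset.mem_insert_self _ _
      · have : (e : ℕ) ≠ i := fun h => hee (Fin.ext h)
        exact hsub (a2 e (by omega) hz hh)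
    · have := a3 X hX hRX
      split_ifs with hc
      · exact Finset.insert_subset (hX e₀ hc.1 (this hc.2)) this
      · exact this

/-- The sets of nodes from which a node can be reached by arcs of reduced cost zero. -/
def reachProg : Prog := .seq reachInit (.loop 32 (.var 0) reachRound)

/-- Each round enlarges every set that is not yet closed. After i rounds a set is closed or has at
least i + 1 nodes, so n rounds suffice. -/
theorem reachProg_spec (hb : CostBase D r w rc σ) :
    ∃ R : Fin n → Finset (Fin n), HasReach R (reachProg.exec O σ) ∧ ∀ v, D.IsHull rc v (R v) := by
  have hb' : CostBase D r w rc (reachInit.exec O σ) := hb.of_frame (reachInit.frame O σ) rfl rfl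
  have hinit := reachInit_spec (O := O) hb.nodes
  have := Prog.exec_loop (O := O) (x := 32) (e := .var 0) (N := n) (σ := reachInit.exec O σ)
    (p := reachRound) hb'.nodes
    (fun i τ => ∃ R : Fin n → Finset (Fin n), HasReach R τ ∧ ∀ v, v ∈ R v ∧
      (∀ X, D.PredClosed rc X → v ∈ X → R v ⊆ X) ∧ (D.PredClosed rc (R v) ∨ i + 1 ≤ (R v).card))
    ⟨_, hinit, fun v => ⟨by simp, by simp, .inr (by simp)⟩⟩ (fun i τ hi hf hI => ?_)
  · obtain ⟨R, h1, h2⟩ := this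
    refine ⟨R, h1, fun v => ⟨(h2 v).1, (h2 v).2.2.resolve_right fun h => ?_, (h2 v).2.1⟩⟩
    have := Finset.card_le_univ (R v)
    rw [Fintype.card_fin] at this
    omega
  · obtain ⟨R, h1, h2⟩ := hI
    obtain ⟨R', h3, h4⟩ := reachRound_spec (O := O) (σ := τ.setNat 32 0 0 i)
      ((hb'.of_frame hf rfl rfl).setNat _ _ _ rfl)
      (R := R) (fun v u => by rw [Mem.setNat_nat_of_ne _ _ _ _ (by decide), h1 v u])
    refine ⟨R', h3, fun v => ?_⟩
    obtain ⟨a1, a2, a3⟩ := h2 v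
    obtain ⟨b1, b2, b3⟩ := h4 v
    refine ⟨b1 a1, fun X hX hv => b3 X hX (a2 X hX hv), ?_⟩
    by_cases heq : R' v = R v
    · left
      intro e he hh
      exact b2 e he (heq ▸ hh)
    · right
      rcases a3 with a3 | a3
      · exact absurd ((b3 _ a3 subset_rfl).antisymm b1) heq
      · have := Finset.card_lt_card (b1.ssubset_of_ne (Ne.symm heq))
        omega

end CoverArb

namespace CoverArb

variable {n m : ℕ} {D : MultiDigraph (Fin n) (Fin m)} {r : Fin n} {w : Fin m → ℝ≥0}
  {rc c : Fin m → ℝ} {O : Network → Finset ℕ} {σ : Mem} {F : Finset (Fin n)}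

/-! ### One step of the dual algorithm -/

/-- The arc in the scalar `18` enters the selected set. -/
def enterSel : BExpr :=
  .and (.nle (.get 31 (.var 12) (.col 3 (.var 18))) (.lit 0))
    (.nle (.lit 1) (.get 31 (.var 12) (.col 4 (.var 18))))

/-- The row of the array `31` given by the scalar `12` is `F`. -/
def SelRow (F : Finset (Fin n)) (σ : Mem) : Prop :=
  ∀ u : Fin n, σ.nat 31 (σ.nat 12 0 0) u = if u ∈ F then 1 else 0

theorem SelRow.congr {τ : Mem} (h : SelRow F σ) (h1 : τ.nat 31 = σ.nat 31) (h2 : τ.nat 12 = σ.nat 12) :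
    SelRow F τ := by
  unfold SelRow
  rw [h1, h2]
  exact h

theorem enterSel_holds (ht : ∀ e : Fin m, σ.nat 3 e 0 = D.tail e)
    (hh : ∀ e : Fin m, σ.nat 4 e 0 = D.head e) (hF : SelRow F σ) {e : Fin m}
    (he : σ.nat 18 0 0 = e) : enterSel.holds σ ↔ D.Enters e F := by
  simp only [enterSel, BExpr.holds, NExpr.eval, he, ht, hh, hF _, MultiDigraph.Enters]
  split_ifs with h1 h2 <;> simp [*]

/-- The minimum reduced cost of the arcs entering the selected set. -/
def findProg : Prog :=
  .seq (.setNat 33 (.lit 0) (.lit 0) (.lit 0)) <|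
  .loop 18 (.var 1) <|
    .ite (.and enterSel (.or (.nle (.var 33) (.lit 0)) (.rlt (.col 1 (.var 18)) (.var 3))))
      (.seq (.setReal 3 (.lit 0) (.lit 0) (.col 1 (.var 18)))
        (.setNat 33 (.lit 0) (.lit 0) (.lit 1))) .skip

/-- The flag in array 33 stands in for an infinite initial minimum; it is 0 as long as no entering
arc has been found. -/
theorem findProg_spec (hb : CostBase D r w rc σ) (hF : SelRow F σ) :
    let τ := findProg.exec O σ
    τ.nat 33 0 0 = 0 ∧ (∀ e, ¬ D.Enters e F) ∨
      τ.nat 33 0 0 = 1 ∧ (∃ e, D.Enters e F ∧ rc e = τ.real 3 0 0) ∧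
        ∀ e, D.Enters e F → τ.real 3 0 0 ≤ rc e := by
  intro τ
  set body : Prog := .ite (.and enterSel (.or (.nle (.var 33) (.lit 0)) (.rlt (.col 1 (.var 18)) (.var 3))))
      (.seq (.setReal 3 (.lit 0) (.lit 0) (.col 1 (.var 18)))
        (.setNat 33 (.lit 0) (.lit 0) (.lit 1))) .skip with hbody
  have hb' : CostBase D r w rc (σ.setNat 33 0 0 0) := hb.setNat _ _ _ rfl
  have := Prog.exec_loop (O := O) (x := 18) (e := .var 1) (N := m) (σ := σ.setNat 33 0 0 0) (p := body)
    hb'.arcs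
    (fun i τ => τ.nat 33 0 0 = 0 ∧ (∀ e : Fin m, (e : ℕ) < i → ¬ D.Enters e F) ∨
      τ.nat 33 0 0 = 1 ∧ (∃ e, D.Enters e F ∧ rc e = τ.real 3 0 0) ∧
        ∀ e : Fin m, (e : ℕ) < i → D.Enters e F → τ.real 3 0 0 ≤ rc e)
    (.inl (by simp)) (fun i τ hi hf hI => ?_)
  · rcases this with ⟨h1, h2⟩ | ⟨h1, h2, h3⟩
    · exact .inl ⟨h1, fun e => h2 e e.2⟩
    · exact .inr ⟨h1, h2, fun e => h3 e e.2⟩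
  · set e₀ : Fin m := ⟨i, hi⟩ with he₀
    set τ₀ := τ.setNat 18 0 0 i with hτ₀
    have hb₀ : CostBase D r w rc τ₀ := (hb'.of_frame hf rfl rfl).setNat _ _ _ rfl
    have hn : ∀ y, y ≠ 18 → τ₀.nat y = τ.nat y := fun y hy => Mem.setNat_nat_of_ne _ _ _ _ hy
    have hF₀ : SelRow F τ₀ := hF.congr
      (by rw [hn 31 (by decide), hf.1 31 rfl, Mem.setNat_nat_of_ne _ _ _ _ (by decide)])
      (by rw [hn 12 (by decide), hf.1 12 rfl, Mem.setNat_nat_of_ne _ _ _ _ (by decide)])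
    have h18 : τ₀.nat 18 0 0 = e₀ := by simp [hτ₀, he₀]
    have h33 : τ₀.nat 33 = τ.nat 33 := hn 33 (by decide)
    have hr : τ₀.real = τ.real := rfl
    have hc1 := hb₀.costs e₀
    have hiff : (BExpr.and enterSel (.or (.nle (.var 33) (.lit 0))
        (.rlt (.col 1 (.var 18)) (.var 3)))).holds τ₀ ↔
        D.Enters e₀ F ∧ (τ.nat 33 0 0 = 0 ∨ rc e₀ < τ.real 3 0 0) := by
      rw [BExpr.holds, enterSel_holds hb₀.tail hb₀.head hF₀ h18, BExpr.holds_or, BExpr.holds_rlt]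
      simp only [BExpr.holds, NExpr.eval, RExpr.eval, h18, hc1, h33, hr, Nat.le_zero]
    have old : ∀ e : Fin m, (e : ℕ) < i + 1 → e = e₀ ∨ (e : ℕ) < i := by
      intro e he
      by_cases hee : (e : ℕ) = i
      · exact .inl (Fin.ext hee)
      · exact .inr (by omega)
    by_cases hc : D.Enters e₀ F ∧ (τ.nat 33 0 0 = 0 ∨ rc e₀ < τ.real 3 0 0)
    · rw [hbody, Prog.exec_ite_pos _ _ _ _ (hiff.2 hc)]
      right
      simp only [Prog.exec_seq, Prog.exec_setReal, Prog.exec_setNat, NExpr.eval, RExpr.eval, h18, hc1,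
        Mem.setNat_nat, Mem.setNat_real, Mem.setReal_real, and_self, if_true, true_and]
      refine ⟨⟨e₀, hc.1, rfl⟩, fun e he hent => ?_⟩
      rcases old e he with rfl | he
      · exact le_rfl
      · rcases hI with ⟨-, h⟩ | ⟨h1, -, h⟩
        · exact absurd hent (h e he)
        · rcases hc.2 with h2 | h2
          · omega
          · exact h2.le.trans (h e he hent)
    · rw [hbody, Prog.exec_ite_neg _ _ _ _ (fun h => hc (hiff.1 h)), Prog.exec_skip, h33, hr]
      rcases hI with ⟨h1, h⟩ | ⟨h1, h2, h⟩
      · refine .inl ⟨h1, fun e he hent => ?_⟩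
        rcases old e he with rfl | he
        · exact hc ⟨hent, .inl h1⟩
        · exact h e he hent
      · refine .inr ⟨h1, h2, fun e he hent => ?_⟩
        rcases old e he with rfl | he
        · by_contra hlt
          exact hc ⟨hent, .inr (not_le.1 hlt)⟩
        · exact h e he hent

/-- Reduce the costs of the arcs entering the selected set. -/
def subProg : Prog :=
  .loop 18 (.var 1) <|
    .ite enterSel (.setReal 1 (.var 18) (.lit 0) (.sub (.col 1 (.var 18)) (.var 3))) .skip

theorem subProg_spec (hb : CostBase D r w rc σ) (hF : SelRow F σ) :
    CostBase D r w (fun e => if D.Enters e F then rc e - σ.real 3 0 0 else rc e)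
      (subProg.exec O σ) := by
  have := Prog.exec_loop (O := O) (x := 18) (e := .var 1) (N := m) (σ := σ)
    (p := .ite enterSel (.setReal 1 (.var 18) (.lit 0) (.sub (.col 1 (.var 18)) (.var 3))) .skip)
    hb.arcs (fun i τ => (∀ e : Fin m, τ.real 1 e 0 = if (e : ℕ) < i ∧ D.Enters e F then
      rc e - σ.real 3 0 0 else rc e) ∧ τ.real 0 = σ.real 0 ∧ τ.real 3 = σ.real 3)
    ⟨fun e => by simpa using hb.costs e, rfl, rfl⟩ (fun i τ hi hf hI => ?_)
  · have hf := subProg.frame O σ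
    refine ⟨?_, ?_, ?_, ?_, ?_, ?_, ?_⟩
    · rw [hf.1 0 rfl, hb.nodes]
    · rw [hf.1 1 rfl, hb.arcs]
    · rw [hf.1 3 rfl]
      exact hb.tail
    · rw [hf.1 4 rfl]
      exact hb.head
    · rw [hf.1 30 rfl, hb.root]
    · rw [hf.2 0 rfl]
      exact hb.weights
    · intro e
      refine (this.1 e).trans ?_
      simp
  · obtain ⟨h1, h2, h3⟩ := hI
    set e₀ : Fin m := ⟨i, hi⟩ with he₀
    set τ₀ := τ.setNat 18 0 0 i with hτ₀
    have hn : ∀ y, y ≠ 18 → τ₀.nat y = τ.nat y := fun y hy => Mem.setNat_nat_of_ne _ _ _ _ hy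
    have hF₀ : SelRow F τ₀ := hF.congr (by rw [hn 31 (by decide), hf.1 31 rfl])
      (by rw [hn 12 (by decide), hf.1 12 rfl])
    have h18 : τ₀.nat 18 0 0 = e₀ := by simp [hτ₀, he₀]
    have hr : τ₀.real = τ.real := rfl
    have hiff : enterSel.holds τ₀ ↔ D.Enters e₀ F := enterSel_holds
      (fun e => by rw [hn 3 (by decide), hf.1 3 rfl, hb.tail])
      (fun e => by rw [hn 4 (by decide), hf.1 4 rfl, hb.head]) hF₀ h18
    have hlt : ¬ ((e₀ : ℕ) < i ∧ D.Enters e₀ F) := by simp [he₀]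
    have hne : ∀ e : Fin m, e ≠ e₀ → (e : ℕ) ≠ i := fun e hee h' => hee (Fin.ext h')
    have old : ∀ e : Fin m, e ≠ e₀ → ((e : ℕ) < i + 1 ↔ (e : ℕ) < i) := by
      intro e hee
      have := hne e hee
      omega
    by_cases hc : D.Enters e₀ F
    · rw [Prog.exec_ite_pos _ _ _ _ (hiff.2 hc), Prog.exec_setReal]
      refine ⟨fun e => ?_, by rw [Mem.setReal_real_of_ne _ _ _ _ (by decide), hr, h2],
        by rw [Mem.setReal_real_of_ne _ _ _ _ (by decide), hr, h3]⟩
      simp only [NExpr.eval, RExpr.eval, h18, hr, Mem.setReal_real, true_and, and_true]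
      by_cases hee : e = e₀
      · subst hee
        rw [if_pos rfl, h1, if_neg hlt, h3, if_pos ⟨by simp [he₀], hc⟩]
      · have := hne e hee
        rw [if_neg this, h1]
        simp only [old e hee]
    · rw [Prog.exec_ite_neg _ _ _ _ (fun h => hc (hiff.1 h)), Prog.exec_skip]
      refine ⟨fun e => ?_, h2, h3⟩
      rw [hr, h1]
      by_cases hee : e = e₀
      · subst hee
        simp [hc]
      · simp only [old e hee]

/-- The first `k` rows of the array `6` are the sets `S i`, and `k` is in the scalar `2`. -/
structure HasFamily (k : ℕ) (S : ℕ → Finset (Fin n)) (σ : Mem) : Prop where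
  count : σ.nat 2 0 0 = k
  row : ∀ i < k, ∀ v : Fin n, σ.nat 6 i v = if v ∈ S i then 1 else 0

theorem HasFamily.congr {k : ℕ} {S : ℕ → Finset (Fin n)} {τ : Mem} (h : HasFamily k S σ)
    (h1 : τ.nat 2 = σ.nat 2) (h2 : τ.nat 6 = σ.nat 6) : HasFamily k S τ :=
  ⟨by rw [h1, h.count], by rw [h2]; exact h.row⟩

/-- Append a set, given by its indicator function, to the family. -/
def appendProg (e : NExpr) : Prog :=
  .seq (.loop 7 (.var 0) (.setNat 6 (.var 2) (.var 7) e))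
    (.setNat 2 (.lit 0) (.lit 0) (.add (.var 2) (.lit 1)))

theorem appendProg_spec {k : ℕ} {S : ℕ → Finset (Fin n)} (hn : σ.nat 0 0 0 = n) (h : HasFamily k S σ)
    {ex : NExpr}
    (hex : ∀ τ : Mem, (∀ y, y ≠ 6 → y ≠ 7 → τ.nat y = σ.nat y) → ∀ v : Fin n, τ.nat 7 0 0 = v →
      ex.eval τ = if v ∈ F then 1 else 0) :
    HasFamily (k + 1) (Function.update S k F) ((appendProg ex).exec O σ) := by
  have := Prog.exec_loop (O := O) (x := 7) (e := .var 0) (N := n) (σ := σ)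
    (p := .setNat 6 (.var 2) (.var 7) ex) hn
    (fun j τ => (∀ i < k, ∀ v : Fin n, τ.nat 6 i v = if v ∈ S i then 1 else 0) ∧
      ∀ v : Fin n, (v : ℕ) < j → τ.nat 6 k v = if v ∈ F then 1 else 0)
    ⟨h.row, by simp⟩ (fun j τ hj hf hI => ?_)
  · have hf := (Prog.loop 7 (.var 0) (.setNat 6 (.var 2) (.var 7) ex)).frame O σ
    set τ := (Prog.loop 7 (.var 0) (.setNat 6 (.var 2) (.var 7) ex)).exec O σ with hτ
    have h2 : τ.nat 2 0 0 = k := by rw [hf.1 2 rfl, h.count]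
    have hexec : (appendProg ex).exec O σ = τ.setNat 2 0 0 (k + 1) := by
      simp only [appendProg, Prog.exec_seq, Prog.exec_setNat, ← hτ, NExpr.eval, h2]
    rw [hexec]
    refine ⟨by simp, fun i hi v => ?_⟩
    rw [Mem.setNat_nat_of_ne _ _ _ _ (by decide)]
    by_cases hik : i = k
    · rw [hik, Function.update_self]
      exact this.2 v v.2
    · rw [Function.update_of_ne hik]
      exact this.1 i (by omega) v
  · have h2 : τ.nat 2 0 0 = k := by rw [hf.1 2 rfl, h.count]
    have hval := hex (τ.setNat 7 0 0 j) (fun y h6 h7 => by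
      rw [Mem.setNat_nat_of_ne _ _ _ _ h7]
      exact hf.1 y (by simp [Prog.writesNat, h6, h7])) ⟨j, hj⟩ (by simp)
    rw [Prog.exec_setNat, hval]
    have e2 : NExpr.eval (τ.setNat 7 0 0 j) (.var 2) = k := by simp [h2]
    have e7 : NExpr.eval (τ.setNat 7 0 0 j) (.var 7) = j := by simp
    rw [e2, e7]
    refine ⟨fun i hi v => ?_, fun v hv => ?_⟩
    · have : i ≠ k := by omega
      simp [this, hI.1 i hi v]
    · by_cases hvj : (v : ℕ) = j
      · obtain rfl : v = ⟨j, hj⟩ := Fin.ext hvj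
        simp
      · simp [hvj, hI.2 v (by omega)]

/-- Mark the sets containing the root. -/
def flagProg : Prog := .loop 9 (.var 0) (.setNat 13 (.var 9) (.lit 0) (.get 31 (.var 9) (.var 30)))

theorem flagProg_spec (hn : σ.nat 0 0 0 = n) (hr : σ.nat 30 0 0 = r) {R : Fin n → Finset (Fin n)}
    (hR : HasReach R σ) (v : Fin n) :
    (flagProg.exec O σ).nat 13 v 0 = if r ∈ R v then 1 else 0 := by
  have := Prog.exec_loop (O := O) (x := 9) (e := .var 0) (N := n) (σ := σ)
    (p := .setNat 13 (.var 9) (.lit 0) (.get 31 (.var 9) (.var 30))) hn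
    (fun i τ => ∀ v : Fin n, (v : ℕ) < i → τ.nat 13 v 0 = if r ∈ R v then 1 else 0) (by simp)
    (fun i τ hi hf hI v hv => ?_)
  · exact this v v.2
  · have h30 : τ.nat 30 0 0 = r := by rw [hf.1 30 rfl, hr]
    have h31 : τ.nat 31 = σ.nat 31 := hf.1 31 rfl
    by_cases hvi : (v : ℕ) = i
    · obtain rfl : v = ⟨i, hi⟩ := Fin.ext hvi
      have := hR ⟨i, hi⟩ r
      simp only at this
      simp [h30, h31, this]
    · simp [hvi, hI v (by omega)]

/-- Add the selected set to the family, if some arc enters it. -/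
def extendProg : Prog :=
  .seq findProg <|
  .ite (.nle (.lit 1) (.var 33)) (.seq subProg (appendProg (.get 31 (.var 12) (.var 7)))) .skip

/-- One step of the dual algorithm. -/
def dualBody : Prog :=
  .seq reachProg <| .seq (sizesProg 31 0) <| .seq flagProg <| .seq (selectProg 0) <|
  .ite (.nle (.add (.var 12) (.lit 1)) (.var 0)) extendProg .skip

/-- Every non-empty set that is closed under predecessors contains the root. -/
def AllReached (D : MultiDigraph (Fin n) (Fin m)) (r : Fin n) (rc : Fin m → ℝ) : Prop :=
  ∀ X : Finset (Fin n), X.Nonempty → (∀ e, rc e ≤ 0 → D.head e ∈ X → D.tail e ∈ X) → r ∈ X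

/-- The hulls containing r are marked, so the selection returns a smallest hull avoiding r or the
sentinel n. The sentinel means that r is in every closed set. If no arc enters the selected hull, no
r-arborescence exists. In both cases the decomposition is final and later rounds do nothing to it.
-/
theorem dualBody_spec (hb : CostBase D r w rc σ) {k : ℕ} {S : ℕ → Finset (Fin n)}
    (hS : HasFamily k S σ) (hd : D.Dual r c k S rc) :
    let τ := dualBody.exec O σ
    CostBase D r w rc τ ∧ HasFamily k S τ ∧ (AllReached D r rc ∨ ∀ B, ¬ D.IsArborescence r B) ∨
    ¬ AllReached D r rc ∧ ∃ S' rc', CostBase D r w rc' τ ∧ HasFamily (k + 1) S' τ ∧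
      D.Dual r c (k + 1) S' rc' := by
  intro τ
  obtain ⟨R, hR, hull⟩ := reachProg_spec (O := O) hb
  have hf1 := reachProg.frame O σ
  set τ₁ := reachProg.exec O σ with hτ₁
  have hb₁ : CostBase D r w rc τ₁ := hb.of_frame hf1 rfl rfl
  have hsize := sizesProg_spec (O := O) (σ := τ₁) (.inr ⟨rfl, rfl⟩) hb₁.nodes hb₁.nodes hR
  have hf2 := (sizesProg 31 0).frame O τ₁
  set τ₂ := (sizesProg 31 0).exec O τ₁ with hτ₂
  have hb₂ : CostBase D r w rc τ₂ := hb₁.of_frame hf2 rfl rfl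
  have hR₂ : HasReach R τ₂ := fun v u => by rw [hf2.1 31 rfl, hR v u]
  have hflag := flagProg_spec (O := O) hb₂.nodes hb₂.root hR₂
  have hf3 := flagProg.frame O τ₂
  set τ₃ := flagProg.exec O τ₂ with hτ₃
  have hb₃ : CostBase D r w rc τ₃ := hb₂.of_frame hf3 rfl rfl
  have hsize₃ : ∀ v : Fin n, τ₃.nat 8 v 0 = (R v).card := fun v => by rw [hf3.1 8 rfl, hsize v]
  obtain ⟨-, hsel⟩ := selectProg_spec (O := O) (σ := τ₃) (.inr rfl) hb₃.nodes hb₃.nodes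
    (fun i hi => by
      rw [hsize₃ ⟨i, hi⟩]
      exact (Finset.card_le_univ _).trans (by simp))
  have hf4 := (selectProg 0).frame O τ₃
  set τ₄ := (selectProg 0).exec O τ₃ with hτ₄
  have hb₄ : CostBase D r w rc τ₄ := hb₃.of_frame hf4 rfl rfl
  have hS₄ : HasFamily k S τ₄ := hS.congr
    (by rw [hf4.1 2 rfl, hf3.1 2 rfl, hf2.1 2 rfl, hf1.1 2 rfl])
    (by rw [hf4.1 6 rfl, hf3.1 6 rfl, hf2.1 6 rfl, hf1.1 6 rfl])
  have hR₄ : HasReach R τ₄ := fun v u => by rw [hf4.1 31 rfl, hf3.1 31 rfl, hR₂ v u]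
  have hexec : τ = (Prog.ite (.nle (.add (.var 12) (.lit 1)) (.var 0)) extendProg .skip).exec O τ₄ := by
    simp only [τ, dualBody, Prog.exec_seq, ← hτ₁, ← hτ₂, ← hτ₃, ← hτ₄]
  rw [hexec]
  rcases hsel with ⟨h12, hall⟩ | ⟨h12, h13, hmin⟩
  · rw [Prog.exec_ite_neg _ _ _ _ (by simp [h12, hb₄.nodes]), Prog.exec_skip]
    refine .inl ⟨hb₄, hS₄, .inl fun X hX hcl => ?_⟩
    obtain ⟨v, hv⟩ := hX
    have := hall v v.2
    rw [hflag] at this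
    -- A closed set contains the hull of each of its nodes, and every hull contains r.
    exact (hull v).least X hcl hv (by by_contra h'; simp [h'] at this)
  · rw [Prog.exec_ite_pos _ _ _ _ (by simp only [BExpr.holds, NExpr.eval, hb₄.nodes]; omega)]
    set v : Fin n := ⟨τ₄.nat 12 0 0, h12⟩ with hv
    have hrv : r ∉ R v := by
      have h := hflag v
      intro h'
      rw [if_pos h', hv] at h
      simp only at h
      omega
    have hminv : ∀ u, r ∉ R u → (R v).card ≤ (R u).card := by
      intro u hu
      have h := hmin u u.2 (by rw [hflag u, if_neg hu])
      rw [hsize₃ u] at h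
      exact (hsize₃ v).symm.le.trans h
    have hF : SelRow (R v) τ₄ := fun u => hR₄ v u
    have hnot : ¬ AllReached D r rc := fun h => hrv (h (R v) ⟨v, (hull v).mem⟩ (hull v).closed)
    rw [extendProg, Prog.exec_seq]
    have hfind := findProg_spec (O := O) hb₄ hF
    have hf5 := findProg.frame O τ₄
    set τ₅ := findProg.exec O τ₄ with hτ₅
    have hb₅ : CostBase D r w rc τ₅ := hb₄.of_frame hf5 rfl rfl
    have hS₅ : HasFamily k S τ₅ := hS₄.congr (hf5.1 2 rfl) (hf5.1 6 rfl)
    rcases hfind with ⟨h33, hno⟩ | ⟨h33, hex, hle⟩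
    · rw [Prog.exec_ite_neg _ _ _ _ (by simp [h33]), Prog.exec_skip]
      refine .inl ⟨hb₅, hS₅, .inr fun B hB => ?_⟩
      have := hB.one_le_enters ⟨v, (hull v).mem⟩ hrv
      obtain ⟨e, he⟩ := Finset.card_pos.1 this
      exact hno e (Finset.mem_filter.1 he).2
    · rw [Prog.exec_ite_pos _ _ _ _ (by simp [h33]), Prog.exec_seq]
      have hF₅ : SelRow (R v) τ₅ := hF.congr (hf5.1 31 rfl) (hf5.1 12 rfl)
      have hb₆ := subProg_spec (O := O) hb₅ hF₅
      have hf6 := subProg.frame O τ₅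
      set τ₆ := subProg.exec O τ₅ with hτ₆
      have hS₆ : HasFamily k S τ₆ := hS₅.congr (hf6.1 2 rfl) (hf6.1 6 rfl)
      have hF₆ : SelRow (R v) τ₆ := hF₅.congr (hf6.1 31 rfl) (hf6.1 12 rfl)
      refine .inr ⟨hnot, _, _, hb₆.of_frame (Prog.frame O _ τ₆) rfl rfl,
        appendProg_spec (F := R v) hb₆.nodes hS₆ (fun υ hυ u hu => ?_), hd.step hull hrv hminv hex hle⟩
      simp only [NExpr.eval, hu]
      rw [hυ 31 (by decide) (by decide), hυ 12 (by decide) (by decide)]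
      exact hF₆ u

end CoverArb

namespace CoverArb

variable {n m : ℕ} {D : MultiDigraph (Fin n) (Fin m)} {r : Fin n} {w : Fin m → ℝ≥0}
  {rc c : Fin m → ℝ} {O : Network → Finset ℕ} {σ : Mem}

/-! ### Initialization and the last step -/

/-- A lower bound for the costs. -/
def lowProg : Prog :=
  .seq (.setReal 2 (.lit 0) (.lit 0) .zero) <|
  .loop 18 (.var 1) <|
    .ite (.rlt (.col 1 (.var 18)) (.var 2)) (.setReal 2 (.lit 0) (.lit 0) (.col 1 (.var 18))) .skip

theorem lowProg_spec (hb : CostBase D r w c σ) (e : Fin m) : (lowProg.exec O σ).real 2 0 0 ≤ c e := by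
  have := Prog.exec_loop (O := O) (x := 18) (e := .var 1) (N := m) (σ := σ.setReal 2 0 0 0)
    (p := .ite (.rlt (.col 1 (.var 18)) (.var 2)) (.setReal 2 (.lit 0) (.lit 0) (.col 1 (.var 18))) .skip)
    hb.arcs (fun i τ => ∀ e : Fin m, (e : ℕ) < i → τ.real 2 0 0 ≤ c e) (by simp)
    (fun i τ hi hf hI e he => ?_)
  · exact this e e.2
  · set τ₀ := τ.setNat 18 0 0 i with hτ₀
    have h1 : τ₀.real 1 i 0 = c ⟨i, hi⟩ := by
      rw [hτ₀, Mem.setNat_real, hf.2 1 rfl, Mem.setReal_real_of_ne _ _ _ _ (by decide)]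
      exact hb.costs ⟨i, hi⟩
    have h18 : τ₀.nat 18 0 0 = i := by simp [hτ₀]
    have hr : τ₀.real = τ.real := rfl
    have hiff : (BExpr.rlt (.col 1 (.var 18)) (.var 2)).holds τ₀ ↔ c ⟨i, hi⟩ < τ.real 2 0 0 := by
      rw [BExpr.holds_rlt]
      simp only [RExpr.eval, NExpr.eval, h18, h1, hr]
    have old : e = ⟨i, hi⟩ ∨ (e : ℕ) < i := by
      by_cases hee : (e : ℕ) = i
      · exact .inl (Fin.ext hee)
      · exact .inr (by omega)
    by_cases hc : c ⟨i, hi⟩ < τ.real 2 0 0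
    · rw [Prog.exec_ite_pos _ _ _ _ (hiff.2 hc), Prog.exec_setReal]
      simp only [NExpr.eval, RExpr.eval, h18, h1, Mem.setReal_real, and_self, if_true]
      rcases old with rfl | he
      · exact le_rfl
      · exact hc.le.trans (hI e he)
    · rw [Prog.exec_ite_neg _ _ _ _ (fun h => hc (hiff.1 h)), Prog.exec_skip, hr]
      rcases old with rfl | he
      · exact not_lt.1 hc
      · exact hI e he

/-- Subtract the lower bound from the costs. -/
def shiftProg : Prog := .loop 18 (.var 1) (.setReal 1 (.var 18) (.lit 0) (.sub (.col 1 (.var 18)) (.var 2)))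

theorem shiftProg_spec (hb : CostBase D r w c σ) :
    CostBase D r w (fun e => c e - σ.real 2 0 0) (shiftProg.exec O σ) := by
  have := Prog.exec_loop (O := O) (x := 18) (e := .var 1) (N := m) (σ := σ)
    (p := .setReal 1 (.var 18) (.lit 0) (.sub (.col 1 (.var 18)) (.var 2)))
    hb.arcs (fun i τ => (∀ e : Fin m, τ.real 1 e 0 = if (e : ℕ) < i then
      c e - σ.real 2 0 0 else c e) ∧ τ.real 2 = σ.real 2)
    ⟨fun e => by simpa using hb.costs e, rfl⟩ (fun i τ hi hf hI => ?_)
  · have hf := shiftProg.frame O σ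
    refine ⟨?_, ?_, ?_, ?_, ?_, ?_, ?_⟩
    · rw [hf.1 0 rfl, hb.nodes]
    · rw [hf.1 1 rfl, hb.arcs]
    · rw [hf.1 3 rfl]
      exact hb.tail
    · rw [hf.1 4 rfl]
      exact hb.head
    · rw [hf.1 30 rfl, hb.root]
    · rw [hf.2 0 rfl]
      exact hb.weights
    · exact fun e => (this.1 e).trans (if_pos e.2)
  · obtain ⟨h1, h2⟩ := hI
    refine ⟨fun e => ?_, by
      rw [Prog.exec_setReal, Mem.setReal_real_of_ne _ _ _ _ (by decide), Mem.setNat_real, h2]⟩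
    by_cases hei : (e : ℕ) = i
    · have h3 := h1 e
      rw [if_neg (by omega), hei] at h3
      simp [hei, h2, h3]
    · have : (e : ℕ) < i + 1 ↔ (e : ℕ) < i := by omega
      simp [hei, h1 e, this]

/-- Turn the arcs entering the root and those of positive reduced cost into loops. -/
def loopProg : Prog :=
  .loop 18 (.var 1) <|
    .ite (.or (.eq (.col 4 (.var 18)) (.var 30)) (.rlt .zero (.col 1 (.var 18))))
      (.setNat 3 (.var 18) (.lit 0) (.col 4 (.var 18))) .skip

theorem loopProg_spec (hb : CostBase D r w rc σ) [DecidablePred fun e => D.head e = r ∨ 0 < rc e] :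
    HasTails 3 (D.looped fun e => D.head e = r ∨ 0 < rc e) (loopProg.exec O σ) := by
  have := Prog.exec_loop (O := O) (x := 18) (e := .var 1) (N := m) (σ := σ)
    (p := .ite (.or (.eq (.col 4 (.var 18)) (.var 30)) (.rlt .zero (.col 1 (.var 18))))
      (.setNat 3 (.var 18) (.lit 0) (.col 4 (.var 18))) .skip) hb.arcs
    (fun i τ => ∀ e : Fin m, τ.nat 3 e 0 = if (e : ℕ) < i then
      ((D.looped fun e => D.head e = r ∨ 0 < rc e).tail e : ℕ) else D.tail e)
    (by simpa using hb.tail) (fun i τ hi hf hI => ?_)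
  · exact fun e => (this e).trans (if_pos e.2)
  · set e₀ : Fin m := ⟨i, hi⟩ with he₀
    set τ₀ := τ.setNat 18 0 0 i with hτ₀
    have hn : ∀ y, y ≠ 18 → τ₀.nat y = τ.nat y := fun y hy => Mem.setNat_nat_of_ne _ _ _ _ hy
    have h18 : τ₀.nat 18 0 0 = e₀ := by simp [hτ₀, he₀]
    have h4 : τ₀.nat 4 e₀ 0 = D.head e₀ := by rw [hn 4 (by decide), hf.1 4 rfl, hb.head]
    have h30 : τ₀.nat 30 0 0 = r := by rw [hn 30 (by decide), hf.1 30 rfl, hb.root]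
    have h1 : τ₀.real 1 e₀ 0 = rc e₀ := by rw [hτ₀, Mem.setNat_real, hf.2 1 rfl, hb.costs]
    have hiff : (BExpr.or (.eq (.col 4 (.var 18)) (.var 30)) (.rlt .zero (.col 1 (.var 18)))).holds τ₀ ↔
        D.head e₀ = r ∨ 0 < rc e₀ := by
      rw [BExpr.holds_or, BExpr.holds_eq, BExpr.holds_rlt]
      simp only [NExpr.eval, RExpr.eval, h18, h4, h30, h1, Fin.val_inj]
    have hne : ∀ e : Fin m, e ≠ e₀ → (e : ℕ) ≠ i := fun e hee h' => hee (Fin.ext h')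
    have old : ∀ e : Fin m, e ≠ e₀ → ((e : ℕ) < i + 1 ↔ (e : ℕ) < i) := by
      intro e hee
      have := hne e hee
      omega
    by_cases hc : D.head e₀ = r ∨ 0 < rc e₀
    · rw [Prog.exec_ite_pos _ _ _ _ (hiff.2 hc), Prog.exec_setNat]
      intro e
      simp only [NExpr.eval, h18, h4, Mem.setNat_nat, true_and, and_true]
      by_cases hee : e = e₀
      · subst hee
        rw [if_pos rfl, if_pos (by simp [he₀])]
        simp only [MultiDigraph.looped, if_pos hc]
      · have := hne e hee
        rw [if_neg this, hn 3 (by decide), hI]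
        simp only [old e hee]
    · rw [Prog.exec_ite_neg _ _ _ _ (fun h => hc (hiff.1 h)), Prog.exec_skip]
      intro e
      rw [hn 3 (by decide), hI]
      by_cases hee : e = e₀
      · subst hee
        rw [if_neg (by simp [he₀]), if_pos (by simp [he₀])]
        simp only [MultiDigraph.looped, if_neg hc]
      · simp only [old e hee]

/-- The part of the program that computes a digraph and a family of sets whose tight arborescences
are the minimum cost arborescences. -/
def dualProg : Prog :=
  .seq (.setNat 30 (.lit 0) (.lit 0) (.var 2)) <|
  .seq (.setNat 2 (.lit 0) (.lit 0) (.lit 0)) <|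
  .seq lowProg <| .seq shiftProg <|
  .seq (.loop 34 (.add (.var 0) (.var 0)) dualBody) <|
  .seq loopProg (appendProg (.lit 1))

/-- The program for minimum cost arborescences. -/
def costProg : Prog := .seq dualProg tightProg

theorem fullFamily_eq_image {k : ℕ} (S : ℕ → Finset (Fin n)) :
    MultiDigraph.fullFamily k S =
      Finset.univ.image fun i : Fin (k + 1) => Function.update S k Finset.univ i := by
  ext F
  rw [MultiDigraph.mem_fullFamily]
  simp only [Finset.mem_image, Finset.mem_univ, true_and]
  constructor
  · rintro (rfl | ⟨i, hi, rfl⟩)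
    · exact ⟨⟨k, by omega⟩, Function.update_self _ _ _⟩
    · exact ⟨⟨i, by omega⟩, Function.update_of_ne (by simp only; omega) _ _⟩
  · rintro ⟨i, rfl⟩
    by_cases hi : (i : ℕ) = k
    · left
      rw [hi, Function.update_self]
    · right
      exact ⟨i, by omega, by rw [Function.update_of_ne hi]⟩

/-- The memory left by the dual phase is a valid input for the tight program. Array 2 has to hold
the number of sets there, so the root is first saved in array 30. The set of all nodes is appended
only at the end, as it contains the root. -/
theorem dualProg_spec (D : MultiDigraph (Fin n) (Fin m)) (r : Fin n) (c : Fin m → ℝ) (w : Fin m → ℝ≥0) :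
    ∃ (D' : MultiDigraph (Fin n) (Fin m)) (k : ℕ) (S : Fin k → Finset (Fin n)),
      k ≤ 2 * n ∧ TightInput D' S w (dualProg.exec O (costInput D r c w)) ∧ Function.Injective S ∧
      IsLaminar (Finset.univ.image S) ∧ Finset.univ ∈ Finset.univ.image S ∧
      ∀ B, D.IsMinCostArborescence c r B ↔ ∃ v, D'.IsTightArborescence (Finset.univ.image S) v B := by
  classical
  set σ := costInput D r c w with hσ
  set τ₁ := (σ.setNat 30 0 0 r).setNat 2 0 0 0 with hτ₁
  have hb₁ : CostBase D r w c τ₁ := by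
    constructor <;> simp [hτ₁, hσ, costInput, scalar, column]
  have h2 : τ₁.nat 2 0 0 = 0 := by simp [hτ₁]
  have hlow := lowProg_spec (O := O) hb₁
  have hf2 := lowProg.frame O τ₁
  set τ₂ := lowProg.exec O τ₁ with hτ₂
  have hb₂ : CostBase D r w c τ₂ := hb₁.of_frame hf2 rfl rfl
  have hb₃ := shiftProg_spec (O := O) hb₂
  have hf3 := shiftProg.frame O τ₂
  set τ₃ := shiftProg.exec O τ₂ with hτ₃
  have hS₃ : HasFamily 0 (fun _ => (∅ : Finset (Fin n))) τ₃ :=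
    ⟨by rw [hf3.1 2 rfl, hf2.1 2 rfl, h2], by simp⟩
  have hd₃ := MultiDigraph.Dual.init D r (fun _ => (∅ : Finset (Fin n))) hlow
  have main := Prog.exec_loop (O := O) (x := 34) (e := .add (.var 0) (.var 0)) (N := n + n) (σ := τ₃)
    (p := dualBody) (by simp only [NExpr.eval, hb₃.nodes])
    (fun j τ => ∃ k S rc, CostBase D r w rc τ ∧ HasFamily k S τ ∧ D.Dual r c k S rc ∧
      ((AllReached D r rc ∨ ∀ B, ¬ D.IsArborescence r B) ∨ j ≤ k))
    ⟨0, _, _, hb₃, hS₃, hd₃, .inr le_rfl⟩ (fun j τ hj hf hI => ?_)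
  · set τ₄ := (Prog.loop 34 (.add (.var 0) (.var 0)) dualBody).exec O τ₃ with hτ₄
    obtain ⟨k, S, rc, hb₄, hS₄, hd, hend⟩ := main
    have hk := hd.card_le
    rw [Fintype.card_fin] at hk
    -- After 2n rounds without completion there would be at least 2n sets, but at most 2n - 2 are
    -- possible.
    have hend' : AllReached D r rc ∨ ∀ B, ¬ D.IsArborescence r B :=
      hend.resolve_right (by omega)
    have ht := loopProg_spec (O := O) hb₄
    have hf5 := loopProg.frame O τ₄
    set τ₅ := loopProg.exec O τ₄ with hτ₅
    have hn₅ : τ₅.nat 0 0 0 = n := by rw [hf5.1 0 rfl, hb₄.nodes]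
    have hS₅ : HasFamily k S τ₅ := hS₄.congr (hf5.1 2 rfl) (hf5.1 6 rfl)
    have hS₆ := appendProg_spec (O := O) (F := Finset.univ) hn₅ hS₅ (ex := .lit 1)
      (fun _ _ v _ => by simp)
    have hf6 := (appendProg (.lit 1)).frame O τ₅
    have hexec : dualProg.exec O σ = (appendProg (.lit 1)).exec O τ₅ := by
      have hr : NExpr.eval σ (.var 2) = r := by simp [hσ, costInput, scalar]
      simp only [dualProg, Prog.exec_seq, Prog.exec_setNat, hr, hτ₅, hτ₄, hτ₃, hτ₂, hτ₁]
      rfl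
    rw [hexec]
    set τ₆ := (appendProg (.lit 1)).exec O τ₅ with hτ₆
    have hfam := fullFamily_eq_image (k := k) S
    refine ⟨D.looped fun e => D.head e = r ∨ 0 < rc e, k + 1,
      fun i => Function.update S k Finset.univ i, by omega, ?_, ?_, ?_, ?_, ?_⟩
    · constructor
      · rw [hf6.1 0 rfl, hn₅]
      · rw [hf6.1 1 rfl, hf5.1 1 rfl, hb₄.arcs]
      · exact hS₆.count
      · intro e
        rw [hf6.1 3 rfl]
        exact ht e
      · intro e
        rw [hf6.1 4 rfl, hf5.1 4 rfl, hb₄.head e]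
        rfl
      · exact fun i v => hS₆.row i i.2 v
      · intro e
        rw [hf6.2 0 rfl, hf5.2 0 rfl, hb₄.weights e]
    · intro i j hij
      -- The appended set is the only one containing r, so it differs from the others.
      have hroot : ∀ i : Fin (k + 1), (r ∈ Function.update S k Finset.univ i) ↔ (i : ℕ) = k := by
        intro i
        by_cases hi : (i : ℕ) = k
        · simp [hi]
        · rw [Function.update_of_ne hi]
          exact iff_of_false (hd.root i (by omega)) hi
      have hij' : Function.update S k Finset.univ i = Function.update S k Finset.univ j := hij
      by_cases hi : (i : ℕ) = k
      · have := (hroot j).1 (hij' ▸ (hroot i).2 hi)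
        exact Fin.ext (hi.trans this.symm)
      · have hj : (j : ℕ) ≠ k := fun hj => hi ((hroot i).1 (hij' ▸ (hroot j).2 hj))
        rw [Function.update_of_ne hi, Function.update_of_ne hj] at hij'
        exact Fin.ext (hd.inj i (by omega) j (by omega) hij')
    · rw [← hfam]
      exact hd.isLaminar_fullFamily
    · rw [← hfam]
      exact MultiDigraph.mem_fullFamily.2 (.inl rfl)
    · intro B
      rw [← hfam]
      exact hd.minCost_iff hend' B
  · obtain ⟨k, S, rc, hb, hS, hd, hend⟩ := hI
    have hn : ∀ y, y ≠ 34 → (τ.setNat 34 0 0 j).nat y = τ.nat y :=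
      fun y hy => Mem.setNat_nat_of_ne _ _ _ _ hy
    rcases dualBody_spec (O := O) (σ := τ.setNat 34 0 0 j) (hb.setNat _ _ _ rfl)
      (hS.congr (hn 2 (by decide)) (hn 6 (by decide))) hd with ⟨h1, h2, h3⟩ | ⟨h1, S', rc', h3, h4, h5⟩
    · exact ⟨k, S, rc, h1, h2, hd, .inl h3⟩
    · refine ⟨k + 1, S', rc', h3, h4, h5, ?_⟩
      rcases hend with (h | h) | h
      · exact absurd h h1
      · exact .inl (.inr h)
      · exact .inr (by omega)

/-- No cut is computed in this phase, so the bound holds without any assumption on T. The hulls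
dominate: n rounds over the arcs, with O(n) work per arc, in each of the 2n steps. -/
theorem costs_dualProg : Costs False dualProg 3 := by
  refine .seq (Light.setNat ..).costs <| .seq (Light.setNat ..).costs <|
    .seq (.seq (Light.setReal ..).costs (Light.loop_arcs _ (.ite _ (.setReal ..) .skip))) <|
    .seq (Light.loop_arcs _ (.setReal ..)) <| .seq (.loop _ linear_two_nodes ?_) <|
    .seq (Light.loop_arcs _ (.ite _ (.setNat ..) .skip)) ?_
  · refine .seq (.seq (Light.costs ?_) (.loop _ linear_nodes (Light.loop_arcs _ ?_))) <|
      .seq (light_sizesProg linear_nodes).costs <| .seq ?_ <|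
      .seq ((light_selectProg linear_nodes).mono (by decide)).costs <|
      .ite _ (.seq ?_ (.ite _ (.seq ?_ ?_) Light.skip.costs)) Light.skip.costs
    · exact .loop _ linear_nodes (.seq (.loop _ linear_nodes (.setNat ..)) (.setNat ..))
    · exact .ite _ (.loop _ linear_nodes (.ite _ (.setNat ..) .skip)) .skip
    · exact Light.loop_nodes _ (.setNat ..)
    · exact .seq (Light.setNat ..).costs
        (Light.loop_arcs _ (.ite _ (.seq (.setReal ..) (.setNat ..)) .skip))
    · exact Light.loop_arcs _ (.ite _ (.setReal ..) .skip)
    · exact .seq (Light.loop_nodes _ (.setNat ..)) (Light.setNat ..).costs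
  · exact .seq (Light.loop_nodes _ (.setNat ..)) (Light.setNat ..).costs

/-- The reduction keeps the nodes, the arcs and the weights, and it identifies the arborescences to
be covered as arc sets. Hence covers, optimality and the bound in n and m carry over. -/
theorem cost_algorithm : ∃ P : Prog, ∀ K : ℕ, ∃ C : ℕ, ∀ T, IsCutTime K T → ∀ O, IsMinCutOracle O →
      ∀ (n m : ℕ) (D : MultiDigraph (Fin n) (Fin m)) (r : Fin n) (c : Fin m → ℝ)
        (w : Fin m → ℝ≥0),
        (P.run O T (costInput D r c w)).2 ≤ C * n ^ 3 * T n m ∧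
        ((∃ H, D.CoversMinCost c r H) →
          IsMinWeight (D.CoversMinCost c r) w
            (outputArcs m (P.run O T (costInput D r c w)).1)) := by
  obtain ⟨A₁, hA₁⟩ := costs_dualProg
  obtain ⟨A₂, hA₂⟩ := tightProg_steps
  refine ⟨costProg, fun K => ⟨(A₁ + A₂) * (K + 1), fun T hT O hO n m D r c w => ?_⟩⟩
  obtain ⟨D', k, S, hk, hin, hinj, hL, hV, hiff⟩ := dualProg_spec (O := O) D r c w
  have hcov : ∀ H, D.CoversMinCost c r H ↔ D'.CoversTight (Finset.univ.image S) H := by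
    intro H
    simp only [MultiDigraph.CoversMinCost, MultiDigraph.CoversTight, hiff]
    exact ⟨fun h v B hB => h B ⟨v, hB⟩, fun h B ⟨v, hB⟩ => h v B hB⟩
  constructor
  · have hTn := hT.2.1 n m
    have hQ : T n m ≤ (K + 1) * T n m := Nat.le_mul_of_pos_left _ (Nat.succ_pos K)
    have hn := r.pos
    have h1 := (Prog.run_snd_le O T dualProg (W := dualProg.writesNat) rfl (fun _ h => h)
      (σ := costInput D r c w) (fun _ _ => rfl)).trans
        (hA₁ T _ n ((K + 1) * T n m) ⟨hn, by omega, by simp [costInput, scalar],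
          by simp [costInput, scalar]; omega, by simp [costInput, scalar]; omega, False.elim⟩)
    have h2 := hA₂ K T hT O n m _ hn hin.nodes hin.arcs (hin.sets.trans_le hk)
    rw [costProg, Prog.run]
    simp only [Prog.run_fst]
    refine (add_le_add h1 h2).trans_eq ?_
    ring
  · rintro ⟨H, hH⟩
    rw [Prog.run_fst, costProg, Prog.exec_seq]
    obtain ⟨h1, h2⟩ := tightProg_spec hO hinj hL hV hin ⟨H, (hcov H).1 hH⟩
    exact ⟨(hcov _).2 h1, fun H' hH' => h2 H' ((hcov H').1 hH')⟩

end CoverArb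

theorem mainTheorem2 :
    -- Correctness of the algorithm, for all choices it can make.
    (∀ (V A : Type*) [Fintype V] [DecidableEq V] [Fintype A] [DecidableEq A]
        (D : MultiDigraph V A) (w : A → ℝ≥0) (L : Finset (Finset V)),
        IsLaminar L → Finset.univ ∈ L →
        (∀ D' L' F, D.FirstPhase w L D' L' → Minimal (fun X => X ∈ L') F →
          ∃ t : {v : V // v ∈ F}, D'.IsAnchorOn w F t) ∧
        (∃ D', D.FirstPhase w L D' ∅) ∧
        (∀ D', D.FirstPhase w L D' ∅ → D'.secondPhase w L = D.gamma w L)) ∧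
    -- Covering the tight arborescences with minimum weight, in time `O(n³ T(n, m))`.
    (∃ P : Prog, ∀ K : ℕ, ∃ C : ℕ, ∀ T, IsCutTime K T → ∀ O, IsMinCutOracle O →
      ∀ (n m k : ℕ) (D : MultiDigraph (Fin n) (Fin m)) (S : Fin k → Finset (Fin n))
        (w : Fin m → ℝ≥0),
        Function.Injective S → IsLaminar (Finset.univ.image S) →
        Finset.univ ∈ Finset.univ.image S →
        (P.run O T (tightInput D S w)).2 ≤ C * n ^ 3 * T n m ∧
        ((∃ H, D.CoversTight (Finset.univ.image S) H) →
          IsMinWeight (D.CoversTight (Finset.univ.image S)) w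
            (outputArcs m (P.run O T (tightInput D S w)).1))) ∧
    -- Covering the minimum cost `r`-arborescences with minimum weight, in time `O(n³ T(n, m))`.
    (∃ P : Prog, ∀ K : ℕ, ∃ C : ℕ, ∀ T, IsCutTime K T → ∀ O, IsMinCutOracle O →
      ∀ (n m : ℕ) (D : MultiDigraph (Fin n) (Fin m)) (r : Fin n) (c : Fin m → ℝ)
        (w : Fin m → ℝ≥0),
        (P.run O T (costInput D r c w)).2 ≤ C * n ^ 3 * T n m ∧
        ((∃ H, D.CoversMinCost c r H) →
          IsMinWeight (D.CoversMinCost c r) w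
            (outputArcs m (P.run O T (costInput D r c w)).1))) := by
  refine ⟨?_, tight_algorithm, cost_algorithm⟩
  · intro V A _ _ _ _ D w L hL hV
    exact ⟨fun D' L' F h hF => h.exists_anchor hL hF.1,
      MultiDigraph.FirstPhase.complete hL _ rfl .start, fun D' h => h.secondPhase_eq hL hV⟩
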